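/- Let $\mathrm{Diff}_+(S^1)$ be the group of orientation-preserving $C^\infty$ diffeomorphisms of the circle, with the $C^\infty$ topology; subgroups carry the subspace topology. Let $\varphi$ be any smooth coordinate on $S^1$ with values in $\mathbb R/2\pi\mathbb Z$ (i.e. the standard angle composed with a diffeomorphism of $S^1$), put $$T=\frac{d}{d\varphi},\qquad S_k=\sin(k\varphi)\,\frac{d}{d\varphi},\qquad C_k=\cos(k\varphi)\,\frac{d}{d\varphi}\qquad(k=1,2,\dots),$$ and let $\mathrm{diff}_0(S^1)$ be the Lie algebra of all finite real linear combinations of $T$, $S_k$, $C_k$. Let $\mathcal S=T^*S^1|_{p>0}$ be the part of the cotangent bundle of $S^1$ where the momentum $p$ (conjugate to the standard angle) is positive. A diffeomorphism $g\in\mathrm{Diff}_+(S^1)$, written in the standard angle as $\vartheta\mapsto\tilde\vartheta$, acts on $\mathcal S$ through its canonical lift $(\vartheta,p)\mapsto(\tilde\vartheta,\;p\,\partial\vartheta/\partial\tilde\vartheta)$. Let $SO^\uparrow(1,2)$ be the group of real $3\times 3$ matrices of determinant $1$ that preserve $x_0^2-x_1^2-x_2^2$ and the direction of time. For $l\ge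 1$, an $l$-fold covering group of $SO^\uparrow(1,2)$ is a connected topological group with a surjective homomorphism onto $SO^\uparrow(1,2)$ that is a covering map and has a kernel of exactly $l$ elements. **Theorem.** (a) Let $G\subset\mathrm{Diff}_+(S^1)$ be a finite-dimensional subgroup generated by elements of $\mathrm{diff}_0(S^1)$, that is, the subgroup generated by the flows of the elements of some finite-dimensional Lie subalgebra $\mathfrak g\subset\mathrm{diff}_0(S^1)$. If the canonical lift of $G$ acts transitively on $\mathcal S$, then $G$ is an $l$-fold covering group of $SO^\uparrow(1,2)$ for some $l\ge 1$; moreover, for every $l\ge1$, $G$ is an $l$-fold covering group of $SO^\uparrow(1,2)$ if and only if $G$ is the subgroup generated by the flows of $l^{-1}T$, $l^{-1}S_l$ and $l^{-1}C_l$. (b) Conversely, for every $l\ge 1$, the subgroup generated by the flows of $l^{-1}T$, $l^{-1}S_l$ and $l^{-1}C_l$ is such a finite-dimensional subgroup, its canonical lift acts transitively on $\mathcal S$, and it is an $l$-fold covering group of $SO^\uparrow(1,2)$. -/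

import Mathlib

open scoped Manifold ContDiff

noncomputable section

namespace CircleDiff

/-! ### Orientation preserving diffeomorphisms of the circle -/

/-- `F : ℝ → ℝ` expresses the circle map `g` in the angular coordinate:
`g (e^{iφ}) = e^{i F(φ)}`. -/
def IsAngleLift (g : Circle → Circle) (F : ℝ → ℝ) : Prop :=
  ∀ φ : ℝ, g (Circle.exp φ) = Circle.exp (F φ)

/-- `Diff₊(S¹)`: the group (under composition) of all `C^∞` diffeomorphisms of the circle that
preserve the orientation, i.e. that are given by an increasing bijection of the angle. -/
def DiffPlus : Subgroup (Equiv.Perm Circle) where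
  carrier := {g | ContMDiff (𝓡 1) (𝓡 1) ∞ g ∧ ContMDiff (𝓡 1) (𝓡 1) ∞ g.symm ∧
    ∃ F : ℝ ≃o ℝ, IsAngleLift g F}
  one_mem' := ⟨contMDiff_id, contMDiff_id, OrderIso.refl ℝ, fun _ => rfl⟩
  mul_mem' := by
    rintro g h ⟨hg, hg', F, hF⟩ ⟨hh, hh', H, hH⟩
    refine ⟨hg.comp hh, hh'.comp hg', H.trans F, fun φ => ?_⟩
    simp only [Equiv.Perm.coe_mul, Function.comp_apply, hH φ, hF (H φ), OrderIso.trans_apply]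
  inv_mem' := by
    rintro g ⟨hg, hg', F, hF⟩
    refine ⟨hg', hg, F.symm, fun φ => ?_⟩
    rw [Equiv.Perm.inv_eq_iff_eq, hF, OrderIso.apply_symm_apply]

/-- The `C^∞` topology on `Diff₊(S¹)`: uniform convergence of the map `φ ↦ g (e^{iφ})` and of each
of its derivatives with respect to `φ`. Subgroups carry the subspace topology. -/
instance : TopologicalSpace DiffPlus :=
  ⨅ k : ℕ, TopologicalSpace.induced
    (fun g : DiffPlus => UniformFun.ofFun
      (iteratedDeriv k (fun φ : ℝ => ((g.1 (Circle.exp φ) : Circle) : ℂ))))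
    inferInstance

/-! ### Vector fields `f(φ) d/dφ` and their flows -/

/-- A circular coordinate ("chart") on `S¹`: the point `q` has the coordinate `φ` (mod `2π`)
determined by `χ q = e^{iφ}`. -/
abbrev Chart : Type := Circle ≃ₘ⟮𝓡 1, 𝓡 1⟯ Circle

/-- `g` is the time `t` map of the flow of the vector field `f(φ) d/dφ`, where `φ` is the
coordinate given by `χ` and `f` is a smooth `2π`-periodic function. -/
def IsFlowMap (χ : Chart) (f : ℝ → ℝ) (t : ℝ) (g : DiffPlus) : Prop :=
  ∃ Φ : ℝ → ℝ → ℝ,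
    (∀ φ, Φ 0 φ = φ) ∧
    (∀ s φ, HasDerivAt (fun r => Φ r φ) (f (Φ s φ)) s) ∧
    ∀ φ, χ (g.1 (χ.symm (Circle.exp φ))) = Circle.exp (Φ t φ)

/-- The subgroup of `Diff₊(S¹)` generated by the one-parameter groups of the vector fields
`f(φ) d/dφ` with `f ∈ X`, in the coordinate given by `χ`. -/
def generatedBy (χ : Chart) (X : Set (ℝ → ℝ)) : Subgroup DiffPlus :=
  Subgroup.closure {g | ∃ f ∈ X, ∃ t : ℝ, IsFlowMap χ f t g}

/-- The coefficient function of `T = d/dφ`. -/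
def vT : ℝ → ℝ := fun _ => 1

/-- The coefficient function of `S_k = sin(kφ) d/dφ`. -/
def vS (k : ℕ) : ℝ → ℝ := fun φ => Real.sin (k * φ)

/-- The coefficient function of `C_k = cos(kφ) d/dφ`. -/
def vC (k : ℕ) : ℝ → ℝ := fun φ => Real.cos (k * φ)

/-- `diff₀(S¹)`: the finite linear combinations of `T`, `S_k`, `C_k`, `k ≥ 1`. -/
def diffZero : Submodule ℝ (ℝ → ℝ) :=
  Submodule.span ℝ ({vT} ∪ {f | ∃ k : ℕ, 1 ≤ k ∧ (f = vS k ∨ f = vC k)})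

/-- The coefficient function of the commutator
`[f d/dφ, g d/dφ] = (f g' - g f') d/dφ`. -/
def bracket (f g : ℝ → ℝ) : ℝ → ℝ := fun φ => f φ * deriv g φ - g φ * deriv f φ

/-- `𝔤` is a finite-dimensional Lie subalgebra of `diff₀(S¹)`. -/
structure IsFinDimSubalgebra (𝔤 : Submodule ℝ (ℝ → ℝ)) : Prop where
  le_diffZero : 𝔤 ≤ diffZero
  finiteDimensional : FiniteDimensional ℝ 𝔤
  bracket_mem : ∀ f ∈ 𝔤, ∀ g ∈ 𝔤, bracket f g ∈ 𝔤

/-- `G` is the finite-dimensional subgroup of `Diff₊(S¹)` generated by (the exponentials of) some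
finite-dimensional Lie algebra of finite linear combinations of `T`, `S_k`, `C_k` in the chart
`χ`. -/
def IsFinDimSubgroupIn (χ : Chart) (G : Subgroup DiffPlus) : Prop :=
  ∃ 𝔤 : Submodule ℝ (ℝ → ℝ), IsFinDimSubalgebra 𝔤 ∧ G = generatedBy χ (𝔤 : Set (ℝ → ℝ))

/-- The three vector fields `l⁻¹ T`, `l⁻¹ S_l`, `l⁻¹ C_l`. -/
def generators (l : ℕ) : Set (ℝ → ℝ) :=
  {(l : ℝ)⁻¹ • vT, (l : ℝ)⁻¹ • vS l, (l : ℝ)⁻¹ • vC l}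

/-! ### The phase space and the canonical lift -/

/-- The phase space `T*S¹|_{p>0}`, where `T*S¹ = S¹ × ℝ` through the canonical coordinates
`(φ, p)`, `(q, p)` standing for the covector `p dφ` at `q`. -/
def phaseSpace : Set (Circle × ℝ) := {x | 0 < x.2}

/-- The derivative `∂φ̃/∂φ` at `q` of the circle map `h : φ ↦ φ̃` with respect to the angle. -/
def angleDeriv (h : Circle → Circle) (q : Circle) : ℝ :=
  deriv (fun t : ℝ => Complex.arg ((h (q * Circle.exp t) / h q : Circle) : ℂ)) 0

/-- The canonical lift of `g : φ ↦ φ̃` to the cotangent bundle (point transformation):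
`(φ, p) ↦ (φ̃, p ∂φ/∂φ̃)`. -/
def cotangentLift (g : DiffPlus) (x : Circle × ℝ) : Circle × ℝ :=
  (g.1 x.1, x.2 * angleDeriv g.1.symm (g.1 x.1))

/-- The canonical lift of `G` acts transitively on `T*S¹|_{p>0}`. -/
def LiftTransitive (G : Subgroup DiffPlus) : Prop :=
  ∀ x ∈ phaseSpace, ∀ y ∈ phaseSpace, ∃ g ∈ G, cotangentLift g x = y

/-! ### The Lorentz group and its covering groups -/

/-- The Minkowski metric on `ℝ^{1+2}`. -/
def minkowski : Matrix (Fin 3) (Fin 3) ℝ := Matrix.diagonal ![1, -1, -1]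

theorem minkowski_sq : minkowski * minkowski = 1 := by
  ext i j
  fin_cases i <;> fin_cases j <;> simp [minkowski]

theorem lorentz_transpose {A : Matrix (Fin 3) (Fin 3) ℝ}
    (h : A.transpose * minkowski * A = minkowski) :
    A * minkowski * A.transpose = minkowski := by
  have h1 : (minkowski * A.transpose * minkowski) * A = 1 := by
    rw [Matrix.mul_assoc, Matrix.mul_assoc, ← Matrix.mul_assoc A.transpose, h, minkowski_sq]
  have h2 : A * (minkowski * A.transpose * minkowski) = 1 := mul_eq_one_comm.mp h1
  calc A * minkowski * A.transpose
      = A * (minkowski * A.transpose * minkowski) * minkowski := by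
        simp only [Matrix.mul_assoc, minkowski_sq, Matrix.mul_one]
    _ = minkowski := by rw [h2, Matrix.one_mul]

theorem lorentz_inv {A : Matrix.SpecialLinearGroup (Fin 3) ℝ}
    (h : A.1.transpose * minkowski * A.1 = minkowski) :
    (A⁻¹).1 = minkowski * A.1.transpose * minkowski := by
  have h1 : (minkowski * A.1.transpose * minkowski) * A.1 = 1 := by
    rw [Matrix.mul_assoc, Matrix.mul_assoc, ← Matrix.mul_assoc A.1.transpose, h, minkowski_sq]
  have h2 : A.1 * (A⁻¹).1 = 1 := by
    rw [← Matrix.SpecialLinearGroup.coe_mul, mul_inv_cancel, Matrix.SpecialLinearGroup.coe_one]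
  calc (A⁻¹).1 = (minkowski * A.1.transpose * minkowski) * A.1 * (A⁻¹).1 := by
        rw [h1, Matrix.one_mul]
    _ = minkowski * A.1.transpose * minkowski := by rw [Matrix.mul_assoc, h2, Matrix.mul_one]

/-- `SO^↑(1,2)`: the real `3 × 3` matrices of determinant `1` that preserve the Minkowski metric
and the direction of time. -/
def SOup : Subgroup (Matrix.SpecialLinearGroup (Fin 3) ℝ) where
  carrier := {A | A.1.transpose * minkowski * A.1 = minkowski ∧ 0 < A.1 0 0}
  one_mem' := by simp
  mul_mem' := by
    rintro A B ⟨hA, hA0⟩ ⟨hB, hB0⟩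
    refine ⟨?_, ?_⟩
    · rw [Matrix.SpecialLinearGroup.coe_mul, Matrix.transpose_mul]
      calc B.1.transpose * A.1.transpose * minkowski * (A.1 * B.1)
          = B.1.transpose * (A.1.transpose * minkowski * A.1) * B.1 := by
            simp only [Matrix.mul_assoc]
        _ = minkowski := by rw [hA, hB]
    · have a := congrFun (congrFun (lorentz_transpose hA) 0) 0
      have b := congrFun (congrFun hB 0) 0
      simp [minkowski, Matrix.mul_apply, Fin.sum_univ_three, Matrix.diagonal_apply] at a b
      rw [Matrix.SpecialLinearGroup.coe_mul, Matrix.mul_apply, Fin.sum_univ_three]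
      set a0 := A.1 0 0
      set a1 := A.1 0 1
      set a2 := A.1 0 2
      set b0 := B.1 0 0
      set b1 := B.1 1 0
      set b2 := B.1 2 0
      have hp : 0 < a0 * b0 := mul_pos hA0 hB0
      have hcs : (a1 * b1 + a2 * b2) ^ 2 < (a0 * b0) ^ 2 := by
        have h1 : (a1 * b1 + a2 * b2) ^ 2 ≤ (a1 ^ 2 + a2 ^ 2) * (b1 ^ 2 + b2 ^ 2) := by
          nlinarith [sq_nonneg (a1 * b2 - a2 * b1)]
        have h2 : a1 ^ 2 + a2 ^ 2 = a0 ^ 2 - 1 := by linarith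
        have h3 : b1 ^ 2 + b2 ^ 2 = b0 ^ 2 - 1 := by linarith
        rw [h2, h3] at h1
        nlinarith [sq_nonneg a1, sq_nonneg a2, sq_nonneg b1, sq_nonneg b2]
      have := (abs_lt_of_sq_lt_sq' hcs hp.le).1
      linarith
  inv_mem' := by
    rintro A ⟨hA, hA0⟩
    have hi := lorentz_inv hA
    refine ⟨?_, ?_⟩
    · rw [hi]
      simp only [Matrix.transpose_mul, Matrix.transpose_transpose]
      have ht : minkowski.transpose = minkowski := Matrix.diagonal_transpose _
      rw [ht]
      calc minkowski * (A.1 * minkowski) * minkowski * (minkowski * A.1.transpose * minkowski)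
          = minkowski * (A.1 * (minkowski * (minkowski * minkowski)) * A.1.transpose)
              * minkowski := by simp only [Matrix.mul_assoc]
        _ = minkowski := by
            rw [minkowski_sq, Matrix.mul_one, lorentz_transpose hA, minkowski_sq, Matrix.one_mul]
    · rw [hi]
      simpa [minkowski, Matrix.mul_apply, Fin.sum_univ_three, Matrix.diagonal_apply] using hA0

/-- The topological group `G` is an `l`-fold covering group of the topological group `H`: it is
connected, and there is a surjective homomorphism `G → H` that is a covering map and whose kernel
has exactly `l` elements (used for `1 ≤ l`). -/
structure IsFoldCoveringGroup (l : ℕ) (G H : Type*) [Group G] [TopologicalSpace G] [Group H]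
    [TopologicalSpace H] : Prop where
  isTopologicalGroup : IsTopologicalGroup G
  connectedSpace : ConnectedSpace G
  exists_covering : ∃ π : G →* H, Function.Surjective π ∧ IsCoveringMap π ∧ Nat.card π.ker = l

end CircleDiff

end

/-!
Identify the circle with the circle of light rays of three-dimensional Minkowski space, the unit
complex number `z` standing for the ray through the null vector `(1, re z, im z)`. The Lorentz group
`SO^↑(1,2)` acts on the rays, and a diffeomorphism `g` of the circle *covers* the Lorentz
transformation `A` with `l` sheets if `A` maps the ray of `z ^ l` to the ray of `g z ^ l`. Let
`lorentzLifts l` be the group of all `g` that cover some `A`.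

**The model group.** The flow of `a + b sin lφ + c cos lφ` covers a one-parameter group of Lorentz
transformations, because a suitably rescaled null vector on the moving ray solves a linear equation
(`exists_covers_of_flow`). Conversely the flows of `l⁻¹ T` and `l⁻¹ S_l` are the rotations and the
explicit `l`-fold lifts of boosts, and the Cartan decomposition `A = R B R'` of the Lorentz group
shows that they generate `lorentzLifts l` (`generatedBy_eq_lorentzLifts`). The homomorphism
`g ↦ A` is surjective and continuous, as `A` can be recovered from three light rays, and its kernel
consists of the `l` deck transformations (`card_ker_lorentzHom`). The Cartan decomposition shows
that `lorentzLifts l` is connected and `σ`-compact, so the homomorphism is open by Baire's theorem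
and therefore a covering (`isFoldCoveringGroup_lorentzLifts`). Rotations and boosts that fix a ray
give transitivity on the phase space (`liftTransitive_lorentzLifts`). All this is transported to an
arbitrary coordinate by conjugation (`chartConj`), which is a homeomorphism for the `C^∞` topology
and preserves transitivity.

**Classification.** Let `𝔤` be a finite-dimensional Lie algebra of trigonometric vector fields and
`N` the largest degree that occurs. If `f` has degree `N` and `g` has degree `n` with `0 < n < N`,
then `[f, g]` has degree `N + n`, which is impossible; so elements of degree `< N` are constant. If
`T ∈ 𝔤` and `N ≥ 1`, this applies to `g'' + N² g` and gives `𝔤 = span (T, S_N, C_N)`. If `T ∉ 𝔤`, the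
leading coefficient embeds `𝔤` into `ℂ`, so that `𝔤` has dimension at most two. Then either `𝔤` is
commutative, and consists of the multiples of one field, or it contains `k` and `h ≠ 0` with
`[k, h] = h` which span it and have a common zero (`IsFinDimSubalgebra.classification`). In these
cases the generated group is commutative or has a fixed point, and cannot act transitively. So a
transitive group is the one generated by `l⁻¹ T`, `l⁻¹ S_l`, `l⁻¹ C_l` for some `l ≥ 1`.

**The number of sheets.** In any covering of the Lorentz group by a connected group the kernel is
the center, since it is discrete and the Lorentz group has trivial center. So the group
alone determines the number of sheets (`IsFoldCoveringGroup.card_center`).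

Continuity in the `C^∞` topology is handled through `Fam`: a map into `DiffPlus` is continuous if
and only if all derivatives along the circle are jointly continuous in the parameter and the point
(`continuous_diffPlus_iff`), and this property is stable under the operations that are used,
in particular under composition and inversion.
-/

namespace CircleDiff

open Complex Filter Topology Function
open scoped ComplexConjugate

/-! ### Derivatives along the circle -/

/-- `H : S¹ → ℂ` has the derivative `d` at `z` with respect to the angle. -/
def HasCircleDeriv (H : Circle → ℂ) (d : ℂ) (z : Circle) : Prop :=
  HasDerivAt (fun s : ℝ => H (z * Circle.exp s)) d 0

theorem hasCircleDeriv_exp {H : Circle → ℂ} {d : ℂ} {φ : ℝ} :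
    HasCircleDeriv H d (Circle.exp φ) ↔ HasDerivAt (fun s : ℝ => H (Circle.exp s)) d φ := by
  have h : (fun s : ℝ => H (Circle.exp φ * Circle.exp s)) =
      fun s : ℝ => (fun r : ℝ => H (Circle.exp r)) (φ + s) := by
    funext s; simp [Circle.exp_add]
  unfold HasCircleDeriv
  rw [h]
  constructor
  · intro h
    have := HasDerivAt.comp_const_add (-φ) φ (by simpa using h)
    simpa using this
  · intro h
    exact HasDerivAt.comp_const_add φ 0 (by simpa using h)

theorem HasCircleDeriv.unique {H : Circle → ℂ} {d e : ℂ} {z : Circle}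
    (h : HasCircleDeriv H d z) (h' : HasCircleDeriv H e z) : d = e :=
  HasDerivAt.unique h h'

theorem hasCircleDeriv_const (c : ℂ) (z : Circle) : HasCircleDeriv (fun _ => c) 0 z :=
  hasDerivAt_const _ _

theorem HasCircleDeriv.add {H K : Circle → ℂ} {d e : ℂ} {z : Circle}
    (h : HasCircleDeriv H d z) (k : HasCircleDeriv K e z) :
    HasCircleDeriv (fun z => H z + K z) (d + e) z :=
  HasDerivAt.add h k

theorem HasCircleDeriv.mul {H K : Circle → ℂ} {d e : ℂ} {z : Circle}
    (h : HasCircleDeriv H d z) (k : HasCircleDeriv K e z) :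
    HasCircleDeriv (fun z => H z * K z) (d * K z + H z * e) z := by
  have := HasDerivAt.mul h k
  simp only [Circle.exp_zero, mul_one] at this
  exact this

theorem HasCircleDeriv.inv {H : Circle → ℂ} {d : ℂ} {z : Circle}
    (h : HasCircleDeriv H d z) (h0 : H z ≠ 0) :
    HasCircleDeriv (fun z => (H z)⁻¹) (-1 * (d * ((H z)⁻¹ * (H z)⁻¹))) z := by
  have := HasDerivAt.inv h (by simpa using h0)
  simp only [Circle.exp_zero, mul_one] at this
  have e : -1 * (d * ((H z)⁻¹ * (H z)⁻¹)) = -d / H z ^ 2 := by field_simp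
  rw [e]
  exact this

theorem HasCircleDeriv.clm {H : Circle → ℂ} {d : ℂ} {z : Circle} (L : ℂ →L[ℝ] ℂ)
    (h : HasCircleDeriv H d z) : HasCircleDeriv (fun z => L (H z)) (L d) z :=
  L.hasFDerivAt.comp_hasDerivAt _ h

/-- The angle of a differentiable curve in the circle, counted from its value at `0`, is
differentiable at `0`. -/
theorem hasDerivAt_angle {u : ℝ → Circle} {d : ℂ}
    (hu : HasDerivAt (fun s => (u s : ℂ)) d 0) :
    HasDerivAt (fun s => Complex.arg ((u s / u 0 : Circle) : ℂ)) (conj (u 0 : ℂ) * d).im 0 := by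
  have h1 : HasDerivAt (fun s => ((u s / u 0 : Circle) : ℂ)) (conj (u 0 : ℂ) * d) 0 := by
    have := hu.mul_const (conj (u 0 : ℂ))
    rw [mul_comm] at this
    refine this.congr_of_eventuallyEq (Eventually.of_forall fun s => ?_)
    change ((u s / u 0 : Circle) : ℂ) = (u s : ℂ) * conj (u 0 : ℂ)
    rw [← Circle.coe_inv_eq_conj, div_eq_mul_inv, Circle.coe_mul]
  have h2 := h1.clog_real (by simp)
  have h3 := Complex.imCLM.hasFDerivAt.comp_hasDerivAt _ h2
  simpa [Function.comp_def, Complex.log_im] using h3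

theorem HasCircleDeriv.comp {H : Circle → ℂ} {u : Circle → Circle} {d e : ℂ} {z : Circle}
    (h : HasCircleDeriv H d (u z)) (hu : HasCircleDeriv (fun z => (u z : ℂ)) e z) :
    HasCircleDeriv (fun z => H (u z)) (((conj (u z : ℂ) * e).im : ℂ) * d) z := by
  have h1 := hasDerivAt_angle (u := fun s => u (z * Circle.exp s)) hu
  simp only [Circle.exp_zero, mul_one] at h1
  have h2 : HasDerivAt (fun s : ℝ => H (u z * Circle.exp s)) d
      (Complex.arg ((u (z * Circle.exp (0 : ℝ)) / u z : Circle) : ℂ)) := by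
    simpa [HasCircleDeriv] using h
  have h3 := h2.scomp (0 : ℝ) h1
  simp only [Function.comp_def, Circle.exp_arg, mul_div_cancel] at h3
  simpa [HasCircleDeriv] using h3

/-- The map `h` of the circle to itself is differentiable at `z`, and `v` is the derivative
`∂φ̃/∂φ` of the angle of its value. -/
def HasAngleDeriv (h : Circle → Circle) (v : ℝ) (z : Circle) : Prop :=
  HasCircleDeriv (fun z => (h z : ℂ)) (v * I * h z) z

theorem Circle.conj_mul_self (z : Circle) : conj (z : ℂ) * z = 1 := by
  rw [← Circle.coe_inv_eq_conj, ← Circle.coe_mul]; simp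

/-- The velocity of a curve in the circle is tangent to the circle. -/
theorem HasCircleDeriv.hasAngleDeriv {h : Circle → Circle} {d : ℂ} {z : Circle}
    (hd : HasCircleDeriv (fun z => (h z : ℂ)) d z) :
    HasAngleDeriv h (conj (h z : ℂ) * d).im z := by
  have h0 : HasCircleDeriv (fun z => (z : ℂ)) (I * h z) (h z) := by
    have : HasDerivAt (fun s : ℝ => Complex.exp (s * I)) I 0 := by
      have := ((hasDerivAt_id (0 : ℝ)).ofReal_comp.mul_const I).cexp
      simpa using this
    have := this.const_mul (h z : ℂ)
    rw [mul_comm] at this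
    simpa [HasCircleDeriv, Circle.coe_exp] using this
  have h1 := h0.comp hd
  unfold HasAngleDeriv
  rwa [← mul_assoc] at h1

theorem HasAngleDeriv.eq {h : Circle → Circle} {d : ℂ} {v : ℝ} {z : Circle}
    (hv : HasAngleDeriv h v z) (hd : HasCircleDeriv (fun z => (h z : ℂ)) d z) :
    (conj (h z : ℂ) * d).im = v := by
  rw [hd.unique hv, mul_comm, mul_assoc, mul_comm (h z : ℂ), Circle.conj_mul_self]
  simp

theorem HasAngleDeriv.comp {g h : Circle → Circle} {v w : ℝ} {z : Circle}
    (hg : HasAngleDeriv g v (h z)) (hh : HasAngleDeriv h w z) :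
    HasAngleDeriv (fun z => g (h z)) (v * w) z := by
  have h1 := HasCircleDeriv.comp hg hh
  rw [hh.eq hh] at h1
  unfold HasAngleDeriv
  convert! h1 using 1
  push_cast; ring

theorem HasAngleDeriv.unique {h : Circle → Circle} {v w : ℝ} {z : Circle}
    (h1 : HasAngleDeriv h v z) (h2 : HasAngleDeriv h w z) : v = w :=
  (h1.eq h1).symm.trans (h2.eq h1)

theorem hasAngleDeriv_id (z : Circle) : HasAngleDeriv (fun z => z) 1 z := by
  have : HasDerivAt (fun s : ℝ => Complex.exp (s * I)) I 0 := by
    have := ((hasDerivAt_id (0 : ℝ)).ofReal_comp.mul_const I).cexp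
    simpa using this
  have := this.const_mul (z : ℂ)
  rw [mul_comm] at this
  simpa [HasAngleDeriv, HasCircleDeriv, Circle.coe_exp] using this

theorem HasAngleDeriv.angleDeriv {h : Circle → Circle} {v : ℝ} {z : Circle}
    (hv : HasAngleDeriv h v z) : angleDeriv h z = v := by
  have h1 := hasDerivAt_angle (u := fun s => h (z * Circle.exp s)) hv
  have h2 := hv.eq hv
  simp only [Circle.exp_zero, mul_one] at h1
  rw [h2] at h1
  exact h1.deriv

/-! ### Smooth families of functions on the circle -/

/-- The family `H p : S¹ → ℂ`, `p ∈ P`, is `k` times differentiable along the circle, with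
derivatives that are jointly continuous in the parameter and the point. -/
def Fam {P : Type*} [TopologicalSpace P] : ℕ → (P → Circle → ℂ) → Prop
  | 0, H => Continuous (uncurry H)
  | k + 1, H => Continuous (uncurry H) ∧
      ∃ H' : P → Circle → ℂ, (∀ p z, HasCircleDeriv (H p) (H' p z) z) ∧ Fam k H'

variable {P Q : Type*} [TopologicalSpace P] [TopologicalSpace Q]

theorem Fam.continuous {k : ℕ} {H : P → Circle → ℂ} (h : Fam k H) : Continuous (uncurry H) := by
  cases k with
  | zero => exact h
  | succ k => exact h.1

theorem Fam.of_succ {k : ℕ} {H : P → Circle → ℂ} (h : Fam (k + 1) H) : Fam k H := by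
  induction k generalizing H with
  | zero => exact h.1
  | succ k ih =>
    obtain ⟨hc, H', hd, hH'⟩ := h
    exact ⟨hc, H', hd, ih hH'⟩

theorem Fam.param {k : ℕ} {H : P → Circle → ℂ} (h : Fam k H) {f : Q → P} (hf : Continuous f) :
    Fam k (fun q => H (f q)) := by
  induction k generalizing H with
  | zero => exact h.continuous.comp (hf.prodMap continuous_id)
  | succ k ih =>
    obtain ⟨hc, H', hd, hH'⟩ := h
    exact ⟨hc.comp (hf.prodMap continuous_id), fun q => H' (f q), fun q z => hd _ z, ih hH'⟩

theorem Fam.paramFun (k : ℕ) {f : P → ℂ} (hf : Continuous f) :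
    Fam k (fun p (_ : Circle) => f p) := by
  induction k generalizing f with
  | zero => exact hf.comp continuous_fst
  | succ k ih =>
    exact ⟨hf.comp continuous_fst, fun _ _ => 0, fun p z => hasCircleDeriv_const _ z,
      ih continuous_const⟩

theorem Fam.add {k : ℕ} {H K : P → Circle → ℂ} (h : Fam k H) (h' : Fam k K) :
    Fam k (fun p z => H p z + K p z) := by
  induction k generalizing H K with
  | zero => exact Continuous.add h h'
  | succ k ih =>
    obtain ⟨hc, H', hd, hH'⟩ := h
    obtain ⟨kc, K', kd, hK'⟩ := h'
    exact ⟨hc.add kc, fun p z => H' p z + K' p z, fun p z => (hd p z).add (kd p z), ih hH' hK'⟩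

theorem Fam.mul {k : ℕ} {H K : P → Circle → ℂ} (h : Fam k H) (h' : Fam k K) :
    Fam k (fun p z => H p z * K p z) := by
  induction k generalizing H K with
  | zero => exact Continuous.mul h h'
  | succ k ih =>
    have h0 := h.of_succ
    have h0' := h'.of_succ
    obtain ⟨hc, H', hd, hH'⟩ := h
    obtain ⟨kc, K', kd, hK'⟩ := h'
    exact ⟨hc.mul kc, fun p z => H' p z * K p z + H p z * K' p z,
      fun p z => (hd p z).mul (kd p z), (ih hH' h0').add (ih h0 hK')⟩

theorem Fam.pow {k : ℕ} {H : P → Circle → ℂ} (h : Fam k H) (n : ℕ) :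
    Fam k (fun p z => H p z ^ n) := by
  induction n with
  | zero => simpa using Fam.paramFun k (P := P) (continuous_const (y := (1 : ℂ)))
  | succ n ih => simpa only [pow_succ] using ih.mul h

theorem Fam.clm {k : ℕ} {H : P → Circle → ℂ} (L : ℂ →L[ℝ] ℂ) (h : Fam k H) :
    Fam k (fun p z => L (H p z)) := by
  induction k generalizing H with
  | zero => exact L.continuous.comp h
  | succ k ih =>
    obtain ⟨hc, H', hd, hH'⟩ := h
    exact ⟨L.continuous.comp hc, fun p z => L (H' p z), fun p z => (hd p z).clm L, ih hH'⟩

theorem Fam.conj {k : ℕ} {H : P → Circle → ℂ} (h : Fam k H) :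
    Fam k (fun p z => (starRingEnd ℂ) (H p z)) :=
  h.clm (Complex.conjCLE : ℂ →L[ℝ] ℂ)

theorem Fam.im {k : ℕ} {H : P → Circle → ℂ} (h : Fam k H) :
    Fam k (fun p z => ((H p z).im : ℂ)) :=
  h.clm (Complex.ofRealCLM.comp Complex.imCLM)

theorem Fam.re {k : ℕ} {H : P → Circle → ℂ} (h : Fam k H) :
    Fam k (fun p z => ((H p z).re : ℂ)) :=
  h.clm (Complex.ofRealCLM.comp Complex.reCLM)

theorem Fam.inv {k : ℕ} {H : P → Circle → ℂ} (h : Fam k H) (h0 : ∀ p z, H p z ≠ 0) :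
    Fam k (fun p z => (H p z)⁻¹) := by
  induction k generalizing H with
  | zero => exact Continuous.inv₀ h fun x => h0 x.1 x.2
  | succ k ih =>
    have h1 := h.of_succ
    obtain ⟨hc, H', hd, hH'⟩ := h
    exact ⟨hc.inv₀ fun x => h0 x.1 x.2, fun p z => -1 * (H' p z * ((H p z)⁻¹ * (H p z)⁻¹)),
      fun p z => (hd p z).inv (h0 p z),
      (Fam.paramFun k continuous_const).mul (hH'.mul ((ih h1 h0).mul (ih h1 h0)))⟩

theorem Fam.continuous_circle {k : ℕ} {u : P → Circle → Circle}
    (h : Fam k (fun p z => (u p z : ℂ))) : Continuous (uncurry u) :=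
  continuous_induced_rng.2 h.continuous

theorem Fam.comp {k : ℕ} {H : P → Circle → ℂ} {u : P → Circle → Circle} (h : Fam k H)
    (hu : Fam k (fun p z => (u p z : ℂ))) : Fam k (fun p z => H p (u p z)) := by
  induction k generalizing H with
  | zero => exact h.continuous.comp (continuous_fst.prodMk hu.continuous_circle)
  | succ k ih =>
    have hu1 := hu.of_succ
    have hcu := hu.continuous_circle
    obtain ⟨hc, H', hd, hH'⟩ := h
    obtain ⟨-, u', hdu, hu'⟩ := hu
    exact ⟨hc.comp (continuous_fst.prodMk hcu), _, fun p z => (hd p (u p z)).comp (hdu p z),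
      ((hu1.conj.mul hu').im).mul (ih hH' hu1)⟩

/-- A continuous family of solutions of the linear equation `u' = v u`, with a coefficient `v`
that is a smooth family, is a smooth family. -/
theorem Fam.of_deriv {k : ℕ} {u v : P → Circle → ℂ} (hu : Continuous (uncurry u))
    (hd : ∀ p z, HasCircleDeriv (u p) (v p z * u p z) z) (hv : ∀ k, Fam k v) : Fam k u := by
  induction k with
  | zero => exact hu
  | succ k ih => exact ⟨hu, _, hd, (hv k).mul ih⟩

/-- The set of all `(p, z)` with `(u p)⁻¹ z ∈ C` is the projection, along the compact circle, of a
closed set. -/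
theorem continuous_symm_of_compact {u : P → Equiv.Perm Circle}
    (hu : Continuous (uncurry fun p z => u p z)) :
    Continuous (uncurry fun p z => (u p).symm z) := by
  rw [continuous_iff_isClosed]
  intro C hC
  have h1 : IsClosed {x : (P × Circle) × Circle | u x.1.1 x.2 = x.1.2 ∧ x.2 ∈ C} := by
    refine IsClosed.inter (isClosed_eq ?_ (by fun_prop)) (hC.preimage continuous_snd)
    exact hu.comp ((continuous_fst.comp continuous_fst).prodMk continuous_snd)
  have h2 := isClosedMap_fst_of_compactSpace _ h1
  convert h2 using 1
  ext ⟨p, z⟩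
  simp only [Set.mem_preimage, uncurry_apply_pair, Set.mem_image, Set.mem_ofPred_eq, Prod.exists,
    Prod.mk.injEq]
  constructor
  · intro h
    exact ⟨p, z, (u p).symm z, ⟨by simp, h⟩, rfl, rfl⟩
  · rintro ⟨p', z', w, ⟨h, hw⟩, rfl, rfl⟩
    rw [← h]; simpa using hw

/-- The derivative of the inverse is the reciprocal of the derivative at the inverse point, so it is
as smooth a family as the inverse itself. -/
theorem Fam.symm {u : P → Equiv.Perm Circle} (hu : ∀ k, Fam k (fun p z => (u p z : ℂ)))
    (hd : ∀ p z, ∃ d, HasCircleDeriv (fun z => ((u p).symm z : ℂ)) d z) (k : ℕ) :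
    Fam k (fun p z => ((u p).symm z : ℂ)) := by
  have hc := continuous_symm_of_compact (hu 0).continuous_circle
  have hcc := (show Continuous (fun z : Circle => (z : ℂ)) by fun_prop).comp hc
  induction k with
  | zero => exact hcc
  | succ k ih =>
    obtain ⟨-, u', hdu, hu'⟩ := hu (k + 1)
    -- `v p z` is the angular derivative of `u p` at `z`
    set v : P → Circle → ℂ := fun p z => ((starRingEnd ℂ (u p z : ℂ) * u' p z).im : ℂ) with hv
    have hvF : Fam k v := ((hu k).conj.mul hu').im
    have key : ∀ p z, ∃ w : ℝ, HasAngleDeriv (u p).symm w z ∧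
        (starRingEnd ℂ (u p ((u p).symm z) : ℂ) * u' p ((u p).symm z)).im * w = 1 := by
      intro p z
      obtain ⟨d, hd⟩ := hd p z
      refine ⟨_, hd.hasAngleDeriv, ?_⟩
      have h1 := ((hdu p ((u p).symm z)).hasAngleDeriv).comp hd.hasAngleDeriv
      simp only [Equiv.apply_symm_apply] at h1
      have := h1.unique (hasAngleDeriv_id z)
      simpa using this
    have hne : ∀ p z, v p z ≠ 0 := by
      intro p z h0
      obtain ⟨w, -, hw⟩ := key p (u p z)
      simp only [hv, ofReal_eq_zero] at h0
      simp only [Equiv.symm_apply_apply, h0, zero_mul] at hw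
      exact zero_ne_one hw
    refine ⟨hcc, fun p z => (v p ((u p).symm z))⁻¹ * I * (u p).symm z, fun p z => ?_, ?_⟩
    · obtain ⟨w, hw, h1⟩ := key p z
      have : (v p ((u p).symm z))⁻¹ = w := by
        refine inv_eq_of_mul_eq_one_right ?_
        simp only [hv]
        exact_mod_cast h1
      simp only [this]
      exact hw
    · have h1 : Fam k (fun p z => v p ((u p).symm z)) := hvF.comp ih
      exact ((h1.inv fun p z => hne _ _).mul (Fam.paramFun k continuous_const)).mul ih

/-! ### The topology of the diffeomorphism group -/

theorem Fam.exists_iteratedDeriv {k : ℕ} {H : P → Circle → ℂ} (h : Fam k H) :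
    ∃ D : P → Circle → ℂ, Continuous (uncurry D) ∧
      ∀ p φ, iteratedDeriv k (fun φ : ℝ => H p (Circle.exp φ)) φ = D p (Circle.exp φ) := by
  induction k generalizing H with
  | zero => exact ⟨H, h, fun p φ => by simp⟩
  | succ k ih =>
    obtain ⟨-, H', hd, hH'⟩ := h
    obtain ⟨D, hD, hD'⟩ := ih hH'
    refine ⟨D, hD, fun p φ => ?_⟩
    rw [iteratedDeriv_succ', ← hD']
    congr 1
    funext s
    exact (hasCircleDeriv_exp.1 (hd p (Circle.exp s))).deriv

theorem continuous_uniformFun_of_circle {D : P → Circle → ℂ} (hD : Continuous (uncurry D)) :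
    Continuous (fun p => UniformFun.ofFun (fun φ : ℝ => D p (Circle.exp φ))) := by
  rw [continuous_iff_continuousAt]
  intro p
  rw [ContinuousAt, UniformFun.tendsto_iff_tendstoUniformly]
  have h1 : Continuous (fun p => (⟨D p, hD.comp (by fun_prop : Continuous fun z => (p, z))⟩ :
      C(Circle, ℂ))) := ContinuousMap.continuous_of_continuous_uncurry _ hD
  have h2 := ContinuousMap.tendsto_iff_tendstoUniformly.1 (h1.tendsto p)
  exact h2.comp Circle.exp

/-- The derivatives of a function on the circle with respect to the angle, as functions on the
circle. -/
noncomputable def circleIteratedDeriv (k : ℕ) (H : Circle → ℂ) (z : Circle) : ℂ :=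
  iteratedDeriv k (fun φ : ℝ => H (Circle.exp φ)) (Complex.arg z)

theorem circleIteratedDeriv_exp (k : ℕ) (H : Circle → ℂ) (φ : ℝ) :
    circleIteratedDeriv k H (Circle.exp φ) =
      iteratedDeriv k (fun φ : ℝ => H (Circle.exp φ)) φ := by
  -- `Complex.arg z` is only one of the angles of `z`, which differ by periods
  obtain ⟨m, hm⟩ := Circle.exp_eq_exp.1 (Circle.exp_arg (Circle.exp φ))
  unfold circleIteratedDeriv
  have h := iteratedDeriv_comp_add_const k (fun φ : ℝ => H (Circle.exp φ)) (m * (2 * Real.pi))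
  have h2 := congrFun h φ
  simp only [Circle.exp_add, Circle.exp_int_mul_two_pi, mul_one] at h2
  rw [hm, ← h2]

theorem isOpenQuotientMap_id_prodMap_exp :
    IsOpenQuotientMap (Prod.map (id : P → P) Circle.exp) :=
  IsOpenQuotientMap.id.prodMap
    ⟨Circle.exp_surjective, Circle.exp.continuous, isLocalHomeomorph_circleExp.isOpenMap⟩

/-- A criterion for a family to be smooth: its members are smooth and all derivatives are jointly
continuous. -/
theorem Fam.of_contDiff {H : P → Circle → ℂ}
    (h : ∀ p, ContDiff ℝ ∞ (fun φ : ℝ => H p (Circle.exp φ)))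
    (hc : ∀ k, Continuous fun x : P × ℝ =>
      iteratedDeriv k (fun φ : ℝ => H x.1 (Circle.exp φ)) x.2) (k : ℕ) : Fam k H := by
  have hD : ∀ n, Continuous (uncurry fun p => circleIteratedDeriv n (H p)) := by
    intro n
    rw [isOpenQuotientMap_id_prodMap_exp.isQuotientMap.continuous_iff]
    simpa only [Function.comp_def, Prod.map, uncurry, id, circleIteratedDeriv_exp] using hc n
  have hF : ∀ j n, Fam j (fun p => circleIteratedDeriv n (H p)) := by
    intro j
    induction j with
    | zero => exact fun n => hD n
    | succ j ih =>
      refine fun n => ⟨hD n, fun p => circleIteratedDeriv (n + 1) (H p), fun p z => ?_, ih _⟩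
      obtain ⟨φ, rfl⟩ := Circle.exp_surjective z
      rw [hasCircleDeriv_exp]
      simp only [circleIteratedDeriv_exp]
      rw [iteratedDeriv_succ]
      exact (((h p).differentiable_iteratedDeriv n (by exact_mod_cast ENat.natCast_lt_top n))
        φ).hasDerivAt
  have e : H = fun p => circleIteratedDeriv 0 (H p) := by
    funext p z
    obtain ⟨φ, rfl⟩ := Circle.exp_surjective z
    simp [circleIteratedDeriv_exp]
  rw [e]
  exact hF k 0

theorem contDiff_coe_comp_exp {u : Circle → Circle} (hu : ContMDiff (𝓡 1) (𝓡 1) ∞ u) :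
    ContDiff ℝ ∞ (fun φ : ℝ => (u (Circle.exp φ) : ℂ)) := by
  have h := hu.comp (contMDiff_circleExp (m := ∞))
  rw [← contMDiff_iff_contDiff]
  have : Fact (Module.finrank ℝ ℂ = 1 + 1) := finrank_real_complex_fact'
  exact (contMDiff_coe_sphere (E := ℂ) (n := 1)).comp h

theorem fam_of_contMDiff {u : Circle → Circle} (hu : ContMDiff (𝓡 1) (𝓡 1) ∞ u) (k : ℕ) :
    Fam k (fun (_ : P) z => (u z : ℂ)) :=
  Fam.of_contDiff (fun _ => contDiff_coe_comp_exp hu) (fun k =>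
    ((contDiff_coe_comp_exp hu).continuous_iteratedDeriv k
      (by exact_mod_cast le_top)).comp continuous_snd) k

/-- The tautological family of all diffeomorphisms is smooth. -/
theorem fam_diffPlus (k : ℕ) : Fam k (fun (g : DiffPlus) z => (g.1 z : ℂ)) := by
  refine Fam.of_contDiff (fun g => contDiff_coe_comp_exp g.2.1) (fun k => ?_) k
  rw [continuous_iff_continuousAt]
  rintro ⟨g, φ⟩
  have hT : Continuous (fun g : DiffPlus => UniformFun.ofFun
      (iteratedDeriv k (fun φ : ℝ => ((g.1 (Circle.exp φ) : Circle) : ℂ)))) :=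
    continuous_iInf_dom (i := k) continuous_induced_dom
  have h1 := UniformFun.tendsto_iff_tendstoUniformly.1 (hT.tendsto g)
  have h2 : ContinuousAt (iteratedDeriv k
      (fun φ : ℝ => ((g.1 (Circle.exp φ) : Circle) : ℂ))) φ :=
    ((contDiff_coe_comp_exp g.2.1).continuous_iteratedDeriv k
      (by exact_mod_cast le_top)).continuousAt
  have h3 : TendstoUniformly (fun (x : DiffPlus × ℝ) => iteratedDeriv k
      (fun φ : ℝ => ((x.1.1 (Circle.exp φ) : Circle) : ℂ)))
      (iteratedDeriv k (fun φ : ℝ => ((g.1 (Circle.exp φ) : Circle) : ℂ))) (𝓝 (g, φ)) := by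
    intro u hu
    exact (continuous_fst.tendsto (g, φ)).eventually (h1 u hu)
  exact h3.tendsto_comp h2 (continuous_snd.tendsto (g, φ))

/-- The universal property of the `C^∞` topology. -/
theorem continuous_diffPlus_iff {f : P → DiffPlus} :
    Continuous f ↔ ∀ k, Fam k (fun p z => ((f p).1 z : ℂ)) := by
  refine ⟨fun hf k => (fam_diffPlus k).param hf, fun h => ?_⟩
  refine continuous_iInf_rng.2 fun k => continuous_induced_rng.2 ?_
  obtain ⟨D, hD, hD'⟩ := (h k).exists_iteratedDeriv
  have := continuous_uniformFun_of_circle hD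
  convert this using 2 with p
  simp only [Function.comp_apply]
  congr 1
  funext φ
  exact hD' p φ

theorem exists_hasCircleDeriv (g : DiffPlus) (z : Circle) :
    ∃ d, HasCircleDeriv (fun z => (g.1 z : ℂ)) d z := by
  obtain ⟨-, H', h, -⟩ := fam_diffPlus 1
  exact ⟨_, h g z⟩

instance : IsTopologicalGroup DiffPlus where
  continuous_mul := continuous_diffPlus_iff.2 fun k =>
    Fam.comp (H := fun (p : DiffPlus × DiffPlus) z => (p.1.1 z : ℂ))
      ((fam_diffPlus k).param continuous_fst) ((fam_diffPlus k).param continuous_snd)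
  continuous_inv := continuous_diffPlus_iff.2 fun k =>
    Fam.symm (u := fun g : DiffPlus => g.1) fam_diffPlus
      (fun g z => exists_hasCircleDeriv g⁻¹ z) k

theorem continuous_eval_diffPlus (z : Circle) : Continuous (fun g : DiffPlus => g.1 z) :=
  (fam_diffPlus 0).continuous_circle.comp (by fun_prop : Continuous fun g : DiffPlus => (g, z))

end CircleDiff

namespace CircleDiff

open Complex Filter Topology Function
open scoped ComplexConjugate

variable {P : Type*} [TopologicalSpace P]

/-! ### Lifts to the angle -/

theorem IsAngleLift.hasAngleDeriv {h : Circle → Circle} {F : ℝ → ℝ} (hF : IsAngleLift h F)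
    {v φ : ℝ} (hv : HasDerivAt F v φ) : HasAngleDeriv h v (Circle.exp φ) := by
  unfold HasAngleDeriv
  rw [hasCircleDeriv_exp, hF φ]
  simp only [hF _, Circle.coe_exp]
  have := (hv.ofReal_comp.mul_const I).cexp
  convert! this using 1
  ring

theorem IsAngleLift.contMDiff {h : Circle → Circle} {F : ℝ → ℝ} (hF : IsAngleLift h F)
    (hs : ContDiff ℝ ∞ F) : ContMDiff (𝓡 1) (𝓡 1) ∞ h := by
  intro q
  -- near `q`, the angle counted from `q` is a smooth function of the point
  have e : h = fun z : Circle =>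
      Circle.exp (F (Complex.arg q + Complex.arg ((z : ℂ) * conj (q : ℂ)))) := by
    funext z
    rw [← hF, Circle.exp_add, ← Circle.coe_inv_eq_conj, ← Circle.coe_mul, Circle.exp_arg,
      Circle.exp_arg, mul_comm z, mul_inv_cancel_left]
  have : Fact (Module.finrank ℝ ℂ = 1 + 1) := finrank_real_complex_fact'
  have h1 : ContMDiff (𝓡 1) 𝓘(ℝ, ℂ) ∞ (fun z : Circle => (z : ℂ)) :=
    contMDiff_coe_sphere (E := ℂ) (n := 1)
  have h2 : ContDiffAt ℝ ∞
      (fun w : ℂ => F (Complex.arg q + Complex.arg (w * conj (q : ℂ)))) q := by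
    refine hs.contDiffAt.comp _ (contDiffAt_const.add ?_)
    have h3 : ContDiffAt ℝ ∞ (fun w : ℂ => Complex.log (w * conj (q : ℂ))) q := by
      refine ContDiffAt.comp (q : ℂ) (g := Complex.log)
        ((Complex.contDiffAt_log ?_).restrict_scalars ℝ) (by fun_prop)
      rw [mul_comm, Circle.conj_mul_self]; simp
    simpa only [Function.comp_def, Complex.imCLM_apply, Complex.log_im] using
      Complex.imCLM.contDiff.contDiffAt.comp _ h3
  rw [e]
  have h4 : ContMDiffAt (𝓡 1) 𝓘(ℝ, ℝ) ∞
      (fun z : Circle => F (Complex.arg q + Complex.arg ((z : ℂ) * conj (q : ℂ)))) q :=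
    ContMDiffAt.comp (g := fun w : ℂ => F (Complex.arg q + Complex.arg (w * conj (q : ℂ)))) q
      h2.contMDiffAt (h1 q)
  exact contMDiff_circleExp.contMDiffAt.comp q h4

theorem exists_angleLift {u : Circle → Circle} (hu : Continuous u) :
    ∃ X : ℝ → ℝ, Continuous X ∧ IsAngleLift u X := by
  obtain ⟨X, ⟨-, hX⟩, -⟩ := Circle.isCoveringMap_exp.existsUnique_continuousMap_lifts
    (⟨fun φ => u (Circle.exp φ), by fun_prop⟩ : C(ℝ, Circle)) 0
    (Complex.arg (u (Circle.exp 0))) (by simp [Circle.exp_arg])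
  exact ⟨X, X.continuous, fun φ => (congrFun hX φ).symm⟩

theorem exists_const_of_exp_eq_one {f : ℝ → ℝ} (hf : Continuous f)
    (h : ∀ x, Circle.exp (f x) = 1) : ∃ c, ∀ x, f x = c := by
  obtain ⟨c, -, hc⟩ := isPreconnected_univ.eqOn_const_of_mapsTo
    (T := (AddSubgroup.zmultiples (2 * Real.pi) : Set ℝ))
    ⟨NormedSpace.discreteTopology_zmultiples _⟩ hf.continuousOn
    (fun x _ => by
      obtain ⟨n, hn⟩ := Circle.exp_eq_one.1 (h x)
      exact AddSubgroup.mem_zmultiples_iff.2 ⟨n, by simp [hn]⟩) ⟨0, zero_mem _⟩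
  exact ⟨c, fun x => hc (Set.mem_univ x)⟩

/-- The angle of a homeomorphism of the circle is a homeomorphism of the line. -/
theorem exists_angleLift_homeo (χ : Circle ≃ₜ Circle) :
    ∃ X : ℝ → ℝ, Continuous X ∧ Bijective X ∧ IsAngleLift χ X := by
  obtain ⟨X, hX, hXl⟩ := exists_angleLift χ.continuous
  obtain ⟨Y, hY, hYl⟩ := exists_angleLift χ.symm.continuous
  obtain ⟨c, hc⟩ := exists_const_of_exp_eq_one (f := fun x => X (Y x) - x) (by fun_prop)
    (fun x => by rw [Circle.exp_sub, ← hXl, ← hYl]; simp)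
  obtain ⟨d, hd⟩ := exists_const_of_exp_eq_one (f := fun x => Y (X x) - x) (by fun_prop)
    (fun x => by rw [Circle.exp_sub, ← hYl, ← hXl]; simp)
  refine ⟨X, hX, ⟨fun x y h => ?_, fun x => ⟨Y (x - c), ?_⟩⟩, hXl⟩
  · have h1 := hd x
    have h2 := hd y
    rw [h] at h1
    linarith
  · have := hc (x - c)
    linarith

/-! ### Change of the coordinate -/

/-- Conjugation by a diffeomorphism of the circle, which need not preserve the orientation. -/
def chartConj (χ : Chart) : DiffPlus →* DiffPlus where
  toFun g := ⟨χ.toEquiv.permCongrHom g.1, by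
    obtain ⟨g, hg, hg', F, hF⟩ := g
    refine ⟨χ.contMDiff.comp (hg.comp χ.symm.contMDiff),
      χ.contMDiff.comp (hg'.comp χ.symm.contMDiff), ?_⟩
    obtain ⟨X, hXc, hXb, hX⟩ := exists_angleLift_homeo χ.toHomeomorph
    have hinv : ∀ φ, X ((Equiv.ofBijective X hXb).symm φ) = φ :=
      (Equiv.ofBijective X hXb).apply_symm_apply
    have hinv' : ∀ φ, (Equiv.ofBijective X hXb).symm (X φ) = φ :=
      (Equiv.ofBijective X hXb).symm_apply_apply
    have hmono : StrictMono fun φ => X (F ((Equiv.ofBijective X hXb).symm φ)) := by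
      intro s t hst
      obtain ⟨s, rfl⟩ := hXb.2 s
      obtain ⟨t, rfl⟩ := hXb.2 t
      simp only [hinv']
      -- the lift of `χ` is monotone or antitone, and occurs twice
      rcases hXc.strictMono_of_inj hXb.1 with h | h
      · exact h (F.strictMono (h.lt_iff_lt.1 hst))
      · exact h (F.strictMono (h.lt_iff_gt.1 hst))
    refine ⟨hmono.orderIsoOfSurjective _ ?_, ?_⟩
    · exact hXb.2.comp (F.surjective.comp (Equiv.surjective _))
    · intro φ
      obtain ⟨φ, rfl⟩ := hXb.2 φ
      simp only [StrictMono.coe_orderIsoOfSurjective, hinv']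
      rw [← hX, ← hX, ← hF]
      change χ (g (χ.symm (χ _))) = χ _
      rw [χ.symm_apply_apply]⟩
  map_one' := Subtype.ext (map_one χ.toEquiv.permCongrHom)
  map_mul' g h := Subtype.ext (map_mul χ.toEquiv.permCongrHom g.1 h.1)

theorem chartConj_apply (χ : Chart) (g : DiffPlus) (z : Circle) :
    (chartConj χ g).1 z = χ (g.1 (χ.symm z)) := rfl

theorem chartConj_symm_chartConj (χ : Chart) (g : DiffPlus) :
    chartConj χ.symm (chartConj χ g) = g := by
  refine Subtype.ext (Equiv.ext fun z => ?_)
  rw [chartConj_apply, chartConj_apply]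
  change χ.symm (χ (g.1 (χ.symm (χ z)))) = g.1 z
  simp

theorem chartConj_chartConj_symm (χ : Chart) (g : DiffPlus) :
    chartConj χ (chartConj χ.symm g) = g :=
  chartConj_symm_chartConj χ.symm g

theorem continuous_chartConj (χ : Chart) : Continuous (chartConj χ) := by
  refine continuous_diffPlus_iff.2 fun k => ?_
  have h1 : Fam k (fun (g : DiffPlus) z => (g.1 (χ.symm z) : ℂ)) :=
    Fam.comp (H := fun (g : DiffPlus) z => (g.1 z : ℂ)) (fam_diffPlus k)
      (fam_of_contMDiff χ.symm.contMDiff k)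
  exact Fam.comp (H := fun (_ : DiffPlus) z => (χ z : ℂ)) (fam_of_contMDiff χ.contMDiff k) h1

/-! ### Rotations -/

/-- The rotation of the circle by the angle `θ`. -/
noncomputable def rot (θ : ℝ) : DiffPlus :=
  ⟨Equiv.mulLeft (Circle.exp θ), by
    have h : ∀ θ, IsAngleLift (Equiv.mulLeft (Circle.exp θ)) (OrderIso.addLeft θ) := fun θ φ => by
      simp [Circle.exp_add]
    have h' := h (-θ)
    rw [Circle.exp_neg] at h'
    exact ⟨(h θ).contMDiff (contDiff_const.add contDiff_id),
      h'.contMDiff (contDiff_const.add contDiff_id), OrderIso.addLeft θ, h θ⟩⟩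

@[simp]
theorem rot_apply (θ : ℝ) (z : Circle) : (rot θ).1 z = Circle.exp θ * z := rfl

theorem rot_add (s t : ℝ) : rot (s + t) = rot s * rot t :=
  Subtype.ext (Equiv.ext fun z => by
    change Circle.exp (s + t) * z = Circle.exp s * (Circle.exp t * z)
    rw [Circle.exp_add, mul_assoc])

theorem fam_coe (k : ℕ) : Fam k (fun (_ : P) (z : Circle) => (z : ℂ)) :=
  fam_of_contMDiff contMDiff_id k

theorem continuous_rot : Continuous rot := by
  refine continuous_diffPlus_iff.2 fun k => ?_
  simp only [rot_apply, Circle.coe_mul]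
  exact (Fam.paramFun k (by fun_prop)).mul (fam_coe k)

/-! ### Boosts -/

section BoostLift

open Real

variable {a : ℝ}

theorem one_add_mul_cos_pos (ha : |a| < 1) (ψ : ℝ) : 0 < 1 + a * Real.cos ψ := by
  have h1 : |a * Real.cos ψ| < 1 := by
    rw [abs_mul]
    exact (mul_le_of_le_one_right (abs_nonneg _) (Real.abs_cos_le_one ψ)).trans_lt ha
  linarith [(abs_lt.1 h1).1]

theorem boost_denom_eq (a ψ : ℝ) : 1 + 2 * a * Real.cos ψ + a ^ 2 =
    (1 + a * Real.cos ψ) ^ 2 + (a * Real.sin ψ) ^ 2 := by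
  linear_combination a ^ 2 * (-(Real.sin_sq_add_cos_sq ψ))

theorem boost_denom_pos (ha : |a| < 1) (ψ : ℝ) : 0 < 1 + 2 * a * Real.cos ψ + a ^ 2 := by
  rw [boost_denom_eq]
  have := one_add_mul_cos_pos ha ψ
  positivity

/-- The Möbius transformation `w ↦ (w + a) / (1 + a w)` of the circle turns `e^{iψ}` by the angle
`- boostAngle a ψ`. -/
noncomputable def boostAngle (a ψ : ℝ) : ℝ :=
  2 * Real.arctan (a * Real.sin ψ / (1 + a * Real.cos ψ))

theorem cos_boostAngle (ha : |a| < 1) (ψ : ℝ) : Real.cos (boostAngle a ψ) =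
    ((1 + a * Real.cos ψ) ^ 2 - (a * Real.sin ψ) ^ 2) / (1 + 2 * a * Real.cos ψ + a ^ 2) := by
  have h := (one_add_mul_cos_pos ha ψ).ne'
  have h' := (boost_denom_pos ha ψ).ne'
  rw [boostAngle, Real.cos_two_mul, Real.cos_sq_arctan]
  rw [boost_denom_eq] at h' ⊢
  field_simp
  ring

theorem sin_boostAngle (ha : |a| < 1) (ψ : ℝ) : Real.sin (boostAngle a ψ) =
    2 * (1 + a * Real.cos ψ) * (a * Real.sin ψ) / (1 + 2 * a * Real.cos ψ + a ^ 2) := by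
  have h := (one_add_mul_cos_pos ha ψ).ne'
  have h' := (boost_denom_pos ha ψ).ne'
  have e : Real.sin (boostAngle a ψ) = 2 * (a * Real.sin ψ / (1 + a * Real.cos ψ)) *
      Real.cos (Real.arctan (a * Real.sin ψ / (1 + a * Real.cos ψ))) ^ 2 := by
    rw [boostAngle, Real.sin_two_mul, Real.sin_arctan, Real.cos_arctan]
    ring
  rw [e, Real.cos_sq_arctan]
  rw [boost_denom_eq] at h' ⊢
  field_simp

theorem cos_sub_boostAngle (ha : |a| < 1) (ψ : ℝ) : Real.cos (ψ - boostAngle a ψ) =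
    ((1 + a ^ 2) * Real.cos ψ + 2 * a) / (1 + 2 * a * Real.cos ψ + a ^ 2) := by
  rw [Real.cos_sub, cos_boostAngle ha, sin_boostAngle ha, mul_div_assoc', mul_div_assoc',
    ← add_div]
  congr 1
  linear_combination (2 * a + a ^ 2 * Real.cos ψ) * Real.sin_sq_add_cos_sq ψ

theorem sin_sub_boostAngle (ha : |a| < 1) (ψ : ℝ) : Real.sin (ψ - boostAngle a ψ) =
    (1 - a ^ 2) * Real.sin ψ / (1 + 2 * a * Real.cos ψ + a ^ 2) := by
  rw [Real.sin_sub, cos_boostAngle ha, sin_boostAngle ha, mul_div_assoc', mul_div_assoc',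
    ← sub_div]
  congr 1
  linear_combination (-a ^ 2 * Real.sin ψ) * Real.sin_sq_add_cos_sq ψ

/-- The Möbius transformations with the parameters `a` and `-a` are inverse to each other. -/
theorem boostAngle_neg_sub (ha : |a| < 1) (ψ : ℝ) :
    boostAngle (-a) (ψ - boostAngle a ψ) = -boostAngle a ψ := by
  have h := (one_add_mul_cos_pos ha ψ).ne'
  have h' := (boost_denom_pos ha ψ).ne'
  have ha2 : 1 - a ^ 2 ≠ 0 := by
    have := (sq_lt_one_iff_abs_lt_one a).2 ha
    linarith
  have e : -a * Real.sin (ψ - boostAngle a ψ) / (1 + -a * Real.cos (ψ - boostAngle a ψ)) =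
      -(a * Real.sin ψ / (1 + a * Real.cos ψ)) := by
    rw [cos_sub_boostAngle ha, sin_sub_boostAngle ha]
    have e2 : 1 + -a * (((1 + a ^ 2) * Real.cos ψ + 2 * a) / (1 + 2 * a * Real.cos ψ + a ^ 2)) =
        (1 - a ^ 2) * (1 + a * Real.cos ψ) / (1 + 2 * a * Real.cos ψ + a ^ 2) := by
      rw [mul_div_assoc', eq_div_iff h', add_mul, div_mul_cancel₀ _ h']
      ring
    rw [e2, mul_div_assoc', div_div_div_cancel_right₀ h', ← neg_div]
    field_simp
  unfold boostAngle at e ⊢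
  rw [e, Real.arctan_neg, mul_neg]

/-- The chain rule for `ψ - boostAngle a ψ`, with both the parameter and the angle varying. -/
theorem hasDerivAt_sub_boostAngle {f g : ℝ → ℝ} {a' ψ' t : ℝ} (hf : HasDerivAt f a' t)
    (hg : HasDerivAt g ψ' t) (ha : |f t| < 1) :
    HasDerivAt (fun t => g t - boostAngle (f t) (g t))
      (((1 - f t ^ 2) * ψ' - 2 * Real.sin (g t) * a') /
        (1 + 2 * f t * Real.cos (g t) + f t ^ 2)) t := by
  have h := (one_add_mul_cos_pos ha (g t)).ne'
  have h' := (boost_denom_pos ha (g t)).ne'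
  have h1 := (((hf.mul hg.sin).div ((hf.mul hg.cos).const_add 1) h).arctan).const_mul 2
  have h2 := hg.sub h1
  unfold boostAngle
  convert! h2 using 1
  rw [boost_denom_eq] at h' ⊢
  simp only [Pi.mul_apply, Pi.div_apply]
  field_simp
  linear_combination (ψ' * f t ^ 2) * Real.sin_sq_add_cos_sq (g t)

end BoostLift

/-- The `l`-fold lift of the Möbius transformation `w ↦ (w + a) / (1 + a w)`, as a map of the
line. -/
noncomputable def boostLift (l : ℕ) (a φ : ℝ) : ℝ := φ - (l : ℝ)⁻¹ * boostAngle a (l * φ)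

theorem mul_boostLift {l : ℕ} (hl : l ≠ 0) (a φ : ℝ) :
    l * boostLift l a φ = l * φ - boostAngle a (l * φ) := by
  have : (l : ℝ) ≠ 0 := by exact_mod_cast hl
  unfold boostLift
  field_simp

theorem boostLift_neg_boostLift {l : ℕ} (hl : l ≠ 0) {a : ℝ} (ha : |a| < 1) (φ : ℝ) :
    boostLift l (-a) (boostLift l a φ) = φ := by
  rw [boostLift, mul_boostLift hl, boostAngle_neg_sub ha]
  unfold boostLift
  ring

theorem hasDerivAt_boostLift {l : ℕ} (hl : l ≠ 0) {a : ℝ} (ha : |a| < 1) (φ : ℝ) :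
    HasDerivAt (boostLift l a)
      ((1 - a ^ 2) / (1 + 2 * a * Real.cos (l * φ) + a ^ 2)) φ := by
  have hl' : (l : ℝ) ≠ 0 := by exact_mod_cast hl
  have h := (hasDerivAt_sub_boostAngle (hasDerivAt_const φ a)
    ((hasDerivAt_id φ).const_mul (l : ℝ)) ha).const_mul (l : ℝ)⁻¹
  have e : boostLift l a = fun φ : ℝ => (l : ℝ)⁻¹ * (l * id φ - boostAngle a (l * id φ)) := by
    funext φ
    simp only [id, boostLift]
    field_simp
  rw [e]
  convert! h using 1
  simp only [id]
  field_simp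
  ring

theorem contDiff_boostLift {l : ℕ} {a : ℝ} (ha : |a| < 1) : ContDiff ℝ ∞ (boostLift l a) := by
  unfold boostLift boostAngle
  have h : ∀ φ : ℝ, 1 + a * Real.cos (l * φ) ≠ 0 := fun φ => (one_add_mul_cos_pos ha _).ne'
  exact contDiff_id.sub (contDiff_const.mul (contDiff_const.mul (Real.contDiff_arctan.comp
    (ContDiff.div (by fun_prop) (by fun_prop) h))))

/-- The map `boostLift l a` as an order isomorphism of the line. -/
noncomputable def boostIso (l : ℕ) (hl : l ≠ 0) (a : ℝ) (ha : |a| < 1) : ℝ ≃o ℝ :=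
  StrictMono.orderIsoOfRightInverse (boostLift l a)
    (strictMono_of_deriv_pos fun φ => by
      rw [(hasDerivAt_boostLift hl ha φ).deriv]
      have := (sq_lt_one_iff_abs_lt_one a).2 ha
      exact div_pos (by linarith) (boost_denom_pos ha _))
    (boostLift l (-a))
    (fun φ => by simpa using boostLift_neg_boostLift hl (a := -a) (by simpa using ha) φ)

/-- The map of the circle with the lift `boostLift l a`, written without a choice of the angle. -/
noncomputable def boostFun (l : ℕ) (a : ℝ) (z : Circle) : Circle :=
  z * Circle.exp (-((l : ℝ)⁻¹ * (2 * Real.arctan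
    (a * ((z : ℂ) ^ l).im / (1 + a * ((z : ℂ) ^ l).re)))))

theorem circle_exp_pow (φ : ℝ) (l : ℕ) : Circle.exp φ ^ l = Circle.exp (l * φ) := by
  refine Circle.coe_injective ?_
  rw [Circle.coe_pow, Circle.coe_exp, ← Complex.exp_nat_mul, Circle.coe_exp]
  push_cast
  ring_nf

theorem circle_exp_re (φ : ℝ) : (Circle.exp φ : ℂ).re = Real.cos φ := by
  rw [Circle.coe_exp, Complex.exp_ofReal_mul_I_re]

theorem circle_exp_im (φ : ℝ) : (Circle.exp φ : ℂ).im = Real.sin φ := by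
  rw [Circle.coe_exp, Complex.exp_ofReal_mul_I_im]

theorem isAngleLift_boostFun (l : ℕ) (a : ℝ) : IsAngleLift (boostFun l a) (boostLift l a) := by
  intro φ
  unfold boostFun boostLift boostAngle
  rw [← Circle.coe_pow, circle_exp_pow, circle_exp_re, circle_exp_im, sub_eq_add_neg,
    Circle.exp_add]

theorem abs_tanh_lt_one (t : ℝ) : |Real.tanh t| < 1 :=
  abs_lt.2 ⟨Real.neg_one_lt_tanh t, Real.tanh_lt_one t⟩

/-- The lift to the `l`-fold covering of the action on the light rays of the boost with rapidity
`t`. Its Möbius parameter is `-tanh (t / 2)`; with this sign the boosts are the flow of `l⁻¹ S_l`. -/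
noncomputable def boost (l : ℕ) [NeZero l] (t : ℝ) : DiffPlus :=
  have ha : |-Real.tanh (t / 2)| < 1 := by simpa using abs_tanh_lt_one (t / 2)
  have ha' : |Real.tanh (t / 2)| < 1 := abs_tanh_lt_one (t / 2)
  have h : ∀ a, |a| < 1 → Function.LeftInverse (boostFun l (-a)) (boostFun l a) := by
    intro a ha z
    obtain ⟨φ, rfl⟩ := Circle.exp_surjective z
    rw [isAngleLift_boostFun, isAngleLift_boostFun, boostLift_neg_boostLift (NeZero.ne l) ha]
  ⟨⟨boostFun l (-Real.tanh (t / 2)), boostFun l (Real.tanh (t / 2)),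
      by simpa using h _ ha, h _ ha'⟩,
    (isAngleLift_boostFun l _).contMDiff (contDiff_boostLift ha),
    (isAngleLift_boostFun l _).contMDiff (contDiff_boostLift ha'),
    boostIso l (NeZero.ne l) _ ha, isAngleLift_boostFun l _⟩

theorem isAngleLift_boost (l : ℕ) [NeZero l] (t : ℝ) :
    IsAngleLift (boost l t).1 (boostLift l (-Real.tanh (t / 2))) :=
  isAngleLift_boostFun l _

theorem continuous_boost (l : ℕ) [NeZero l] : Continuous (boost l) := by
  refine continuous_diffPlus_iff.2 fun k => ?_
  have hat : ∀ t : ℝ, |-Real.tanh (t / 2)| < 1 := fun t => by simpa using abs_tanh_lt_one (t / 2)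
  have hc : Continuous fun t : ℝ => -Real.tanh (t / 2) := by
    simp only [Real.tanh_eq_sinh_div_cosh]
    have : ∀ t : ℝ, Real.cosh (t / 2) ≠ 0 := fun t => (Real.cosh_pos _).ne'
    fun_prop (disch := assumption)
  have hre : ∀ φ : ℝ, ((Circle.exp φ : ℂ) ^ l).re = Real.cos (l * φ) := fun φ => by
    rw [← Circle.coe_pow, circle_exp_pow, circle_exp_re]
  -- the angular derivative of the boost
  let v : ℝ → Circle → ℂ := fun t z => ((1 - (-Real.tanh (t / 2)) ^ 2 : ℝ) : ℂ) *
    (1 + ((2 * -Real.tanh (t / 2) : ℝ) : ℂ) * (((z : ℂ) ^ l).re : ℂ) +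
      (((-Real.tanh (t / 2)) ^ 2 : ℝ) : ℂ))⁻¹
  have hden : ∀ (t : ℝ) (z : Circle), (1 + ((2 * -Real.tanh (t / 2) : ℝ) : ℂ) *
      (((z : ℂ) ^ l).re : ℂ) + (((-Real.tanh (t / 2)) ^ 2 : ℝ) : ℂ)) ≠ 0 := by
    intro t z
    obtain ⟨φ, rfl⟩ := Circle.exp_surjective z
    rw [hre]
    have := (boost_denom_pos (hat t) (l * φ)).ne'
    exact_mod_cast this
  have hv : ∀ k, Fam k v := fun k =>
    (Fam.paramFun k (by fun_prop)).mul (Fam.inv (((Fam.paramFun k continuous_const).add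
      ((Fam.paramFun k (by fun_prop)).mul ((fam_coe k).pow l).re)).add
        (Fam.paramFun k (by fun_prop))) hden)
  refine Fam.of_deriv (v := fun t z => v t z * I) ?_ ?_
    (fun k => (hv k).mul (Fam.paramFun k continuous_const))
  · change Continuous fun x : ℝ × Circle => (boostFun l (-Real.tanh (x.1 / 2)) x.2 : ℂ)
    unfold boostFun
    have hc' : Continuous fun x : ℝ × Circle => -Real.tanh (x.1 / 2) := hc.comp continuous_fst
    have : ∀ x : ℝ × Circle, 1 + -Real.tanh (x.1 / 2) * ((x.2 : ℂ) ^ l).re ≠ 0 := by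
      rintro ⟨t, z⟩
      obtain ⟨φ, rfl⟩ := Circle.exp_surjective z
      simp only [hre]
      exact (one_add_mul_cos_pos (hat t) _).ne'
    fun_prop (disch := assumption)
  · intro t z
    obtain ⟨φ, rfl⟩ := Circle.exp_surjective z
    have := (isAngleLift_boost l t).hasAngleDeriv
      (hasDerivAt_boostLift (NeZero.ne l) (hat t) φ)
    unfold HasAngleDeriv at this
    convert! this using 1
    simp only [v, hre, div_eq_mul_inv]
    push_cast
    rfl

end CircleDiff

namespace CircleDiff

open Matrix

/-! ### The Lorentz group -/

/-- The real `3 × 3` matrices of determinant one. -/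
abbrev SL3 : Type := Matrix.SpecialLinearGroup (Fin 3) ℝ

theorem SOup.row_sq (A : SOup) : A.1.1 0 0 ^ 2 = 1 + A.1.1 0 1 ^ 2 + A.1.1 0 2 ^ 2 := by
  have a := congrFun (congrFun (lorentz_transpose A.2.1) 0) 0
  simp [minkowski, Matrix.mul_apply, Fin.sum_univ_three, Matrix.diagonal_apply] at a
  linarith

theorem SOup.one_le (A : SOup) : 1 ≤ A.1.1 0 0 := by
  have h1 := SOup.row_sq A
  refine (one_le_sq_iff₀ A.2.2.le).1 ?_
  linarith [sq_nonneg (A.1.1 0 1), sq_nonneg (A.1.1 0 2)]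

/-- The spatial rotations. -/
noncomputable def rotMat (θ : ℝ) : SOup :=
  ⟨⟨!![1, 0, 0; 0, Real.cos θ, -Real.sin θ; 0, Real.sin θ, Real.cos θ], by
      rw [Matrix.det_fin_three]
      simp
      linear_combination Real.sin_sq_add_cos_sq θ⟩, by
    constructor
    · ext i j
      fin_cases i <;> fin_cases j <;>
        simp [minkowski, Matrix.mul_apply, Fin.sum_univ_three, Matrix.diagonal_apply] <;>
        first
        | linear_combination -Real.sin_sq_add_cos_sq θ
        | ring
    · simp⟩

/-- The boosts in the direction of the first space coordinate. -/
noncomputable def boostMat (t : ℝ) : SOup :=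
  ⟨⟨!![Real.cosh t, -Real.sinh t, 0; -Real.sinh t, Real.cosh t, 0; 0, 0, 1], by
      rw [Matrix.det_fin_three]
      simp
      linear_combination Real.cosh_sq_sub_sinh_sq t⟩, by
    constructor
    · ext i j
      fin_cases i <;> fin_cases j <;>
        simp [minkowski, Matrix.mul_apply, Fin.sum_univ_three, Matrix.diagonal_apply] <;>
        first
        | linear_combination Real.cosh_sq_sub_sinh_sq t
        | linear_combination -Real.cosh_sq_sub_sinh_sq t
        | ring
    · simpa using Real.cosh_pos t⟩

theorem exists_cos_sin (x y : ℝ) (h : x ^ 2 + y ^ 2 = 1) :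
    ∃ θ, Real.cos θ = x ∧ Real.sin θ = y := by
  refine ⟨Complex.arg ⟨x, y⟩, ?_, ?_⟩
  · have h0 : (⟨x, y⟩ : ℂ) ≠ 0 := fun h0 => by
      have h1 := congrArg Complex.re h0
      have h2 := congrArg Complex.im h0
      simp at h1 h2
      simp [h1, h2] at h
    rw [Complex.cos_arg h0, Complex.norm_def, Complex.normSq_mk,
      show x * x + y * y = 1 by linarith]
    simp
  · rw [Complex.sin_arg, Complex.norm_def, Complex.normSq_mk,
      show x * x + y * y = 1 by linarith]
    simp

theorem eq_zero_of_sq_add_sq {x y : ℝ} (h : x ^ 2 + y ^ 2 = 0) : x = 0 ∧ y = 0 := by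
  have h' := (add_eq_zero_iff_of_nonneg (sq_nonneg x) (sq_nonneg y)).1 h
  exact ⟨pow_eq_zero_iff two_ne_zero |>.1 h'.1, pow_eq_zero_iff two_ne_zero |>.1 h'.2⟩

/-- A Lorentz transformation that fixes the time axis is a rotation. -/
theorem eq_rotMat_of_row (A : SOup) (h1 : A.1.1 0 1 = 0) (h2 : A.1.1 0 2 = 0) :
    ∃ θ, A = rotMat θ := by
  have h0 : A.1.1 0 0 = 1 := by
    have := SOup.row_sq A
    rw [h1, h2] at this
    exact (pow_left_inj₀ A.2.2.le zero_le_one two_ne_zero).1 (by linarith)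
  have e : ∀ i j, (A.1.1.transpose * minkowski * A.1.1) i j = minkowski i j := fun i j => by
    rw [A.2.1]
  have e00 := e 0 0
  have e11 := e 1 1
  have e22 := e 2 2
  have hd := A.1.2
  rw [Matrix.det_fin_three] at hd
  simp [minkowski, Matrix.mul_apply, Fin.sum_univ_three, Matrix.diagonal_apply, h0, h1, h2]
    at e00 e11 e22 hd
  obtain ⟨h10, h20⟩ := eq_zero_of_sq_add_sq (x := A.1.1 1 0) (y := A.1.1 2 0)
    (by linear_combination -e00)
  obtain ⟨h11, h12⟩ := eq_zero_of_sq_add_sq (x := A.1.1 2 2 - A.1.1 1 1)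
    (y := A.1.1 1 2 + A.1.1 2 1) (by linear_combination -e11 - e22 - 2 * hd)
  rw [sub_eq_zero] at h11
  rw [add_eq_zero_iff_eq_neg] at h12
  obtain ⟨θ, hc, hs⟩ := exists_cos_sin (A.1.1 1 1) (A.1.1 2 1) (by linear_combination -e11)
  refine ⟨θ, Subtype.ext (Subtype.ext ?_)⟩
  ext i j
  fin_cases i <;> fin_cases j <;> simp [rotMat, *]

/-- The Cartan decomposition of the Lorentz group: the boost and the second rotation are chosen so
as to give the first row of `A`. -/
theorem SOup.exists_eq_rot_mul_boost_mul_rot (A : SOup) :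
    ∃ α t β, A = rotMat α * boostMat t * rotMat β := by
  set r : ℝ := Real.sqrt (A.1.1 0 1 ^ 2 + A.1.1 0 2 ^ 2) with hr
  have hrow := SOup.row_sq A
  have hr2 : r ^ 2 = A.1.1 0 1 ^ 2 + A.1.1 0 2 ^ 2 := Real.sq_sqrt (by positivity)
  obtain ⟨β, h1, h2⟩ : ∃ β, r * Real.cos β = A.1.1 0 1 ∧ r * Real.sin β = A.1.1 0 2 := by
    by_cases hr0 : r = 0
    · refine ⟨0, ?_⟩
      rw [hr0] at hr2 ⊢
      have h0 := eq_zero_of_sq_add_sq (x := A.1.1 0 1) (y := A.1.1 0 2) (by linarith)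
      simp [h0.1, h0.2]
    · obtain ⟨θ, hc, hs⟩ := exists_cos_sin (A.1.1 0 1 / r) (A.1.1 0 2 / r) (by
        field_simp
        linarith)
      exact ⟨θ, by rw [hc]; field_simp, by rw [hs]; field_simp⟩
  set t := -Real.arsinh r
  have hsh : Real.sinh t = -r := by simp [t, Real.sinh_neg]
  have hch : Real.cosh t = A.1.1 0 0 := by
    have h3 := Real.cosh_sq t
    have h4 := Real.cosh_pos t
    have h5 := A.2.2
    rw [hsh] at h3
    exact (pow_left_inj₀ h4.le h5.le two_ne_zero).1 (by linarith)
  set B : SOup := boostMat t * rotMat (-β)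
  have hB : ∀ j, B.1.1 0 j = A.1.1 0 j := by
    intro j
    change ((boostMat t).1.1 * (rotMat (-β)).1.1) 0 j = _
    rw [Matrix.mul_apply]
    fin_cases j <;> simp [Fin.sum_univ_three, rotMat, boostMat, hsh, hch, ← h1, ← h2]
  have hM : ∀ j, (A * B⁻¹).1.1 0 j = (1 : SOup).1.1 0 j := by
    intro j
    rw [← mul_inv_cancel B]
    change (A.1.1 * (B⁻¹).1.1) 0 j = (B.1.1 * (B⁻¹).1.1) 0 j
    rw [Matrix.mul_apply, Matrix.mul_apply]
    exact Finset.sum_congr rfl fun k _ => by rw [hB]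
  obtain ⟨α, hα⟩ := eq_rotMat_of_row (A * B⁻¹) ((hM 1).trans rfl) ((hM 2).trans rfl)
  refine ⟨α, t, -β, ?_⟩
  rw [mul_assoc, ← hα, inv_mul_cancel_right]

theorem rotMat_zero : rotMat 0 = 1 := by
  refine Subtype.ext (Subtype.ext ?_)
  ext i j
  fin_cases i <;> fin_cases j <;> simp [rotMat]

/-- A central element commutes with the rotation by `π`, hence is a rotation, and a rotation that
commutes with a boost is trivial. -/
theorem center_SOup : Subgroup.center SOup = ⊥ := by
  rw [Subgroup.eq_bot_iff_forall]
  intro A hA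
  have hc := Subgroup.mem_center_iff.1 hA
  have key : ∀ (B : SOup) i j, (B.1.1 * A.1.1) i j = (A.1.1 * B.1.1) i j := fun B i j => by
    have := congrArg (fun C : SOup => C.1.1 i j) (hc B)
    exact this
  have h1 := key (rotMat Real.pi) 0 1
  have h2 := key (rotMat Real.pi) 0 2
  simp [Matrix.mul_apply, Fin.sum_univ_three, rotMat] at h1 h2
  obtain ⟨θ, rfl⟩ := eq_rotMat_of_row A (by linarith) (by linarith)
  have hsh : Real.sinh 1 ≠ 0 := (Real.sinh_pos_iff.2 one_pos).ne'
  have h3 := key (boostMat 1) 1 0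
  simp [Matrix.mul_apply, Fin.sum_univ_three, rotMat, boostMat, hsh] at h3
  have hsin : Real.sin θ = 0 := by
    have := Real.sin_sq_add_cos_sq θ
    rw [h3] at this
    exact pow_eq_zero_iff two_ne_zero |>.1 (by linarith)
  rw [← rotMat_zero]
  refine Subtype.ext (Subtype.ext ?_)
  ext i j
  fin_cases i <;> fin_cases j <;> simp [rotMat, h3, hsin]

theorem isClosed_SOup : IsClosed (SOup : Set SL3) := by
  have e : (SOup : Set SL3) =
      {A : SL3 | A.1.transpose * minkowski * A.1 = minkowski ∧ 1 ≤ A.1 0 0} := by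
    ext A
    exact ⟨fun h => ⟨h.1, SOup.one_le ⟨A, h⟩⟩, fun h => ⟨h.1, one_pos.trans_le h.2⟩⟩
  rw [e]
  have h : Continuous fun A : SL3 => A.1 := continuous_subtype_val
  exact (isClosed_eq ((h.matrix_transpose.matrix_mul continuous_const).matrix_mul h)
    continuous_const).inter (isClosed_le continuous_const (h.matrix_elem 0 0))

instance : LocallyCompactSpace SOup :=
  have : LocallyCompactSpace (Matrix (Fin 3) (Fin 3) ℝ) :=
    inferInstanceAs (LocallyCompactSpace (Fin 3 → Fin 3 → ℝ))
  have : LocallyCompactSpace SL3 :=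
    Matrix.SpecialLinearGroup.isClosedEmbedding_val.locallyCompactSpace
  isClosed_SOup.isClosedEmbedding_subtypeVal.locallyCompactSpace

/-! ### Transformations of the light rays -/

/-- The point of the light cone on the ray with the direction `z`. -/
def nullVec (z : Circle) : Fin 3 → ℝ := ![1, (z : ℂ).re, (z : ℂ).im]

/-- `g` is a lift, to the `l`-fold covering `z ↦ z ^ l` of the circle of light rays, of the action
of the matrix `A` on the light rays. -/
def Covers (l : ℕ) (g : DiffPlus) (A : SL3) : Prop :=
  ∀ z : Circle, ∃ c : ℝ, 0 < c ∧ A.1 *ᵥ nullVec (z ^ l) = c • nullVec (g.1 z ^ l)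

theorem Covers.one (l : ℕ) : Covers l 1 1 := fun z => ⟨1, one_pos, by simp⟩

theorem Covers.mul {l : ℕ} {g h : DiffPlus} {A B : SL3} (hA : Covers l g A) (hB : Covers l h B) :
    Covers l (g * h) (A * B) := by
  intro z
  obtain ⟨c, hc, e⟩ := hB z
  obtain ⟨d, hd, e'⟩ := hA (h.1 z)
  refine ⟨c * d, mul_pos hc hd, ?_⟩
  rw [Matrix.SpecialLinearGroup.coe_mul, ← Matrix.mulVec_mulVec, e, Matrix.mulVec_smul, e',
    smul_smul]
  rfl

theorem Covers.inv {l : ℕ} {g : DiffPlus} {A : SL3} (hA : Covers l g A) :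
    Covers l g⁻¹ A⁻¹ := by
  intro z
  obtain ⟨c, hc, e⟩ := hA ((g⁻¹).1 z)
  refine ⟨c⁻¹, inv_pos.2 hc, ?_⟩
  have e1 : g.1 ((g⁻¹).1 z) = z := g.1.apply_symm_apply z
  rw [e1] at e
  have e2 : (A⁻¹).1 *ᵥ (A.1 *ᵥ nullVec ((g⁻¹).1 z ^ l)) = nullVec ((g⁻¹).1 z ^ l) := by
    rw [Matrix.mulVec_mulVec, ← Matrix.SpecialLinearGroup.coe_mul, inv_mul_cancel]
    simp
  rw [← e2, e, Matrix.mulVec_smul, smul_smul, inv_mul_cancel₀ hc.ne', one_smul]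

theorem circle_exists_pow (l : ℕ) [NeZero l] (w : Circle) : ∃ z : Circle, z ^ l = w := by
  obtain ⟨φ, rfl⟩ := Circle.exp_surjective w
  refine ⟨Circle.exp (φ / l), ?_⟩
  rw [circle_exp_pow, mul_div_cancel₀ _ (by exact_mod_cast NeZero.ne l)]

/-- A matrix of determinant one that fixes four light rays is the identity. -/
theorem Covers.eq_one {l : ℕ} [NeZero l] {A : SL3} (hA : Covers l 1 A) : A = 1 := by
  have key : ∀ φ : ℝ, ∃ c : ℝ, A.1 *ᵥ ![1, Real.cos φ, Real.sin φ] =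
      c • ![1, Real.cos φ, Real.sin φ] := by
    intro φ
    obtain ⟨z, hz⟩ := circle_exists_pow l (Circle.exp φ)
    obtain ⟨c, -, hc⟩ := hA z
    refine ⟨c, ?_⟩
    have e : (1 : DiffPlus).1 z = z := rfl
    rwa [e, hz, nullVec, circle_exp_re, circle_exp_im] at hc
  obtain ⟨c1, h1⟩ := key 0
  obtain ⟨c2, h2⟩ := key (Real.pi / 2)
  obtain ⟨c3, h3⟩ := key Real.pi
  obtain ⟨c4, h4⟩ := key (-(Real.pi / 2))
  have hx : ∀ i, A.1 i 0 + A.1 i 1 = c1 * ![1, 1, 0] i ∧ A.1 i 0 + A.1 i 2 = c2 * ![1, 0, 1] i ∧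
      A.1 i 0 - A.1 i 1 = c3 * ![1, -1, 0] i ∧ A.1 i 0 - A.1 i 2 = c4 * ![1, 0, -1] i := by
    intro i
    have a1 := congrFun h1 i
    have a2 := congrFun h2 i
    have a3 := congrFun h3 i
    have a4 := congrFun h4 i
    simp [Matrix.mulVec, dotProduct, Fin.sum_univ_three] at a1 a2 a3 a4
    refine ⟨?_, ?_, ?_, ?_⟩
    · fin_cases i <;> simp at a1 ⊢ <;> linarith
    · fin_cases i <;> simp at a2 ⊢ <;> linarith
    · fin_cases i <;> simp at a3 ⊢ <;> linarith
    · fin_cases i <;> simp at a4 ⊢ <;> linarith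
  obtain ⟨x1, x2, x3, x4⟩ := hx 0
  obtain ⟨y1, y2, y3, y4⟩ := hx 1
  obtain ⟨z1, z2, z3, z4⟩ := hx 2
  simp at x1 x2 x3 x4 y1 y2 y3 y4 z1 z2 z3 z4
  have hc3 : c3 = c1 := by linarith
  have hc2 : c2 = c1 := by linarith
  have e00 : A.1 0 0 = c1 := by linarith
  have e01 : A.1 0 1 = 0 := by linarith
  have e02 : A.1 0 2 = 0 := by linarith
  have e10 : A.1 1 0 = 0 := by linarith
  have e11 : A.1 1 1 = c1 := by linarith
  have e12 : A.1 1 2 = 0 := by linarith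
  have e20 : A.1 2 0 = 0 := by linarith
  have e21 : A.1 2 1 = 0 := by linarith
  have e22 : A.1 2 2 = c1 := by linarith
  have hd := A.2
  rw [Matrix.det_fin_three] at hd
  simp only [e00, e01, e02, e10, e11, e12, e20, e21, e22] at hd
  have hc : c1 = 1 := by
    have : (c1 - 1) * (c1 ^ 2 + c1 + 1) = 0 := by linear_combination hd
    rcases mul_eq_zero.1 this with h | h
    · linarith
    · linarith [sq_nonneg (c1 + 1 / 2)]
  refine Subtype.ext ?_
  ext i j
  fin_cases i <;> fin_cases j <;> simp [*]

theorem Covers.unique {l : ℕ} [NeZero l] {g : DiffPlus} {A B : SL3} (hA : Covers l g A)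
    (hB : Covers l g B) : A = B := by
  have h := hA.inv.mul hB
  rw [inv_mul_cancel] at h
  exact inv_mul_eq_one.1 h.eq_one

/-- The group of the `l`-fold lifts of Lorentz transformations of the light rays. -/
def lorentzLifts (l : ℕ) : Subgroup DiffPlus where
  carrier := {g | ∃ A : SOup, Covers l g A.1}
  one_mem' := ⟨1, Covers.one l⟩
  mul_mem' := by
    rintro g h ⟨A, hA⟩ ⟨B, hB⟩
    exact ⟨A * B, hA.mul hB⟩
  inv_mem' := by
    rintro g ⟨A, hA⟩
    exact ⟨A⁻¹, hA.inv⟩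

theorem covers_of_angle {l : ℕ} {g : DiffPlus} {A : SL3} {F : ℝ → ℝ} (hF : IsAngleLift g.1 F)
    (h : ∀ φ : ℝ, ∃ c : ℝ, 0 < c ∧ A.1 *ᵥ ![1, Real.cos (l * φ), Real.sin (l * φ)] =
      c • ![1, Real.cos (l * F φ), Real.sin (l * F φ)]) : Covers l g A := by
  intro z
  obtain ⟨φ, rfl⟩ := Circle.exp_surjective z
  obtain ⟨c, hc, e⟩ := h φ
  refine ⟨c, hc, ?_⟩
  rwa [hF, circle_exp_pow, circle_exp_pow, nullVec, nullVec, circle_exp_re, circle_exp_im,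
    circle_exp_re, circle_exp_im]

theorem covers_rot (l : ℕ) (θ : ℝ) : Covers l (rot θ) (rotMat (l * θ)).1 := by
  refine covers_of_angle (F := fun φ => θ + φ) (fun φ => ?_) fun φ => ⟨1, one_pos, ?_⟩
  · rw [rot_apply, Circle.exp_add]
  · ext i
    fin_cases i <;>
      simp [rotMat, Matrix.mulVec, dotProduct, Fin.sum_univ_three, mul_add, Real.cos_add,
        Real.sin_add] <;> ring

/-- Half-angle formulas, cleared of denominators. -/
theorem cosh_sinh_half (t : ℝ) :
    Real.cosh t * (1 - Real.tanh (t / 2) ^ 2) = 1 + Real.tanh (t / 2) ^ 2 ∧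
    Real.sinh t * (1 - Real.tanh (t / 2) ^ 2) = 2 * Real.tanh (t / 2) := by
  have h := (Real.cosh_pos (t / 2)).ne'
  have h1 := Real.cosh_sq_sub_sinh_sq (t / 2)
  have hc : Real.cosh t = Real.cosh (t / 2) ^ 2 + Real.sinh (t / 2) ^ 2 := by
    rw [← Real.cosh_two_mul]; ring_nf
  have hs : Real.sinh t = 2 * Real.sinh (t / 2) * Real.cosh (t / 2) := by
    rw [← Real.sinh_two_mul]; ring_nf
  rw [hc, hs, Real.tanh_eq_sinh_div_cosh]
  constructor
  · field_simp
    linear_combination h1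
  · field_simp
    linear_combination Real.sinh (t / 2) * h1

theorem covers_boost (l : ℕ) [NeZero l] (t : ℝ) : Covers l (boost l t) (boostMat t).1 := by
  refine covers_of_angle (isAngleLift_boost l t) fun φ => ?_
  have ha : |-Real.tanh (t / 2)| < 1 := by simpa using abs_tanh_lt_one (t / 2)
  have hD := boost_denom_pos ha (l * φ)
  have ha2 : 0 < 1 - Real.tanh (t / 2) ^ 2 := by
    have := (sq_lt_one_iff_abs_lt_one _).2 (abs_tanh_lt_one (t / 2))
    linarith
  obtain ⟨hc, hs⟩ := cosh_sinh_half t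
  refine ⟨_, div_pos hD ha2, ?_⟩
  rw [mul_boostLift (NeZero.ne l), cos_sub_boostAngle ha, sin_sub_boostAngle ha]
  obtain ⟨D, hDe⟩ : ∃ D, D = 1 + 2 * -Real.tanh (t / 2) * Real.cos (l * φ) +
    (-Real.tanh (t / 2)) ^ 2 := ⟨_, rfl⟩
  rw [← hDe] at hD ⊢
  ext i
  fin_cases i <;>
    simp [boostMat, Matrix.mulVec, dotProduct, Fin.sum_univ_three] <;> field_simp
  · linear_combination hc - Real.cos (l * φ) * hs - hDe
  · linear_combination Real.cos (l * φ) * hc - hs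

/-- A lift of the identity is a deck transformation: `g z / z` is an `l`-th root of unity and
depends continuously on `z`. -/
theorem exists_rot_of_covers_one {l : ℕ} [NeZero l] {g : DiffPlus} (hg : Covers l g 1) :
    ∃ ζ : Circle, ζ ^ l = 1 ∧ ∀ z, g.1 z = ζ * z := by
  have h1 : ∀ z, (g.1 z / z) ^ l = 1 := by
    intro z
    obtain ⟨c, hc, e⟩ := hg z
    have e0 := congrFun e 0
    have e1 := congrFun e 1
    have e2 := congrFun e 2
    simp [nullVec] at e0 e1 e2
    subst e0
    rw [div_pow, div_eq_one]
    refine Circle.coe_injective ?_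
    apply Complex.ext <;> simp [e1, e2]
  have := HasEnoughRootsOfUnity.finite_rootsOfUnity Circle l
  have hfin : ((rootsOfUnity l Circle : Set Circleˣ)).Finite := Set.toFinite _
  obtain ⟨ζ, hζ, hc⟩ := isPreconnected_univ.eqOn_const_of_mapsTo (T := {w : Circle | w ^ l = 1})
    (f := fun z => g.1 z / z)
    (by
      refine Set.Finite.isDiscrete ?_
      refine (hfin.image (fun u : Circleˣ => (u : Circle))).subset fun w hw => ?_
      have hw' : w ^ l = 1 := hw
      exact ⟨toUnits w, by
        rw [SetLike.mem_coe, mem_rootsOfUnity, ← map_pow, hw', map_one], rfl⟩)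
    (by
      have : Continuous g.1 := g.2.1.continuous
      exact (this.div' continuous_id).continuousOn) (fun z _ => h1 z) ⟨1, one_pow l⟩
  refine ⟨ζ, hζ, fun z => ?_⟩
  have := hc (Set.mem_univ z)
  simp only [Function.const_apply] at this
  rw [← this, div_mul_cancel]

end CircleDiff

namespace CircleDiff

open Matrix

/-! ### Flows of trigonometric vector fields with one frequency -/

theorem det_minkowski : minkowski.det = 1 := by
  simp [minkowski, Matrix.det_diagonal, Fin.prod_univ_three]

/-- The exponential of an element of the Lie algebra of the Lorentz group is a square of a matrix
preserving the metric, and therefore preserves the orientation and the direction of time. -/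
theorem exists_SOup_eq_exp {N : Matrix (Fin 3) (Fin 3) ℝ}
    (hN : minkowski * N * minkowski = -N.transpose) : ∃ A : SOup, A.1.1 = NormedSpace.exp N := by
  have hu : minkowski⁻¹ = minkowski := Matrix.inv_eq_left_inv minkowski_sq
  have hη : IsUnit minkowski := by
    rw [Matrix.isUnit_iff_isUnit_det, det_minkowski]
    exact isUnit_one
  set B : Matrix (Fin 3) (Fin 3) ℝ := NormedSpace.exp ((2 : ℝ)⁻¹ • N) with hB
  have hlor : B.transpose * minkowski * B = minkowski := by
    have h1 := Matrix.exp_conj minkowski ((2 : ℝ)⁻¹ • N) hη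
    rw [hu, Matrix.mul_smul, Matrix.smul_mul, hN, smul_neg, Matrix.exp_neg,
      ← Matrix.transpose_smul, Matrix.exp_transpose, ← hB] at h1
    have hBu : IsUnit B.transpose.det := by
      rw [Matrix.det_transpose, ← Matrix.isUnit_iff_isUnit_det]
      exact Matrix.isUnit_exp _
    have h2 : minkowski * B = B.transpose⁻¹ * minkowski := by
      rw [h1, Matrix.mul_assoc (minkowski * B), minkowski_sq, Matrix.mul_one]
    rw [Matrix.mul_assoc, h2, ← Matrix.mul_assoc, Matrix.mul_nonsing_inv _ hBu, Matrix.one_mul]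
  have hBB : B * B = NormedSpace.exp N := by
    rw [hB, ← Matrix.exp_add_of_commute _ _ (Commute.refl _), ← add_smul]
    norm_num
  have hdet : B.det * B.det = 1 := by
    have := congrArg Matrix.det hlor
    rw [Matrix.det_mul, Matrix.det_mul, Matrix.det_transpose, det_minkowski, mul_one] at this
    exact this
  refine ⟨⟨⟨B * B, by rw [Matrix.det_mul, hdet]⟩, ?_, ?_⟩, hBB⟩
  · calc (B * B).transpose * minkowski * (B * B)
        = B.transpose * (B.transpose * minkowski * B) * B := by
          simp only [Matrix.transpose_mul, Matrix.mul_assoc]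
      _ = minkowski := by rw [hlor, hlor]
  · have a := congrFun (congrFun (lorentz_transpose hlor) 0) 0
    have b := congrFun (congrFun hlor 0) 0
    simp [minkowski, Matrix.mul_apply, Fin.sum_univ_three, Matrix.diagonal_apply] at a b
    change 0 < (B * B) 0 0
    rw [Matrix.mul_apply, Fin.sum_univ_three]
    linarith [sq_nonneg (B 0 1 + B 1 0), sq_nonneg (B 0 2 + B 2 0)]

section

attribute [local instance] Matrix.linftyOpNormedRing Matrix.linftyOpNormedAlgebra

/-- The only solution of `Y' = N Y` is `exp (t N) Y₀`. -/
theorem eq_exp_mulVec {N : Matrix (Fin 3) (Fin 3) ℝ} {Y : ℝ → Fin 3 → ℝ}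
    (hY : ∀ t, HasDerivAt Y (N *ᵥ Y t) t) (t : ℝ) :
    Y t = NormedSpace.exp (t • N) *ᵥ Y 0 := by
  have h1 : ∀ t : ℝ, HasDerivAt (fun t : ℝ => NormedSpace.exp (t • N) *ᵥ Y 0)
      (N *ᵥ (NormedSpace.exp (t • N) *ᵥ Y 0)) t := by
    intro t
    let L : Matrix (Fin 3) (Fin 3) ℝ →ₗ[ℝ] (Fin 3 → ℝ) :=
      { toFun := fun M => M *ᵥ Y 0
        map_add' := fun M M' => Matrix.add_mulVec M M' _
        map_smul' := fun c M => Matrix.smul_mulVec c M _ }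
    have h := (LinearMap.toContinuousLinearMap L).hasFDerivAt.comp_hasDerivAt t
      (hasDerivAt_exp_smul_const' N t)
    rw [Matrix.mulVec_mulVec]
    exact h
  have h2 := ODE_solution_unique_univ (v := fun _ y => N *ᵥ y) (s := fun _ => Set.univ) (t₀ := 0)
    (fun _ => ((LinearMap.toContinuousLinearMap (Matrix.toLin' N)).lipschitz).lipschitzOnWith)
    (fun t => ⟨hY t, Set.mem_univ _⟩) (fun t => ⟨h1 t, Set.mem_univ _⟩) (by simp)
  exact congrFun h2 t

end

/-- The flow of `a + b sin lφ + c cos lφ` covers Lorentz transformations. -/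
theorem exists_covers_of_flow {l : ℕ} {a b c t : ℝ} {g : DiffPlus} {f : ℝ → ℝ}
    (hf : ∀ φ, f φ = a + b * Real.sin (l * φ) + c * Real.cos (l * φ))
    (hg : IsFlowMap (Diffeomorph.refl (𝓡 1) Circle ∞) f t g) : g ∈ lorentzLifts l := by
  obtain ⟨Φ, h0, hd, hΦ⟩ := hg
  set N : Matrix (Fin 3) (Fin 3) ℝ := (l : ℝ) • !![0, -b, c; -b, 0, -a; c, a, 0] with hN
  obtain ⟨A, hA⟩ := exists_SOup_eq_exp (N := t • N) (by
    ext i j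
    fin_cases i <;> fin_cases j <;>
      simp [hN, minkowski, Matrix.mul_apply, Matrix.diagonal_apply])
  refine ⟨A, covers_of_angle (F := Φ t) hΦ fun φ => ?_⟩
  -- the null vector on the moving ray, rescaled so as to satisfy a linear equation
  set q : ℝ → ℝ := fun s => l * (b * Real.cos (l * Φ s φ) - c * Real.sin (l * Φ s φ)) with hq
  have hΦc : Continuous fun s => Φ s φ :=
    continuous_iff_continuousAt.2 fun s => (hd s φ).continuousAt
  have hqc : Continuous q := by fun_prop
  set Λ : ℝ → ℝ := fun s => ∫ r in (0 : ℝ)..s, q r with hΛ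
  have hΛd : ∀ s, HasDerivAt Λ (q s) s := fun s => (hqc.integral_hasStrictDerivAt 0 s).hasDerivAt
  have hY : ∀ s, HasDerivAt (fun s => Real.exp (-Λ s) •
      ![1, Real.cos (l * Φ s φ), Real.sin (l * Φ s φ)]) (N *ᵥ (Real.exp (-Λ s) •
      ![1, Real.cos (l * Φ s φ), Real.sin (l * Φ s φ)])) s := by
    intro s
    have e1 := (hΛd s).neg.exp
    have e2 := ((hd s φ).const_mul (l : ℝ)).cos
    have e3 := ((hd s φ).const_mul (l : ℝ)).sin
    have hs := Real.sin_sq_add_cos_sq (l * Φ s φ)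
    rw [hf] at e2 e3
    rw [hasDerivAt_pi]
    intro i
    fin_cases i
    · convert! e1 using 1
      · simp
      · simp [hN, Matrix.mulVec, dotProduct, Fin.sum_univ_three, hq]
        ring
    · convert! e1.mul e2 using 1
      simp [hN, Matrix.mulVec, dotProduct, Fin.sum_univ_three, hq]
      linear_combination (l * Real.exp (-Λ s) * b) * hs
    · convert! e1.mul e3 using 1
      simp [hN, Matrix.mulVec, dotProduct, Fin.sum_univ_three, hq]
      linear_combination (-(l * Real.exp (-Λ s) * c)) * hs
  have := eq_exp_mulVec hY t
  rw [← hA] at this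
  refine ⟨Real.exp (-Λ t), Real.exp_pos _, ?_⟩
  rw [this]
  simp [hΛ, h0]

theorem isFlowMap_rot (l : ℕ) [NeZero l] (θ : ℝ) :
    IsFlowMap (Diffeomorph.refl (𝓡 1) Circle ∞) ((l : ℝ)⁻¹ • vT) (l * θ) (rot θ) := by
  have hl : (l : ℝ) ≠ 0 := by exact_mod_cast NeZero.ne l
  refine ⟨fun s φ => φ + (l : ℝ)⁻¹ * s, fun φ => by simp, fun s φ => ?_, fun φ => ?_⟩
  · simpa [vT] using ((hasDerivAt_id s).const_mul (l : ℝ)⁻¹).const_add φ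
  · change Circle.exp θ * Circle.exp φ = Circle.exp (φ + (l : ℝ)⁻¹ * (l * θ))
    rw [← Circle.exp_add, inv_mul_cancel_left₀ hl, add_comm]

theorem hasDerivAt_neg_tanh_half (s : ℝ) : HasDerivAt (fun s => -Real.tanh (s / 2))
    (-((1 - Real.tanh (s / 2) ^ 2) / 2)) s := by
  have hc := (Real.cosh_pos (s / 2)).ne'
  have h := ((((hasDerivAt_id s).div_const 2).sinh).div
    (((hasDerivAt_id s).div_const 2).cosh) hc).neg
  convert! h using 1
  · funext s
    simp [Real.tanh_eq_sinh_div_cosh]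
  · simp only [Real.tanh_eq_sinh_div_cosh, id]
    field_simp

theorem isFlowMap_boost (l : ℕ) [NeZero l] (t : ℝ) :
    IsFlowMap (Diffeomorph.refl (𝓡 1) Circle ∞) ((l : ℝ)⁻¹ • vS l) t (boost l t) := by
  have hl : (l : ℝ) ≠ 0 := by exact_mod_cast NeZero.ne l
  refine ⟨fun s φ => boostLift l (-Real.tanh (s / 2)) φ, fun φ => ?_, fun s φ => ?_, fun φ => ?_⟩
  · simp [boostLift, boostAngle]
  · have ha : |-Real.tanh (s / 2)| < 1 := by simpa using abs_tanh_lt_one (s / 2)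
    have h := (hasDerivAt_sub_boostAngle (hasDerivAt_neg_tanh_half s)
      (hasDerivAt_const s (l * φ)) ha).const_mul (l : ℝ)⁻¹
    simp only [Pi.smul_apply, vS, smul_eq_mul]
    rw [mul_boostLift (NeZero.ne l), sin_sub_boostAngle ha]
    convert! h using 1
    · funext s
      rw [← mul_boostLift (NeZero.ne l), inv_mul_cancel_left₀ hl]
    · ring
  · exact isAngleLift_boost l t φ

theorem mem_span_generators {l : ℕ} {f : ℝ → ℝ} (hf : f ∈ Submodule.span ℝ (generators l)) :
    ∃ a b c : ℝ, ∀ φ, f φ = a + b * Real.sin (l * φ) + c * Real.cos (l * φ) := by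
  obtain ⟨a, b, c, rfl⟩ := Submodule.mem_span_triple.1 hf
  refine ⟨a * (l : ℝ)⁻¹, b * (l : ℝ)⁻¹, c * (l : ℝ)⁻¹, fun φ => ?_⟩
  simp [vT, vS, vC]
  ring

/-- The lifted Cartan decomposition. The deck transformations are rotations and are absorbed in the
last factor. -/
theorem exists_eq_rot_mul_boost_mul_rot {l : ℕ} [NeZero l] {g : DiffPlus}
    (hg : g ∈ lorentzLifts l) : ∃ α t β, g = rot α * boost l t * rot β := by
  have hl : (l : ℝ) ≠ 0 := by exact_mod_cast NeZero.ne l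
  obtain ⟨A, hA⟩ := hg
  obtain ⟨α, t, β, rfl⟩ := SOup.exists_eq_rot_mul_boost_mul_rot A
  have hc : Covers l (rot (α / l) * boost l t * rot (β / l))
      (rotMat α * boostMat t * rotMat β).1 := by
    have hα := covers_rot l (α / l)
    have hβ := covers_rot l (β / l)
    rw [mul_div_cancel₀ _ hl] at hα hβ
    exact (hα.mul (covers_boost l t)).mul hβ
  have h1 := hc.inv.mul hA
  rw [inv_mul_cancel] at h1
  obtain ⟨ζ, -, hζ⟩ := exists_rot_of_covers_one h1
  obtain ⟨θ, rfl⟩ := Circle.exp_surjective ζ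
  refine ⟨α / l, t, β / l + θ, ?_⟩
  rw [rot_add, ← mul_assoc, ← inv_mul_eq_iff_eq_mul]
  exact Subtype.ext (Equiv.ext hζ)

theorem generatedBy_eq_lorentzLifts {l : ℕ} [NeZero l] {X : Set (ℝ → ℝ)}
    (h1 : generators l ⊆ X) (h2 : X ⊆ Submodule.span ℝ (generators l)) :
    generatedBy (Diffeomorph.refl (𝓡 1) Circle ∞) X = lorentzLifts l := by
  apply le_antisymm
  · refine (Subgroup.closure_le _).2 ?_
    rintro g ⟨f, hf, t, hg⟩
    obtain ⟨a, b, c, habc⟩ := mem_span_generators (h2 hf)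
    exact exists_covers_of_flow habc hg
  · have hrot : ∀ θ, rot θ ∈ generatedBy (Diffeomorph.refl (𝓡 1) Circle ∞) X := fun θ =>
      Subgroup.subset_closure ⟨_, h1 (by simp [generators]), _, isFlowMap_rot l θ⟩
    have hboost : ∀ t, boost l t ∈ generatedBy (Diffeomorph.refl (𝓡 1) Circle ∞) X := fun t =>
      Subgroup.subset_closure ⟨_, h1 (by simp [generators]), _, isFlowMap_boost l t⟩
    intro g hg
    obtain ⟨α, t, β, rfl⟩ := exists_eq_rot_mul_boost_mul_rot hg
    exact mul_mem (mul_mem (hrot _) (hboost _)) (hrot _)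

/-- Flows in a chart are conjugate to flows in the standard angle. -/
theorem isFlowMap_iff_chartConj {χ : Chart} {f : ℝ → ℝ} {t : ℝ} {g : DiffPlus} :
    IsFlowMap χ f t g ↔ IsFlowMap (Diffeomorph.refl (𝓡 1) Circle ∞) f t (chartConj χ g) :=
  Iff.rfl

theorem generatedBy_eq_comap (χ : Chart) (X : Set (ℝ → ℝ)) : generatedBy χ X =
    (generatedBy (Diffeomorph.refl (𝓡 1) Circle ∞) X).comap (chartConj χ) := by
  apply le_antisymm
  · refine (Subgroup.closure_le _).2 ?_
    rintro g ⟨f, hf, t, hg⟩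
    exact Subgroup.subset_closure ⟨f, hf, t, hg⟩
  · intro g hg
    have h : generatedBy (Diffeomorph.refl (𝓡 1) Circle ∞) X ≤
        (generatedBy χ X).comap (chartConj χ.symm) := by
      refine (Subgroup.closure_le _).2 ?_
      rintro g ⟨f, hf, t, hg⟩
      refine Subgroup.subset_closure ⟨f, hf, t, ?_⟩
      rw [isFlowMap_iff_chartConj, chartConj_chartConj_symm]
      exact hg
    have := h hg
    rwa [Subgroup.mem_comap, chartConj_symm_chartConj] at this

end CircleDiff

namespace CircleDiff

open Matrix Topology Function

/-! ### The covering homomorphism -/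

/-- The homomorphism that sends an `l`-fold lift to the Lorentz transformation that it covers. -/
noncomputable def lorentzHom (l : ℕ) [NeZero l] : lorentzLifts l →* SOup where
  toFun g := g.2.choose
  map_one' := Subtype.ext ((1 : lorentzLifts l).2.choose_spec.unique (Covers.one l))
  map_mul' g h := Subtype.ext ((g * h).2.choose_spec.unique
    (g.2.choose_spec.mul h.2.choose_spec))

theorem covers_lorentzHom {l : ℕ} [NeZero l] (g : lorentzLifts l) :
    Covers l g.1 (lorentzHom l g).1 :=
  g.2.choose_spec

theorem lorentzHom_eq {l : ℕ} [NeZero l] {g : lorentzLifts l} {A : SOup}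
    (h : Covers l g.1 A.1) : lorentzHom l g = A :=
  Subtype.ext ((covers_lorentzHom g).unique h)

theorem rot_mul_boost_mul_rot_mem (l : ℕ) [NeZero l] (α t β : ℝ) :
    rot α * boost l t * rot β ∈ lorentzLifts l :=
  mul_mem (mul_mem ⟨_, covers_rot l α⟩ ⟨_, covers_boost l t⟩) ⟨_, covers_rot l β⟩

theorem lorentzHom_surjective (l : ℕ) [NeZero l] : Surjective (lorentzHom l) := by
  intro A
  have hl : (l : ℝ) ≠ 0 := by exact_mod_cast NeZero.ne l
  obtain ⟨α, t, β, rfl⟩ := SOup.exists_eq_rot_mul_boost_mul_rot A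
  refine ⟨⟨_, rot_mul_boost_mul_rot_mem l (α / l) t (β / l)⟩, lorentzHom_eq ?_⟩
  have hα := covers_rot l (α / l)
  have hβ := covers_rot l (β / l)
  rw [mul_div_cancel₀ _ hl] at hα hβ
  exact (hα.mul (covers_boost l t)).mul hβ

/-- The Minkowski product. -/
def mink (x y : Fin 3 → ℝ) : ℝ := x 0 * y 0 - x 1 * y 1 - x 2 * y 2

theorem mink_mulVec (A : SOup) (x y : Fin 3 → ℝ) :
    mink (A.1.1 *ᵥ x) (A.1.1 *ᵥ y) = mink x y := by
  have h : ∀ x y : Fin 3 → ℝ, mink x y = x ⬝ᵥ (minkowski *ᵥ y) := by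
    intro x y
    simp [mink, minkowski, dotProduct, Fin.sum_univ_three, Matrix.mulVec_diagonal]
    ring
  rw [h, h, ← Matrix.vecMul_transpose, ← Matrix.dotProduct_mulVec, Matrix.mulVec_mulVec,
    Matrix.mulVec_mulVec]
  exact congrArg (fun M : Matrix (Fin 3) (Fin 3) ℝ => x ⬝ᵥ M *ᵥ y) A.2.1

theorem continuous_nullVec : Continuous nullVec := by
  refine continuous_pi fun i => ?_
  fin_cases i
  · exact continuous_const
  · exact Complex.continuous_re.comp (by fun_prop)
  · exact Complex.continuous_im.comp (by fun_prop)

/-- Three positive functions are continuous if their pairwise products are, as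
`c² = (c d) (c e) / (d e)`. -/
theorem continuous_of_continuous_mul {X : Type*} [TopologicalSpace X] {c d e : X → ℝ}
    (hc : ∀ x, 0 < c x) (hd : ∀ x, 0 < d x) (he : ∀ x, 0 < e x)
    (hcd : Continuous fun x => c x * d x) (hce : Continuous fun x => c x * e x)
    (hde : Continuous fun x => d x * e x) : Continuous c := by
  have h : Continuous fun x => √(c x * d x * (c x * e x) / (d x * e x)) :=
    ((hcd.mul hce).div hde fun x => (mul_pos (hd x) (he x)).ne').sqrt
  refine h.congr fun x => ?_
  have h1 := (hd x).ne'
  have h2 := (he x).ne'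
  rw [show c x * d x * (c x * e x) / (d x * e x) = c x ^ 2 by field_simp,
    Real.sqrt_sq (hc x).le]

/-- The images of three light rays determine a Lorentz transformation and depend continuously on
the lift; the products of the scaling factors on these rays are found from the Minkowski products
of null vectors. -/
theorem continuous_lorentzHom (l : ℕ) [NeZero l] : Continuous (lorentzHom l) := by
  have hl : (l : ℝ) ≠ 0 := by exact_mod_cast NeZero.ne l
  -- the images of three light rays
  let W : ℝ → lorentzLifts l → Fin 3 → ℝ := fun φ g => nullVec (g.1.1 (Circle.exp (φ / l)) ^ l)
  have hW : ∀ φ, Continuous (W φ) := fun φ => continuous_nullVec.comp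
    (((continuous_eval_diffPlus _).comp continuous_subtype_val).pow l)
  have hm : ∀ φ ψ, Continuous fun g => mink (W φ g) (W ψ g) := by
    intro φ ψ
    have h := fun φ i => (continuous_apply i).comp (hW φ)
    unfold mink
    exact (((h φ 0).mul (h ψ 0)).sub ((h φ 1).mul (h ψ 1))).sub ((h φ 2).mul (h ψ 2))
  have hc : ∀ φ, ∃ c : lorentzLifts l → ℝ, ∀ g, 0 < c g ∧
      (lorentzHom l g).1.1 *ᵥ ![1, Real.cos φ, Real.sin φ] = c g • W φ g := by
    intro φ
    choose c hc using fun g : lorentzLifts l => covers_lorentzHom g (Circle.exp (φ / l))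
    refine ⟨c, fun g => ?_⟩
    have := hc g
    rwa [circle_exp_pow, mul_div_cancel₀ _ hl, nullVec, circle_exp_re, circle_exp_im] at this
  have hmc : ∀ (φ ψ : ℝ) (c d : lorentzLifts l → ℝ),
      1 - Real.cos φ * Real.cos ψ - Real.sin φ * Real.sin ψ ≠ 0 →
      (∀ g, (lorentzHom l g).1.1 *ᵥ ![1, Real.cos φ, Real.sin φ] = c g • W φ g) →
      (∀ g, (lorentzHom l g).1.1 *ᵥ ![1, Real.cos ψ, Real.sin ψ] = d g • W ψ g) →
      Continuous fun g => c g * d g := by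
    intro φ ψ c d hne h1 h2
    have key : ∀ g, c g * d g * mink (W φ g) (W ψ g) =
        1 - Real.cos φ * Real.cos ψ - Real.sin φ * Real.sin ψ := by
      intro g
      have h3 := mink_mulVec (lorentzHom l g) ![1, Real.cos φ, Real.sin φ]
        ![1, Real.cos ψ, Real.sin ψ]
      rw [h1, h2] at h3
      simp only [mink, Pi.smul_apply, smul_eq_mul] at h3 ⊢
      simp at h3
      linear_combination h3
    have hne' : ∀ g, mink (W φ g) (W ψ g) ≠ 0 := fun g h => hne (by
      rw [← key g, h, mul_zero])
    refine ((continuous_const (y := 1 - Real.cos φ * Real.cos ψ - Real.sin φ * Real.sin ψ)).div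
      (hm φ ψ) hne').congr fun g => ?_
    rw [Pi.div_apply]
    rw [← key g, mul_div_cancel_right₀ _ (hne' g)]
  obtain ⟨c0, h0⟩ := hc 0
  obtain ⟨c1, h1⟩ := hc (Real.pi / 2)
  obtain ⟨c2, h2⟩ := hc Real.pi
  have e01 := hmc _ _ c0 c1 (by simp) (fun g => (h0 g).2) (fun g => (h1 g).2)
  have e02 := hmc _ _ c0 c2 (by norm_num) (fun g => (h0 g).2) (fun g => (h2 g).2)
  have e12 := hmc _ _ c1 c2 (by simp) (fun g => (h1 g).2) (fun g => (h2 g).2)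
  have hc0 : Continuous c0 := continuous_of_continuous_mul (fun g => (h0 g).1)
    (fun g => (h1 g).1) (fun g => (h2 g).1) e01 e02 e12
  have hc1 : Continuous c1 := continuous_of_continuous_mul (fun g => (h1 g).1)
    (fun g => (h0 g).1) (fun g => (h2 g).1) (by simpa only [mul_comm] using e01) e12 e02
  have hc2 : Continuous c2 := continuous_of_continuous_mul (fun g => (h2 g).1)
    (fun g => (h0 g).1) (fun g => (h1 g).1) (by simpa only [mul_comm] using e02)
    (by simpa only [mul_comm] using e12) e01
  have hcol : ∀ (φ : ℝ) (c : lorentzLifts l → ℝ), Continuous c →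
      (∀ g, (lorentzHom l g).1.1 *ᵥ ![1, Real.cos φ, Real.sin φ] = c g • W φ g) →
      ∀ i, Continuous fun g => (lorentzHom l g).1.1 i 0 + (lorentzHom l g).1.1 i 1 * Real.cos φ +
        (lorentzHom l g).1.1 i 2 * Real.sin φ := by
    intro φ c hc h i
    refine (hc.mul ((continuous_apply i).comp (hW φ))).congr fun g => ?_
    have := congrFun (h g) i
    simp [Matrix.mulVec, dotProduct, Fin.sum_univ_three] at this
    simp [this]
  refine continuous_induced_rng.2 (continuous_induced_rng.2 (continuous_matrix fun i j => ?_))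
  have k0 := hcol _ c0 hc0 (fun g => (h0 g).2) i
  have k1 := hcol _ c1 hc1 (fun g => (h1 g).2) i
  have k2 := hcol _ c2 hc2 (fun g => (h2 g).2) i
  simp only [Real.cos_zero, Real.sin_zero, Real.cos_pi, Real.sin_pi, Real.cos_pi_div_two,
    Real.sin_pi_div_two, mul_one, mul_zero, add_zero, mul_neg] at k0 k1 k2
  have z0 : Continuous fun g => (lorentzHom l g).1.1 i 0 :=
    ((k0.add k2).div_const 2).congr fun g => by
      simp only [Pi.add_apply]
      ring
  fin_cases j
  · exact z0
  · exact (k0.sub z0).congr fun g => add_sub_cancel_left _ _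
  · exact (k1.sub z0).congr fun g => add_sub_cancel_left _ _

/-! ### The covering of the Lorentz group -/

theorem rotMat_eq_one {θ : ℝ} (h : Circle.exp θ = 1) : rotMat θ = 1 := by
  have h1 := circle_exp_re θ
  have h2 := circle_exp_im θ
  rw [h] at h1 h2
  simp at h1 h2
  rw [← rotMat_zero]
  refine Subtype.ext (Subtype.ext ?_)
  ext i j
  fin_cases i <;> fin_cases j <;> simp [rotMat, ← h1, ← h2]

theorem card_ker_lorentzHom (l : ℕ) [NeZero l] : Nat.card (lorentzHom l).ker = l := by
  have hmem : ∀ ζ : rootsOfUnity l Circle,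
      Covers l (rot (Complex.arg ((ζ.1 : Circle) : ℂ))) (1 : SOup).1 := by
    intro ζ
    have h := covers_rot l (Complex.arg ((ζ.1 : Circle) : ℂ))
    rwa [rotMat_eq_one] at h
    rw [← circle_exp_pow, Circle.exp_arg, ← Units.val_pow_eq_pow_val,
      (mem_rootsOfUnity l ζ.1).1 ζ.2, Units.val_one]
  let f : rootsOfUnity l Circle → (lorentzHom l).ker := fun ζ =>
    ⟨⟨rot (Complex.arg ((ζ.1 : Circle) : ℂ)), 1, hmem ζ⟩, lorentzHom_eq (hmem ζ)⟩
  have hf : Bijective f := by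
    constructor
    · intro ζ ξ h
      have h1 : (f ζ).1.1.1 1 = (f ξ).1.1.1 1 := by rw [h]
      simp only [f, rot_apply, Circle.exp_arg, mul_one] at h1
      exact Subtype.ext (Units.ext h1)
    · rintro ⟨g, hg⟩
      have h1 := covers_lorentzHom g
      rw [show lorentzHom l g = 1 from hg] at h1
      obtain ⟨ζ, hζ, h⟩ := exists_rot_of_covers_one h1
      refine ⟨⟨toUnits ζ, by rw [mem_rootsOfUnity, ← map_pow, hζ, map_one]⟩, ?_⟩
      refine Subtype.ext (Subtype.ext (Subtype.ext (Equiv.ext fun z => ?_)))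
      simp only [f, rot_apply, val_toUnits_apply, Circle.exp_arg, h]
  rw [← Nat.card_eq_of_bijective f hf, HasEnoughRootsOfUnity.natCard_rootsOfUnity]

instance : T2Space DiffPlus :=
  T2Space.of_injective_continuous (f := fun (g : DiffPlus) (z : Circle) => g.1 z)
    (fun _ _ h => Subtype.ext (Equiv.ext fun z => congrFun h z))
    (continuous_pi fun z => continuous_eval_diffPlus z)

/-- The Cartan decomposition as a continuous surjective map onto the group of lifts. -/
theorem exists_continuous_surjective_lorentzLifts (l : ℕ) [NeZero l] :
    ∃ f : ℝ × ℝ × ℝ → lorentzLifts l, Continuous f ∧ Surjective f := by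
  refine ⟨fun x => ⟨_, rot_mul_boost_mul_rot_mem l x.1 x.2.1 x.2.2⟩, ?_, ?_⟩
  · refine Continuous.subtype_mk ?_ _
    exact ((continuous_rot.comp continuous_fst).mul ((continuous_boost l).comp
      (continuous_fst.comp continuous_snd))).mul
        (continuous_rot.comp (continuous_snd.comp continuous_snd))
  · rintro ⟨g, hg⟩
    obtain ⟨α, t, β, rfl⟩ := exists_eq_rot_mul_boost_mul_rot hg
    exact ⟨(α, t, β), rfl⟩

/-- The homomorphism is open because a surjective homomorphism from a `σ`-compact group to a locally
compact one is; its kernel is finite, hence discrete. -/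
theorem isFoldCoveringGroup_lorentzLifts (l : ℕ) [NeZero l] :
    IsFoldCoveringGroup l (lorentzLifts l) SOup := by
  obtain ⟨f, hf, hs⟩ := exists_continuous_surjective_lorentzLifts l
  have hsig : SigmaCompactSpace (lorentzLifts l) :=
    ⟨by rw [← hs.range_eq]; exact isSigmaCompact_range hf⟩
  have hopen : IsOpenMap (lorentzHom l) := MonoidHom.isOpenMap_of_sigmaCompact _
    (lorentzHom_surjective l) (continuous_lorentzHom l)
  have hq : IsQuotientMap (lorentzHom l) :=
    hopen.isQuotientMap (continuous_lorentzHom l) (lorentzHom_surjective l)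
  have hfin : Finite (lorentzHom l).ker := Nat.finite_of_card_ne_zero (by
    rw [card_ker_lorentzHom]
    exact NeZero.ne l)
  have hd : IsDiscrete ((lorentzHom l).ker : Set (lorentzLifts l)) :=
    (Set.toFinite _).isDiscrete
  exact
    { isTopologicalGroup := inferInstance
      connectedSpace := hs.connectedSpace hf
      exists_covering := ⟨lorentzHom l, lorentzHom_surjective l,
        (hq.isQuotientCoveringMap_of_isDiscrete_ker_monoidHom hd).isCoveringMap,
        card_ker_lorentzHom l⟩ }

/-- The kernel of a covering homomorphism onto the Lorentz group is the center, because it is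
discrete in a connected group and the Lorentz group has trivial center. -/
theorem IsFoldCoveringGroup.card_center {l : ℕ} {G : Type*} [Group G] [TopologicalSpace G]
    (h : IsFoldCoveringGroup l G SOup) : Nat.card (Subgroup.center G) = l := by
  obtain ⟨π, hs, hc, hl⟩ := h.exists_covering
  have := h.isTopologicalGroup
  have := h.connectedSpace
  have e : Subgroup.center G = π.ker := by
    apply le_antisymm
    · intro z hz
      have h1 : π z ∈ Subgroup.center SOup := by
        refine Subgroup.mem_center_iff.2 fun A => ?_
        obtain ⟨g, rfl⟩ := hs A
        rw [← map_mul, ← map_mul, Subgroup.mem_center_iff.1 hz g]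
      rw [center_SOup] at h1
      exact h1
    · intro k hk
      have hk' : π k = 1 := hk
      refine Subgroup.mem_center_iff.2 fun g => ?_
      have h1 := hc.const_of_comp (g := fun g : G => g * k * g⁻¹) (by fun_prop)
        (fun a a' => by simp [hk']) g 1
      simp only [one_mul, inv_one, mul_one] at h1
      exact mul_inv_eq_iff_eq_mul.1 h1
  rw [e, hl]

theorem IsFoldCoveringGroup.of_mulEquiv {l : ℕ} {G G' H : Type*} [Group G] [TopologicalSpace G]
    [IsTopologicalGroup G] [Group G'] [TopologicalSpace G'] [Group H] [TopologicalSpace H]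
    (h : IsFoldCoveringGroup l G' H) (e : G ≃* G') (he : Continuous e)
    (he' : Continuous e.symm) : IsFoldCoveringGroup l G H := by
  obtain ⟨π, hs, hc, hl⟩ := h.exists_covering
  have := h.connectedSpace
  refine ⟨inferInstance, e.symm.surjective.connectedSpace he', π.comp e.toMonoidHom,
    hs.comp e.surjective, hc.comp_homeomorph ⟨e.toEquiv, he, he'⟩, ?_⟩
  rw [← hl]
  exact Nat.card_congr (e.toEquiv.subtypeEquiv fun g => Iff.rfl)

end CircleDiff

namespace CircleDiff

open Topology Function Filter

/-! ### The canonical lift -/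

theorem hasAngleDeriv_of_contMDiff {u : Circle → Circle} (hu : ContMDiff (𝓡 1) (𝓡 1) ∞ u)
    (z : Circle) : HasAngleDeriv u (angleDeriv u z) z := by
  obtain ⟨-, H', h, -⟩ := fam_of_contMDiff (P := Unit) hu 1
  have h1 := (h () z).hasAngleDeriv
  rwa [h1.angleDeriv]

theorem hasAngleDeriv_diffPlus (g : DiffPlus) (z : Circle) :
    HasAngleDeriv g.1 (angleDeriv g.1 z) z :=
  hasAngleDeriv_of_contMDiff g.2.1 z

theorem angleDeriv_comp {u v : Circle → Circle} (hu : ContMDiff (𝓡 1) (𝓡 1) ∞ u)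
    (hv : ContMDiff (𝓡 1) (𝓡 1) ∞ v) (z : Circle) :
    angleDeriv (fun z => u (v z)) z = angleDeriv u (v z) * angleDeriv v z :=
  ((hasAngleDeriv_of_contMDiff hu (v z)).comp (hasAngleDeriv_of_contMDiff hv z)).angleDeriv

theorem angleDeriv_id (z : Circle) : angleDeriv (fun z => z) z = 1 :=
  (hasAngleDeriv_id z).angleDeriv

theorem angleDeriv_symm_mul (χ : Chart) (z : Circle) :
    angleDeriv χ.symm (χ z) * angleDeriv χ z = 1 := by
  rw [← angleDeriv_comp χ.symm.contMDiff χ.contMDiff]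
  simp only [Diffeomorph.symm_apply_apply]
  exact angleDeriv_id z

theorem angleDeriv_inv_mul (g : DiffPlus) (z : Circle) :
    angleDeriv (g⁻¹).1 (g.1 z) * angleDeriv g.1 z = 1 := by
  rw [← angleDeriv_comp (g⁻¹).2.1 g.2.1]
  have e : (fun z => (g⁻¹).1 (g.1 z)) = fun z => z := by
    funext z
    exact g.1.symm_apply_apply z
  rw [e]
  exact angleDeriv_id z

/-- Near `0`, a continuous lift differs from its value at the base point by the argument in
`(-π, π]`. -/
theorem IsAngleLift.hasDerivAt {h : Circle → Circle} {F : ℝ → ℝ} (hF : IsAngleLift h F)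
    (hc : Continuous F) {v φ : ℝ} (hv : HasAngleDeriv h v (Circle.exp φ)) : HasDerivAt F v φ := by
  have h1 := hasDerivAt_angle (u := fun s => h (Circle.exp φ * Circle.exp s)) hv
  simp only [Circle.exp_zero, mul_one] at h1
  rw [hv.eq hv] at h1
  have h2 : (fun s : ℝ => F (φ + s) - F φ) =ᶠ[𝓝 0] fun s => Complex.arg
      ((h (Circle.exp φ * Circle.exp s) / h (Circle.exp φ) : Circle) : ℂ) := by
    have h3 : Continuous fun s : ℝ => F (φ + s) - F φ := by fun_prop
    have h4 : ∀ᶠ s : ℝ in 𝓝 0, F (φ + s) - F φ ∈ Set.Ioo (-Real.pi) Real.pi :=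
      h3.continuousAt.eventually_mem (by
        simpa using Ioo_mem_nhds (by linarith [Real.pi_pos]) Real.pi_pos)
    filter_upwards [h4] with s hs
    rw [← Circle.exp_add, hF, hF, ← Circle.exp_sub, Circle.arg_exp hs.1 hs.2.le]
  have h5 := ((h1.congr_of_eventuallyEq h2).add_const (F φ))
  have h6 := HasDerivAt.comp_const_add (-φ) φ (f := fun s => F (φ + s) - F φ + F φ)
    (by simpa using h5)
  simpa using h6

theorem angleDeriv_pos (g : DiffPlus) (z : Circle) : 0 < angleDeriv g.1 z := by
  obtain ⟨F, hF⟩ := g.2.2.2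
  obtain ⟨φ, rfl⟩ := Circle.exp_surjective z
  have h := hF.hasDerivAt F.continuous (hasAngleDeriv_diffPlus g (Circle.exp φ))
  have h0 : 0 ≤ angleDeriv g.1 (Circle.exp φ) := by
    rw [← h.deriv]
    exact F.monotone.deriv_nonneg
  refine h0.lt_of_ne fun h1 => ?_
  have := angleDeriv_inv_mul g (Circle.exp φ)
  rw [← h1, mul_zero] at this
  exact zero_ne_one this

theorem cotangentLift_apply (g : DiffPlus) (q : Circle) (p : ℝ) :
    cotangentLift g (q, p) = (g.1 q, p * (angleDeriv g.1 q)⁻¹) := by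
  have h := eq_inv_of_mul_eq_one_left (angleDeriv_inv_mul g q)
  rw [← h]
  rfl

theorem cotangentLift_one (x : Circle × ℝ) : cotangentLift 1 x = x := by
  obtain ⟨q, p⟩ := x
  rw [cotangentLift_apply]
  have : angleDeriv (1 : DiffPlus).1 q = 1 := angleDeriv_id q
  rw [this, inv_one, mul_one]
  rfl

theorem cotangentLift_mul (g h : DiffPlus) (x : Circle × ℝ) :
    cotangentLift (g * h) x = cotangentLift g (cotangentLift h x) := by
  obtain ⟨q, p⟩ := x
  simp only [cotangentLift_apply]
  have : angleDeriv (g * h).1 q = angleDeriv g.1 (h.1 q) * angleDeriv h.1 q :=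
    angleDeriv_comp g.2.1 h.2.1 q
  rw [this, mul_inv, mul_assoc, mul_comm (angleDeriv h.1 q)⁻¹]
  rfl

theorem cotangentLift_rot (θ p : ℝ) (q : Circle) :
    cotangentLift (rot θ) (q, p) = (Circle.exp θ * q, p) := by
  rw [cotangentLift_apply]
  have h : HasAngleDeriv (rot θ).1 1 q := by
    obtain ⟨φ, rfl⟩ := Circle.exp_surjective q
    have hF : IsAngleLift (rot θ).1 (fun φ => θ + φ) := fun φ => by
      rw [rot_apply, Circle.exp_add]
    exact hF.hasAngleDeriv ((hasDerivAt_id φ).const_add θ)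
  rw [h.angleDeriv]
  simp

/-- The boosts fix the direction `1` and rescale its momentum. -/
theorem cotangentLift_boost (l : ℕ) [NeZero l] (t p : ℝ) :
    cotangentLift (boost l t) (1, p) = (1, p * Real.exp (-t)) := by
  have ha : |-Real.tanh (t / 2)| < 1 := by simpa using abs_tanh_lt_one (t / 2)
  have h1 : (boost l t).1 1 = 1 := by
    rw [← Circle.exp_zero, isAngleLift_boost]
    simp [boostLift, boostAngle]
  have h2 := (isAngleLift_boost l t).hasAngleDeriv (hasDerivAt_boostLift (NeZero.ne l) ha 0)
  rw [Circle.exp_zero] at h2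
  rw [cotangentLift_apply, h1, h2.angleDeriv]
  congr 2
  have hc := (Real.cosh_pos (t / 2)).ne'
  have hs : Real.cosh (t / 2) - Real.sinh (t / 2) = Real.exp (-(t / 2)) :=
    Real.cosh_sub_sinh _
  have hs' : Real.cosh (t / 2) + Real.sinh (t / 2) = Real.exp (t / 2) :=
    Real.cosh_add_sinh _
  have e1 := (Real.exp_pos (-(t / 2))).ne'
  have e2 := (Real.exp_pos (t / 2)).ne'
  have e3 : Real.exp (-t) = Real.exp (-(t / 2)) / Real.exp (t / 2) := by
    rw [← Real.exp_sub]; ring_nf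
  rw [e3, Real.tanh_eq_sinh_div_cosh, mul_zero, Real.cos_zero, inv_div, div_eq_div_iff]
  · rw [← hs, ← hs']
    field_simp
    ring
  · have : 1 - (-(Real.sinh (t / 2) / Real.cosh (t / 2))) ^ 2 =
        Real.exp (t / 2) * Real.exp (-(t / 2)) / Real.cosh (t / 2) ^ 2 := by
      rw [← hs, ← hs']
      field_simp
      ring
    rw [this]
    positivity
  · exact e2

theorem liftTransitive_lorentzLifts (l : ℕ) [NeZero l] : LiftTransitive (lorentzLifts l) := by
  rintro ⟨q, p⟩ hp ⟨q', p'⟩ hp'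
  replace hp : 0 < p := hp
  replace hp' : 0 < p' := hp'
  obtain ⟨α, rfl⟩ := Circle.exp_surjective q
  obtain ⟨β, rfl⟩ := Circle.exp_surjective q'
  refine ⟨_, rot_mul_boost_mul_rot_mem l β (Real.log (p / p')) (-α), ?_⟩
  rw [cotangentLift_mul, cotangentLift_mul, cotangentLift_rot (-α) p (Circle.exp α),
    ← Circle.exp_add, neg_add_cancel, Circle.exp_zero, cotangentLift_boost,
    cotangentLift_rot β, mul_one, Real.exp_neg,
    Real.exp_log (div_pos hp hp')]
  field_simp

/-- Transitivity on the phase space does not depend on the chart: the chart acts on the covectors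
through the absolute value of its derivative, even if it reverses the orientation. -/
theorem LiftTransitive.comap_chartConj {G : Subgroup DiffPlus} (hG : LiftTransitive G)
    (χ : Chart) : LiftTransitive (G.comap (chartConj χ)) := by
  have hne : ∀ z, angleDeriv χ z ≠ 0 := fun z h => by
    have := angleDeriv_symm_mul χ z
    rw [h, mul_zero] at this
    exact zero_ne_one this
  have habs : ∀ z, 0 < |angleDeriv χ z| := fun z => abs_pos.2 (hne z)
  rintro ⟨q, p⟩ hp ⟨q', p'⟩ hp'
  obtain ⟨h, hh, e⟩ := hG (χ q, p / |angleDeriv χ q|) (div_pos hp (habs q))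
    (χ q', p' / |angleDeriv χ q'|) (div_pos hp' (habs q'))
  have hgh : chartConj χ (chartConj χ.symm h) = h := chartConj_chartConj_symm χ h
  set g := chartConj χ.symm h with hg
  have hgG : g ∈ G.comap (chartConj χ) := by rwa [Subgroup.mem_comap, hgh]
  refine ⟨g, hgG, ?_⟩
  rw [cotangentLift_apply] at e ⊢
  obtain ⟨e1, e2⟩ := Prod.mk.inj e
  have hq : g.1 q = q' := by
    have : g.1 q = χ.symm (h.1 (χ q)) := rfl
    rw [this, e1, χ.symm_apply_apply]
  -- the chain rule for `χ ∘ g = h ∘ χ`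
  have key : angleDeriv χ q' * angleDeriv g.1 q = angleDeriv h.1 (χ q) * angleDeriv χ q := by
    rw [← angleDeriv_comp h.2.1 χ.contMDiff, ← hq, ← angleDeriv_comp χ.contMDiff g.2.1]
    congr 1
    funext z
    have : g.1 z = χ.symm (h.1 (χ z)) := rfl
    rw [this, χ.apply_symm_apply]
  have key' := congrArg abs key
  rw [abs_mul, abs_mul, abs_of_pos (angleDeriv_pos g q), abs_of_pos (angleDeriv_pos h _)] at key'
  rw [hq]
  congr 1
  have n1 := (habs q).ne'
  have n2 := (habs q').ne'
  have n3 := (angleDeriv_pos g q).ne'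
  have n4 := (angleDeriv_pos h (χ q)).ne'
  field_simp at e2 ⊢
  have : |angleDeriv χ q'| * p = |angleDeriv χ q'| * (p' * angleDeriv g.1 q) := by
    rw [mul_left_comm, key']
    linear_combination e2
  exact mul_left_cancel₀ n2 this

theorem not_liftTransitive_of_fixed {G : Subgroup DiffPlus} {q : Circle}
    (h : ∀ g ∈ G, g.1 q = q) : ¬ LiftTransitive G := by
  intro hG
  have h1 : (0 : ℝ) < 1 := one_pos
  obtain ⟨g, hg, e⟩ := hG (q, 1) h1 (q * Circle.exp Real.pi, 1) h1
  have e1 : g.1 q = q * Circle.exp Real.pi := congrArg Prod.fst e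
  rw [h g hg, left_eq_mul] at e1
  have := circle_exp_re Real.pi
  rw [e1] at this
  simp at this
  norm_num at this

/-- In a commutative group that is transitive on the circle, an element with a fixed point is
trivial, so no element rescales the momentum at a point. -/
theorem not_liftTransitive_of_commute {G : Subgroup DiffPlus}
    (h : ∀ g ∈ G, ∀ k ∈ G, g * k = k * g) : ¬ LiftTransitive G := by
  intro hG
  have h1 : (0 : ℝ) < 1 := one_pos
  have h2 : (0 : ℝ) < 2 := two_pos
  obtain ⟨g, hg, e⟩ := hG (1, 1) h1 (1, 2) h2
  have e1 : g.1 1 = 1 := congrArg Prod.fst e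
  have hg1 : g = 1 := by
    refine Subtype.ext (Equiv.ext fun z => ?_)
    obtain ⟨k, hk, ek⟩ := hG (1, 1) h1 (z, 1) h1
    have e2 : k.1 1 = z := congrArg Prod.fst ek
    have e3 := congrArg (fun f : DiffPlus => f.1 1) (h g hg k hk)
    change g.1 (k.1 1) = k.1 (g.1 1) at e3
    -- `g` commutes with an element `k` that moves the fixed point `1` of `g` to `z`
    rw [e1, e2] at e3
    exact e3
  rw [hg1, cotangentLift_one] at e
  norm_num at e

end CircleDiff

namespace CircleDiff

open Topology Function Filter
open scoped ComplexConjugate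

/-! ### Trigonometric polynomials -/

/-- The evaluation of a Laurent polynomial `∑ pₙ zⁿ` at `z = e^{iφ}`, as a function of `φ`. -/
noncomputable def trigEval : AddMonoidAlgebra ℂ ℤ →ₐ[ℂ] (ℝ → ℂ) :=
  AddMonoidAlgebra.lift ℂ (ℝ → ℂ) ℤ
    { toFun := fun n φ => Complex.exp (n.toAdd * φ * Complex.I)
      map_one' := by funext φ; simp
      map_mul' := fun m n => by
        funext φ
        rw [Pi.mul_apply, ← Complex.exp_add, toAdd_mul]
        push_cast
        ring_nf }

theorem trigEval_single (n : ℤ) (c : ℂ) (φ : ℝ) :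
    trigEval (AddMonoidAlgebra.single n c) φ = c * Complex.exp (n * φ * Complex.I) := by
  rw [trigEval, AddMonoidAlgebra.lift_single]
  rfl

/-- A trigonometric polynomial determines its coefficients, since the characters `e^{inφ}` of `ℝ`
are linearly independent. -/
theorem trigEval_injective : Injective trigEval := by
  let χ : ℤ → (Multiplicative ℝ →* ℂ) := fun n =>
    { toFun := fun φ => Complex.exp (n * φ.toAdd * Complex.I)
      map_one' := by simp
      map_mul' := fun a b => by
        rw [← Complex.exp_add, toAdd_mul]
        push_cast
        ring_nf }
  have hd : ∀ n : ℤ, HasDerivAt (fun s : ℝ => Complex.exp (n * s * Complex.I))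
      (n * Complex.I) 0 := fun n => by
    have := ((((hasDerivAt_id (0 : ℝ)).ofReal_comp).const_mul (n : ℂ)).mul_const Complex.I).cexp
    simpa using this
  have hχ : Injective χ := fun m n h => by
    have h1 : (fun s : ℝ => Complex.exp (m * s * Complex.I)) =
        fun s : ℝ => Complex.exp (n * s * Complex.I) :=
      funext fun s => DFunLike.congr_fun h (Multiplicative.ofAdd s)
    have h2 := (h1 ▸ hd m).unique (hd n)
    exact_mod_cast mul_right_cancel₀ Complex.I_ne_zero h2
  have hli := (linearIndependent_monoidHom (Multiplicative ℝ) ℂ).comp χ hχ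
  rw [linearIndependent_iff_injective_finsuppLinearCombination] at hli
  intro p q h
  refine AddMonoidAlgebra.coeff_injective (hli ?_)
  funext φ
  have h1 := congrFun h φ.toAdd
  simp only [trigEval, AddMonoidAlgebra.lift_apply, Finsupp.sum_apply'] at h1
  simp only [Finsupp.linearCombination_apply, Finsupp.sum_apply']
  exact h1

/-- The derivative of a trigonometric polynomial. -/
theorem exists_hasDerivAt_trigEval (p : AddMonoidAlgebra ℂ ℤ) :
    ∃ q : AddMonoidAlgebra ℂ ℤ, (∀ n, q.coeff n = Complex.I * n * p.coeff n) ∧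
      ∀ φ, HasDerivAt (trigEval p) (trigEval q φ) φ := by
  induction p using AddMonoidAlgebra.induction_linear with
  | zero => exact ⟨0, by simp, fun φ => by simp⟩
  | add p p' h h' =>
    obtain ⟨q, hq, hd⟩ := h
    obtain ⟨q', hq', hd'⟩ := h'
    refine ⟨q + q', fun n => ?_, fun φ => ?_⟩
    · simp [hq, hq', mul_add]
    · rw [map_add, map_add]
      exact (hd φ).add (hd' φ)
  | single m c =>
    refine ⟨AddMonoidAlgebra.single m (Complex.I * m * c), fun n => ?_, fun φ => ?_⟩
    · simp only [AddMonoidAlgebra.coeff_single, Finsupp.single_apply]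
      split_ifs with h
      · rw [h]
      · simp
    · have e : trigEval (AddMonoidAlgebra.single m c) = fun φ : ℝ =>
        c * Complex.exp (m * φ * Complex.I) := funext fun φ => trigEval_single m c φ
      rw [e, trigEval_single]
      have h := ((((hasDerivAt_id φ).ofReal_comp).const_mul (m : ℂ)).mul_const
        Complex.I).cexp.const_mul c
      refine h.congr_deriv ?_
      simp only [id, Complex.ofReal_one]
      ring

/-- The conjugate of a trigonometric polynomial. -/
theorem exists_conj_trigEval (p : AddMonoidAlgebra ℂ ℤ) :
    ∃ q : AddMonoidAlgebra ℂ ℤ, (∀ n, q.coeff n = conj (p.coeff (-n))) ∧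
      ∀ φ, trigEval q φ = conj (trigEval p φ) := by
  induction p using AddMonoidAlgebra.induction_linear with
  | zero => exact ⟨0, by simp, fun φ => by simp⟩
  | add p p' h h' =>
    obtain ⟨q, hq, hd⟩ := h
    obtain ⟨q', hq', hd'⟩ := h'
    exact ⟨q + q', fun n => by simp [hq, hq'], fun φ => by simp [hd, hd']⟩
  | single m c =>
    refine ⟨AddMonoidAlgebra.single (-m) (conj c), fun n => ?_, fun φ => ?_⟩
    · simp only [AddMonoidAlgebra.coeff_single, Finsupp.single_apply, neg_eq_iff_eq_neg]
      split_ifs <;> simp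
    · rw [trigEval_single, trigEval_single, map_mul, ← Complex.exp_conj]
      simp

/-- The real function `f` is the trigonometric polynomial `∑ pₙ e^{inφ}`. -/
def IsTrig (f : ℝ → ℝ) (p : AddMonoidAlgebra ℂ ℤ) : Prop := ∀ φ, (f φ : ℂ) = trigEval p φ

namespace IsTrig

variable {f g : ℝ → ℝ} {p q : AddMonoidAlgebra ℂ ℤ}

theorem unique (hp : IsTrig f p) (hq : IsTrig f q) : p = q :=
  trigEval_injective (funext fun φ => (hp φ).symm.trans (hq φ))

theorem add (hf : IsTrig f p) (hg : IsTrig g q) : IsTrig (f + g) (p + q) := fun φ => by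
  simp [← hf φ, ← hg φ]

theorem smul (c : ℝ) (hf : IsTrig f p) : IsTrig (c • f) ((c : ℂ) • p) := fun φ => by
  rw [map_smul]
  simp [← hf φ]

theorem zero : IsTrig 0 0 := fun φ => by simp

theorem coeff_neg (hf : IsTrig f p) (n : ℤ) : p.coeff (-n) = conj (p.coeff n) := by
  obtain ⟨q, h1, h2⟩ := exists_conj_trigEval p
  have : IsTrig f q := fun φ => by rw [h2, ← hf φ, Complex.conj_ofReal]
  rw [this.unique hf] at h1
  rw [h1 (-n), neg_neg]

theorem exists_deriv (hf : IsTrig f p) : ∃ p' : AddMonoidAlgebra ℂ ℤ,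
    (∀ n, p'.coeff n = Complex.I * n * p.coeff n) ∧ IsTrig (deriv f) p' := by
  obtain ⟨q, h1, h2⟩ := exists_hasDerivAt_trigEval p
  refine ⟨q, h1, fun φ => ?_⟩
  have e : trigEval p = fun φ => (f φ : ℂ) := funext fun φ => (hf φ).symm
  have h3 := h2 φ
  rw [e] at h3
  have h4 : HasDerivAt f (trigEval q φ).re φ := Complex.reCLM.hasFDerivAt.comp_hasDerivAt φ h3
  rw [h4.deriv]
  exact h4.ofReal_comp.unique h3

/-- The leading coefficient of a commutator. -/
theorem exists_bracket (hf : IsTrig f p) (hg : IsTrig g q) : ∃ r : AddMonoidAlgebra ℂ ℤ,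
    IsTrig (bracket f g) r ∧ ∀ M n : ℤ, (∀ m, M < m → p.coeff m = 0) →
      (∀ m, n < m → q.coeff m = 0) →
      r.coeff (M + n) = Complex.I * (n - M) * (p.coeff M * q.coeff n) := by
  obtain ⟨p', hp, hf'⟩ := hf.exists_deriv
  obtain ⟨q', hq, hg'⟩ := hg.exists_deriv
  refine ⟨p * q' - q * p', fun φ => ?_, fun M n hM hn => ?_⟩
  · simp [bracket, ← hf φ, ← hg φ, ← hf' φ, ← hg' φ]
  · have key : ∀ {a b : AddMonoidAlgebra ℂ ℤ} {A B : ℤ}, (∀ m, A < m → a.coeff m = 0) →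
        (∀ m, B < m → b.coeff m = 0) → (a * b).coeff (A + B) = a.coeff A * b.coeff B := by
      intro a b A B ha hb
      refine AddMonoidAlgebra.coeff_mul_add_of_uniqueAdd fun x y hx hy e => ?_
      rw [Finsupp.mem_support_iff] at hx hy
      have h1 : x ≤ A := not_lt.1 fun h => hx (ha x h)
      have h2 : y ≤ B := not_lt.1 fun h => hy (hb y h)
      omega
    have e1 := key hM (b := q') (B := n) (fun m hm => by rw [hq, hn m hm, mul_zero])
    have e2 := key hn (b := p') (B := M) (fun m hm => by rw [hp, hM m hm, mul_zero])
    rw [AddMonoidAlgebra.coeff_sub, Finsupp.sub_apply, e1, add_comm M n, e2, hp, hq]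
    ring

end IsTrig

theorem isTrig_vT : IsTrig vT (AddMonoidAlgebra.single 0 1) := fun φ => by
  rw [trigEval_single]
  simp [vT]

theorem isTrig_vC (k : ℕ) : IsTrig (vC k)
    (AddMonoidAlgebra.single (k : ℤ) (1 / 2) + AddMonoidAlgebra.single (-(k : ℤ)) (1 / 2)) :=
  fun φ => by
    simp only [vC, map_add, Pi.add_apply, trigEval_single, Complex.ofReal_cos, Complex.cos]
    push_cast
    ring_nf

theorem isTrig_vS (k : ℕ) : IsTrig (vS k)
    (AddMonoidAlgebra.single (k : ℤ) (-Complex.I / 2) +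
      AddMonoidAlgebra.single (-(k : ℤ)) (Complex.I / 2)) :=
  fun φ => by
    simp only [vS, map_add, Pi.add_apply, trigEval_single, Complex.ofReal_sin, Complex.sin]
    push_cast
    ring_nf

theorem exists_isTrig {f : ℝ → ℝ} (hf : f ∈ diffZero) : ∃ p, IsTrig f p := by
  induction hf using Submodule.span_induction with
  | mem f hf =>
    rcases hf with rfl | ⟨k, -, rfl | rfl⟩
    exacts [⟨_, isTrig_vT⟩, ⟨_, isTrig_vS k⟩, ⟨_, isTrig_vC k⟩]
  | zero => exact ⟨0, IsTrig.zero⟩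
  | add f g _ _ hf hg =>
    obtain ⟨p, hp⟩ := hf
    obtain ⟨q, hq⟩ := hg
    exact ⟨_, hp.add hq⟩
  | smul c f _ hf =>
    obtain ⟨p, hp⟩ := hf
    exact ⟨_, hp.smul c⟩

/-- The coefficient of `e^{inφ}` in the trigonometric polynomial `f` (meaningless if `f` is not a
trigonometric polynomial). -/
noncomputable def trigCoeff (f : ℝ → ℝ) (n : ℤ) : ℂ := (invFun trigEval fun φ => (f φ : ℂ)).coeff n

theorem IsTrig.trigCoeff {f : ℝ → ℝ} {p : AddMonoidAlgebra ℂ ℤ} (hf : IsTrig f p) (n : ℤ) :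
    trigCoeff f n = p.coeff n := by
  have : (fun φ => (f φ : ℂ)) = trigEval p := funext hf
  rw [CircleDiff.trigCoeff, this, leftInverse_invFun trigEval_injective]

section trigCoeff

variable {f g : ℝ → ℝ}

theorem trigCoeff_add (hf : f ∈ diffZero) (hg : g ∈ diffZero) (n : ℤ) :
    trigCoeff (f + g) n = trigCoeff f n + trigCoeff g n := by
  obtain ⟨p, hp⟩ := exists_isTrig hf
  obtain ⟨q, hq⟩ := exists_isTrig hg
  rw [(hp.add hq).trigCoeff, hp.trigCoeff, hq.trigCoeff]
  rfl

theorem trigCoeff_smul (c : ℝ) (hf : f ∈ diffZero) (n : ℤ) :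
    trigCoeff (c • f) n = c * trigCoeff f n := by
  obtain ⟨p, hp⟩ := exists_isTrig hf
  rw [(hp.smul c).trigCoeff, hp.trigCoeff]
  simp

theorem trigCoeff_neg (hf : f ∈ diffZero) (n : ℤ) : trigCoeff f (-n) = conj (trigCoeff f n) := by
  obtain ⟨p, hp⟩ := exists_isTrig hf
  rw [hp.trigCoeff, hp.trigCoeff, hp.coeff_neg]

theorem trigCoeff_deriv (hf : f ∈ diffZero) (n : ℤ) :
    trigCoeff (deriv f) n = Complex.I * n * trigCoeff f n := by
  obtain ⟨p, hp⟩ := exists_isTrig hf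
  obtain ⟨q, h, hq⟩ := hp.exists_deriv
  rw [hq.trigCoeff, hp.trigCoeff, h]

theorem trigCoeff_bracket (hf : f ∈ diffZero) (hg : g ∈ diffZero) {M n : ℤ}
    (hM : ∀ m, M < m → trigCoeff f m = 0) (hn : ∀ m, n < m → trigCoeff g m = 0) :
    trigCoeff (bracket f g) (M + n) =
      Complex.I * (n - M) * (trigCoeff f M * trigCoeff g n) := by
  obtain ⟨p, hp⟩ := exists_isTrig hf
  obtain ⟨q, hq⟩ := exists_isTrig hg
  obtain ⟨r, hr, h⟩ := hp.exists_bracket hq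
  simp only [hp.trigCoeff, hq.trigCoeff, hr.trigCoeff] at *
  exact h M n hM hn

theorem exists_trigCoeff_eq_zero (hf : f ∈ diffZero) : ∃ M : ℕ, ∀ m : ℤ, M < m →
    trigCoeff f m = 0 := by
  obtain ⟨p, hp⟩ := exists_isTrig hf
  refine ⟨p.coeff.support.sup Int.natAbs, fun m hm => ?_⟩
  rw [hp.trigCoeff]
  by_contra h
  have := Finset.le_sup (f := Int.natAbs) (Finsupp.mem_support_iff.2 h)
  omega

/-- A real trigonometric polynomial is determined by the coefficients of index `n ≥ 0`. -/
theorem eq_of_trigCoeff (hf : f ∈ diffZero) (hg : g ∈ diffZero)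
    (h : ∀ n : ℤ, 0 ≤ n → trigCoeff f n = trigCoeff g n) : f = g := by
  have h' : ∀ n, trigCoeff f n = trigCoeff g n := fun n => by
    rcases le_total 0 n with hn | hn
    · exact h n hn
    · have := h (-n) (by omega)
      rw [trigCoeff_neg hf, trigCoeff_neg hg] at this
      exact (starRingEnd ℂ).injective this
  obtain ⟨p, hp⟩ := exists_isTrig hf
  obtain ⟨q, hq⟩ := exists_isTrig hg
  have : p = q := AddMonoidAlgebra.coeff_injective (Finsupp.ext fun n => by
    rw [← hp.trigCoeff, ← hq.trigCoeff, h'])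
  funext φ
  have := (hp φ).trans (this ▸ (hq φ).symm)
  exact_mod_cast this

end trigCoeff

theorem vT_mem_diffZero : vT ∈ diffZero := Submodule.subset_span (Or.inl rfl)

theorem vS_mem_diffZero {k : ℕ} (hk : 1 ≤ k) : vS k ∈ diffZero :=
  Submodule.subset_span (Or.inr ⟨k, hk, Or.inl rfl⟩)

theorem vC_mem_diffZero {k : ℕ} (hk : 1 ≤ k) : vC k ∈ diffZero :=
  Submodule.subset_span (Or.inr ⟨k, hk, Or.inr rfl⟩)

theorem trigCoeff_combination {N : ℕ} (hN : 1 ≤ N) (a b c : ℝ) {n : ℤ} (hn : 0 ≤ n) :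
    trigCoeff (a • vT + (b • vC N + c • vS N)) n =
      (if n = 0 then (a : ℂ) else 0) + if n = N then (b - c * Complex.I) / 2 else 0 := by
  rw [((isTrig_vT.smul a).add (((isTrig_vC N).smul b).add ((isTrig_vS N).smul c))).trigCoeff]
  have h : ¬ -(N : ℤ) = n := by omega
  simp only [AddMonoidAlgebra.coeff_add, AddMonoidAlgebra.coeff_smul, Finsupp.add_apply,
    Finsupp.smul_apply, AddMonoidAlgebra.coeff_single, Finsupp.single_apply, h, if_false,
    eq_comm (a := (0 : ℤ)), eq_comm (a := (N : ℤ)), smul_eq_mul]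
  split_ifs <;> ring

end CircleDiff

namespace CircleDiff

open Topology Function Filter
open scoped ComplexConjugate

/-! ### Finite-dimensional Lie algebras of trigonometric vector fields -/

theorem analyticOnNhd_of_mem_diffZero {f : ℝ → ℝ} (hf : f ∈ diffZero) :
    AnalyticOnNhd ℝ f Set.univ := by
  induction hf using Submodule.span_induction with
  | mem f hf =>
    have hl : ∀ (k : ℕ) (x : ℝ), AnalyticAt ℝ (fun φ : ℝ => (k : ℝ) * φ) x := fun k x =>
      analyticAt_const.mul analyticAt_id
    rcases hf with rfl | ⟨k, -, rfl | rfl⟩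
    · exact fun x _ => analyticAt_const
    · exact fun x _ => Real.analyticAt_sin.comp (hl k x)
    · exact fun x _ => Real.analyticAt_cos.comp (hl k x)
  | zero => exact fun x _ => analyticAt_const
  | add f g _ _ hf hg => exact hf.add hg
  | smul c f _ hf => exact fun x hx => analyticAt_const.smul (hf x hx)

theorem periodic_of_mem_diffZero {f : ℝ → ℝ} (hf : f ∈ diffZero) :
    Periodic f (2 * Real.pi) := by
  induction hf using Submodule.span_induction with
  | mem f hf =>
    rcases hf with rfl | ⟨k, -, rfl | rfl⟩
    · exact fun x => rfl
    · exact fun x => by rw [vS, mul_add]; exact Real.sin_add_nat_mul_two_pi _ k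
    · exact fun x => by rw [vC, mul_add]; exact Real.cos_add_nat_mul_two_pi _ k
  | zero => exact fun x => rfl
  | add f g _ _ hf hg => exact hf.add hg
  | smul c f _ hf => exact hf.smul c

theorem hasDerivAt_of_mem_diffZero {f : ℝ → ℝ} (hf : f ∈ diffZero) (x : ℝ) :
    HasDerivAt f (deriv f x) x :=
  (analyticOnNhd_of_mem_diffZero hf x trivial).differentiableAt.hasDerivAt

/-- At a zero `x` of `h ≠ 0` with `a x ≠ 0`, the order of vanishing of `a h'` is smaller than that
of `b h`. -/
theorem eq_zero_of_mul_deriv_eq_mul {a b h : ℝ → ℝ} {x : ℝ} (ha : AnalyticAt ℝ a x)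
    (hb : AnalyticAt ℝ b x) (hh : AnalyticOnNhd ℝ h Set.univ) (hax : a x ≠ 0) (hx : h x = 0)
    (e : ∀ y, a y * deriv h y = b y * h y) : h = 0 := by
  have hh' := hh x trivial
  have h1 := hh'.analyticOrderAt_deriv_add_one
  simp only [hx, sub_zero] at h1
  have h2 := congrArg (fun u => analyticOrderAt u x)
    (show a * deriv h = b * h from funext e)
  simp only [analyticOrderAt_mul ha hh'.deriv, analyticOrderAt_mul hb hh',
    ha.analyticOrderAt_eq_zero.2 hax, zero_add] at h2
  refine hh.eq_of_eventuallyEq (fun x _ => analyticAt_const) (z₀ := x) ?_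
  refine analyticOrderAt_eq_top.1 ?_
  by_contra htop
  have h3 : analyticOrderAt (deriv h) x ≠ ⊤ := fun h => htop (by rw [← h1, h]; rfl)
  have h4 : analyticOrderAt (deriv h) x + 1 ≤ analyticOrderAt (deriv h) x := by
    conv_rhs => rw [h2]
    rw [h1]
    exact le_add_self
  exact absurd ((ENat.add_one_le_iff h3).1 h4) (lt_irrefl _)

section bracket

variable {f g h k : ℝ → ℝ}

theorem bracket_smul_add (hf : f ∈ diffZero) (hg : g ∈ diffZero) (a b : ℝ) :
    bracket h (a • f + b • g) = a • bracket h f + b • bracket h g := by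
  funext x
  have h1 : deriv (a • f + b • g) x = a * deriv f x + b * deriv g x :=
    (((hasDerivAt_of_mem_diffZero hf x).const_smul a).add
      ((hasDerivAt_of_mem_diffZero hg x).const_smul b)).deriv
  simp only [bracket, h1, Pi.add_apply, Pi.smul_apply, smul_eq_mul]
  ring

theorem bracket_self : bracket f f = 0 := funext fun _ => sub_self _

theorem bracket_symm : bracket f g = -bracket g f := funext fun x => by
  simp [bracket]

theorem bracket_vT : bracket vT f = deriv f := funext fun x => by
  have : deriv vT x = 0 := deriv_const x 1
  simp [bracket, this, vT]

theorem bracket_smul_left (hf : f ∈ diffZero) (a : ℝ) :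
    bracket (a • f) g = a • bracket f g := by
  funext x
  have h1 : deriv (a • f) x = a * deriv f x :=
    ((hasDerivAt_of_mem_diffZero hf x).const_smul a).deriv
  simp only [bracket, h1, Pi.smul_apply, smul_eq_mul]
  ring

/-- Commuting vector fields on the line are proportional. -/
theorem exists_smul_of_bracket_eq_zero (hf : f ∈ diffZero) (hg : g ∈ diffZero) (hf0 : f ≠ 0)
    (h : bracket f g = 0) : ∃ c : ℝ, g = c • f := by
  obtain ⟨x, hx⟩ := Function.ne_iff.1 hf0
  replace hx : f x ≠ 0 := hx
  have hk : g - (g x / f x) • f ∈ diffZero := sub_mem hg (diffZero.smul_mem _ hf)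
  refine ⟨g x / f x, sub_eq_zero.1 ?_⟩
  have haf := analyticOnNhd_of_mem_diffZero hf
  refine eq_zero_of_mul_deriv_eq_mul (x := x) (haf x trivial) (haf.deriv x trivial)
    (analyticOnNhd_of_mem_diffZero hk) hx (by simp [hx]) fun y => ?_
  have h1 := bracket_smul_add (h := f) hg hf 1 (-(g x / f x))
  rw [h, bracket_self, smul_zero, smul_zero, add_zero, one_smul, neg_smul, ← sub_eq_add_neg] at h1
  have h2 := congrFun h1 y
  simp only [bracket, Pi.zero_apply] at h2
  linarith

/-- If `[k, h] = h ≠ 0`, then `k` and `h` have a common zero: otherwise `h` would have no zero at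
all, and the periodic function `k / h`, with derivative `-1 / h`, would be strictly monotone. -/
theorem exists_common_zero (hk : k ∈ diffZero) (hh : h ∈ diffZero) (h0 : h ≠ 0)
    (e : bracket k h = h) : ∃ x, k x = 0 ∧ h x = 0 := by
  have ak := analyticOnNhd_of_mem_diffZero hk
  have ah := analyticOnNhd_of_mem_diffZero hh
  have e' : ∀ y, k y * deriv h y - h y * deriv k y = h y := congrFun e
  by_cases hz : ∃ x, h x = 0
  · obtain ⟨x, hx⟩ := hz
    refine ⟨x, by_contra fun hkx => h0 ?_, hx⟩
    refine eq_zero_of_mul_deriv_eq_mul (b := fun y => 1 + deriv k y) (ak x trivial)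
      (analyticAt_const.add (ak.deriv x trivial)) ah hkx hx fun y => ?_
    linarith [e' y]
  · push Not at hz
    exfalso
    have hd : ∀ y, HasDerivAt (fun y => k y / h y) (-(h y)⁻¹) y := fun y => by
      refine ((hasDerivAt_of_mem_diffZero hk y).div (hasDerivAt_of_mem_diffZero hh y)
        (hz y)).congr_deriv ?_
      have := hz y
      field_simp
      linarith [e' y]
    obtain ⟨c, -, hc⟩ := exists_hasDerivAt_eq_zero (a := 0) (b := 2 * Real.pi)
      Real.two_pi_pos (fun y _ => (hd y).continuousAt.continuousWithinAt) (by
        have h1 := periodic_of_mem_diffZero hk 0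
        have h2 := periodic_of_mem_diffZero hh 0
        rw [zero_add] at h1 h2
        simp only [h1, h2]) fun y _ => hd y
    exact hz c (by simpa using hc)

end bracket

/-- A Lie algebra of trigonometric vector fields of dimension at most two either consists of the
multiples of one vector field or has a common zero. -/
theorem common_zero_or_multiples {𝔤 : Submodule ℝ (ℝ → ℝ)} (h𝔤 : IsFinDimSubalgebra 𝔤)
    (hdim : ∀ f ∈ 𝔤, ∀ g ∈ 𝔤, LinearIndependent ℝ ![f, g] →
      ∀ k ∈ 𝔤, ∃ a b : ℝ, k = a • f + b • g) :
    (∃ x, ∀ f ∈ 𝔤, f x = 0) ∨ ∃ f ∈ diffZero, ∀ g ∈ 𝔤, ∃ c : ℝ, g = c • f := by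
  have hsub := h𝔤.le_diffZero
  by_cases hab : ∀ f ∈ 𝔤, ∀ g ∈ 𝔤, bracket f g = 0
  · right
    by_cases h0 : ∃ f ∈ 𝔤, f ≠ 0
    · obtain ⟨f, hf, hf0⟩ := h0
      exact ⟨f, hsub hf, fun g hg =>
        exists_smul_of_bracket_eq_zero (hsub hf) (hsub hg) hf0 (hab f hf g hg)⟩
    · push Not at h0
      exact ⟨0, zero_mem _, fun g hg => ⟨0, by simp [h0 g hg]⟩⟩
  · left
    push Not at hab
    have hli : ∀ f ∈ 𝔤, ∀ g ∈ 𝔤, bracket f g ≠ 0 → LinearIndependent ℝ ![f, g] := by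
      intro f hf g hg h
      have hf0 : f ≠ 0 := by
        rintro rfl
        refine h (funext fun x => ?_)
        have : deriv (0 : ℝ → ℝ) x = 0 := deriv_const x 0
        simp [bracket, this]
      rw [LinearIndependent.pair_iff' hf0]
      rintro a rfl
      refine h ?_
      have := bracket_smul_add (h := f) (hsub hf) (hsub hf) a 0
      simpa [bracket_self] using this
    -- the derived algebra is spanned by a single `h`, and some `k` satisfies `[k, h] = h`
    obtain ⟨k, hk, h, hh, h0, e⟩ : ∃ k ∈ 𝔤, ∃ h ∈ 𝔤, h ≠ 0 ∧ bracket k h = h := by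
      obtain ⟨f, hf, g, hg, hfg⟩ := hab
      have hh := h𝔤.bracket_mem f hf g hg
      obtain ⟨a, b, e⟩ := hdim f hf g hg (hli f hf g hg hfg) _ hh
      by_cases hb : b = 0
      · have ha : a ≠ 0 := by
          rintro rfl
          exact hfg (by rw [e, hb, zero_smul, zero_smul, add_zero])
        refine ⟨(-a⁻¹) • g, 𝔤.smul_mem _ hg, _, hh, hfg, ?_⟩
        have h1 := bracket_smul_add (h := g) (hsub hf) (hsub hg) a b
        rw [bracket_self, smul_zero, add_zero, ← e, bracket_symm (f := g) (g := f)] at h1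
        rw [bracket_smul_left (hsub hg), h1, smul_smul, smul_neg, neg_mul, neg_smul,
          inv_mul_cancel₀ ha, one_smul, neg_neg]
      · refine ⟨b⁻¹ • f, 𝔤.smul_mem _ hf, _, hh, hfg, ?_⟩
        have h1 := bracket_smul_add (h := f) (hsub hf) (hsub hg) a b
        rw [bracket_self, smul_zero, zero_add, ← e] at h1
        rw [bracket_smul_left (hsub hf), h1, smul_smul, inv_mul_cancel₀ hb, one_smul]
    obtain ⟨x, hkx, hhx⟩ := exists_common_zero (hsub hk) (hsub hh) h0 e
    refine ⟨x, fun f hf => ?_⟩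
    obtain ⟨a, b, rfl⟩ := hdim k hk h hh (hli k hk h hh (by rwa [e])) f hf
    simp [hkx, hhx]

theorem IsFinDimSubalgebra.exists_degree_bound {𝔤 : Submodule ℝ (ℝ → ℝ)}
    (h𝔤 : IsFinDimSubalgebra 𝔤) : ∃ M : ℕ, ∀ f ∈ 𝔤, ∀ m : ℤ, M < m → trigCoeff f m = 0 := by
  have hfg : 𝔤.FG := Submodule.fg_iff_finiteDimensional _ |>.2 h𝔤.finiteDimensional
  obtain ⟨s, hs⟩ := hfg
  have hsz : ∀ f ∈ s, f ∈ diffZero := fun f hf =>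
    h𝔤.le_diffZero (hs ▸ Submodule.subset_span hf)
  have : ∀ f : ℝ → ℝ, ∃ M : ℕ, f ∈ s → ∀ m : ℤ, M < m → trigCoeff f m = 0 := fun f => by
    by_cases hf : f ∈ s
    · obtain ⟨M, hM⟩ := exists_trigCoeff_eq_zero (hsz f hf)
      exact ⟨M, fun _ => hM⟩
    · exact ⟨0, fun h => absurd h hf⟩
  choose M hM using this
  refine ⟨s.sup M, fun f hf => ?_⟩
  have hle : Submodule.span ℝ (s : Set (ℝ → ℝ)) ≤ diffZero := hs ▸ h𝔤.le_diffZero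
  rw [← hs] at hf
  induction hf using Submodule.span_induction with
  | mem f hf =>
    intro m hm
    have := Finset.le_sup (f := M) hf
    exact hM f hf m (by omega)
  | zero => intro m _; rw [IsTrig.zero.trigCoeff]; rfl
  | add f g hf hg h1 h2 =>
    intro m hm
    rw [trigCoeff_add (hle hf) (hle hg), h1 m hm, h2 m hm, add_zero]
  | smul c f hf h1 =>
    intro m hm
    rw [trigCoeff_smul c (hle hf), h1 m hm, mul_zero]

theorem eq_smul_vT {f : ℝ → ℝ} (hf : f ∈ diffZero) (h : ∀ n : ℤ, 0 < n → trigCoeff f n = 0) :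
    f = (trigCoeff f 0).re • vT := by
  refine eq_of_trigCoeff hf (diffZero.smul_mem _ vT_mem_diffZero) fun n hn => ?_
  rw [(isTrig_vT.smul _).trigCoeff]
  rcases hn.eq_or_lt with rfl | hn
  · have h0 := trigCoeff_neg hf 0
    rw [neg_zero] at h0
    simp [Complex.conj_eq_iff_re.1 h0.symm]
  · rw [h n hn]
    simp only [AddMonoidAlgebra.coeff_smul, AddMonoidAlgebra.coeff_single, Finsupp.smul_apply,
      Finsupp.single_apply, hn.ne, if_false, smul_zero]

/-- In a Lie algebra whose elements have degree at most `N`, with `N ≥ 1` attained by `f`, an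
element `g` of smaller degree is constant: if its degree were `n ≥ 1`, then `[f, g]` would have the
degree `N + n > N`. -/
theorem eq_smul_vT_of_trigCoeff_eq_zero {𝔤 : Submodule ℝ (ℝ → ℝ)} (h𝔤 : IsFinDimSubalgebra 𝔤)
    {N : ℕ} (hN : ∀ f ∈ 𝔤, ∀ m : ℤ, N < m → trigCoeff f m = 0) {f g : ℝ → ℝ} (hf : f ∈ 𝔤)
    (hfN : trigCoeff f N ≠ 0) (hg : g ∈ 𝔤) (hgN : trigCoeff g N = 0) :
    g = (trigCoeff g 0).re • vT := by
  have hsub := h𝔤.le_diffZero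
  refine eq_smul_vT (hsub hg) ?_
  by_contra hcon
  push Not at hcon
  obtain ⟨n₀, hn₀, hgn₀⟩ := hcon
  obtain ⟨n, ⟨hn, hgn⟩, hmax⟩ := Int.exists_greatest_of_bdd
    (P := fun n => 0 < n ∧ trigCoeff g n ≠ 0)
    ⟨N, fun z hz => not_lt.1 fun h => hz.2 (hN g hg z h)⟩ ⟨n₀, hn₀, hgn₀⟩
  have hnN : n ≠ N := fun h => hgn (h ▸ hgN)
  have h1 := trigCoeff_bracket (hsub hf) (hsub hg) (hN f hf) (n := n) fun m hm => by
    by_contra h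
    exact absurd (hmax m ⟨hn.trans hm, h⟩) (not_le.2 hm)
  rw [hN _ (h𝔤.bracket_mem f hf g hg) _ (by omega)] at h1
  have h2 : ((n : ℂ) - (N : ℤ)) ≠ 0 := by
    rw [sub_ne_zero]
    exact_mod_cast hnN
  exact mul_ne_zero (mul_ne_zero Complex.I_ne_zero h2) (mul_ne_zero hfN hgn) h1.symm

/-- The case in which `𝔤` contains `T` and is not spanned by it. -/
theorem span_generators_of_vT_mem {𝔤 : Submodule ℝ (ℝ → ℝ)} (h𝔤 : IsFinDimSubalgebra 𝔤)
    {N : ℕ} (hN1 : 1 ≤ N) (hN : ∀ f ∈ 𝔤, ∀ m : ℤ, N < m → trigCoeff f m = 0) {f : ℝ → ℝ}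
    (hf : f ∈ 𝔤) (hfN : trigCoeff f N ≠ 0) (hT : vT ∈ 𝔤) :
    generators N ⊆ 𝔤 ∧ 𝔤 ≤ Submodule.span ℝ (generators N) := by
  have hsub := h𝔤.le_diffZero
  have hN0 : (N : ℝ) ≠ 0 := by exact_mod_cast (by omega : N ≠ 0)
  have hderiv : ∀ g ∈ 𝔤, deriv g ∈ 𝔤 := fun g hg => bracket_vT (f := g) ▸ h𝔤.bracket_mem _ hT g hg
  -- every element is a combination of `T`, `C_N` and `S_N`, because `g'' + N² g` has degree `< N`
  have key : ∀ g ∈ 𝔤, g = (trigCoeff g 0).re • vT + ((2 * (trigCoeff g N).re) • vC N +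
      (-(2 * (trigCoeff g N).im)) • vS N) := by
    intro g hg
    have hg' := hderiv g hg
    have hg'' := hderiv _ hg'
    have hs := 𝔤.smul_mem ((N : ℝ) ^ 2) hg
    have hc : ∀ n : ℤ, trigCoeff (deriv (deriv g) + ((N : ℝ) ^ 2) • g) n =
        ((N : ℂ) ^ 2 - n ^ 2) * trigCoeff g n := fun n => by
      rw [trigCoeff_add (hsub hg'') (hsub hs), trigCoeff_smul _ (hsub hg),
        trigCoeff_deriv (hsub hg'), trigCoeff_deriv (hsub hg)]
      push_cast
      linear_combination (n : ℂ) ^ 2 * trigCoeff g n * Complex.I_sq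
    have hT' := eq_smul_vT_of_trigCoeff_eq_zero h𝔤 hN hf hfN (add_mem hg'' hs) (by
      rw [hc]; push_cast; ring)
    refine eq_of_trigCoeff (hsub hg) (add_mem (diffZero.smul_mem _ vT_mem_diffZero)
      (add_mem (diffZero.smul_mem _ (vC_mem_diffZero hN1))
        (diffZero.smul_mem _ (vS_mem_diffZero hN1)))) fun n hn => ?_
    rw [trigCoeff_combination hN1 _ _ _ hn]
    rcases hn.eq_or_lt with rfl | hn'
    · have h0 := trigCoeff_neg (hsub hg) 0
      rw [neg_zero] at h0
      have : ¬ (0 : ℤ) = N := by omega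
      simp [Complex.conj_eq_iff_re.1 h0.symm, this]
    by_cases hnN : n = N
    · subst hnN
      have : ¬ (N : ℤ) = 0 := by omega
      rw [if_neg this, if_pos rfl]
      conv_lhs => rw [← Complex.re_add_im (trigCoeff g N)]
      push_cast
      ring
    · rw [if_neg hn'.ne', if_neg hnN, add_zero]
      have h1 := hc n
      rw [hT', (isTrig_vT.smul _).trigCoeff] at h1
      simp only [AddMonoidAlgebra.coeff_smul, AddMonoidAlgebra.coeff_single, Finsupp.smul_apply,
        Finsupp.single_apply, hn'.ne, if_false, smul_zero] at h1
      refine (mul_eq_zero.1 h1.symm).resolve_left fun h => ?_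
      have h2 : (N : ℤ) ^ 2 = n ^ 2 := by exact_mod_cast sub_eq_zero.1 h
      exact hnN ((pow_left_inj₀ hn (by omega) two_ne_zero).1 h2.symm)
  constructor
  · -- `b C + d S` and its derivative `N (d C - b S)` span `C` and `S`
    have e := key f hf
    set b := 2 * (trigCoeff f N).re with hb
    set d := -(2 * (trigCoeff f N).im) with hd
    have hbd : b ^ 2 + d ^ 2 ≠ 0 := fun h => hfN (by
      have hb0 : b = 0 := by nlinarith [sq_nonneg b, sq_nonneg d]
      have hd0 : d = 0 := by nlinarith [sq_nonneg b, sq_nonneg d]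
      apply Complex.ext
      · simpa [hb] using hb0
      · simpa [hd] using hd0)
    have h1 : b • vC N + d • vS N ∈ 𝔤 := by
      have : b • vC N + d • vS N = f - (trigCoeff f 0).re • vT :=
        eq_sub_of_add_eq (by rw [add_comm]; exact e.symm)
      rw [this]
      exact sub_mem hf (𝔤.smul_mem _ hT)
    have h2 : d • vC N - b • vS N ∈ 𝔤 := by
      have hd : deriv (b • vC N + d • vS N) = (N : ℝ) • (d • vC N - b • vS N) := by
        funext x
        have hl : HasDerivAt (fun φ : ℝ => (N : ℝ) * φ) N x := by
          simpa using (hasDerivAt_id x).const_mul (N : ℝ)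
        have hC : HasDerivAt (vC N) _ x := hl.cos
        have hS : HasDerivAt (vS N) _ x := hl.sin
        rw [((hC.const_smul b).add (hS.const_smul d)).deriv]
        simp only [vC, vS, Pi.smul_apply, Pi.sub_apply, smul_eq_mul]
        ring
      have := 𝔤.smul_mem (N : ℝ)⁻¹ (hderiv _ h1)
      rwa [hd, smul_smul, inv_mul_cancel₀ hN0, one_smul] at this
    have hC : vC N ∈ 𝔤 := by
      have : vC N = (b ^ 2 + d ^ 2)⁻¹ • (b • (b • vC N + d • vS N) +
          d • (d • vC N - b • vS N)) := by
        rw [eq_inv_smul_iff₀ hbd]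
        module
      rw [this]
      exact 𝔤.smul_mem _ (add_mem (𝔤.smul_mem _ h1) (𝔤.smul_mem _ h2))
    have hS : vS N ∈ 𝔤 := by
      have : vS N = (b ^ 2 + d ^ 2)⁻¹ • (d • (b • vC N + d • vS N) -
          b • (d • vC N - b • vS N)) := by
        rw [eq_inv_smul_iff₀ hbd]
        module
      rw [this]
      exact 𝔤.smul_mem _ (sub_mem (𝔤.smul_mem _ h1) (𝔤.smul_mem _ h2))
    rintro g (rfl | rfl | rfl)
    exacts [𝔤.smul_mem _ hT, 𝔤.smul_mem _ hS, 𝔤.smul_mem _ hC]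
  · intro g hg
    have hmem : ∀ v, (N : ℝ)⁻¹ • v ∈ generators N → v ∈ Submodule.span ℝ (generators N) :=
      fun v hv => by
        have := Submodule.smul_mem _ (N : ℝ) (Submodule.subset_span (R := ℝ) hv)
        rwa [smul_smul, mul_inv_cancel₀ hN0, one_smul] at this
    rw [key g hg]
    exact add_mem (Submodule.smul_mem _ _ (hmem _ (Or.inl rfl)))
      (add_mem (Submodule.smul_mem _ _ (hmem _ (Or.inr (Or.inr rfl))))
        (Submodule.smul_mem _ _ (hmem _ (Or.inr (Or.inl rfl)))))

/-- The finite-dimensional Lie algebras of trigonometric vector fields: either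
`span (T, S_N, C_N)` for some `N ≥ 1`, or too small for transitivity. -/
theorem IsFinDimSubalgebra.classification {𝔤 : Submodule ℝ (ℝ → ℝ)}
    (h𝔤 : IsFinDimSubalgebra 𝔤) :
    (∃ N : ℕ, 1 ≤ N ∧ generators N ⊆ 𝔤 ∧ 𝔤 ≤ Submodule.span ℝ (generators N)) ∨
      (∃ x, ∀ f ∈ 𝔤, f x = 0) ∨ ∃ f ∈ diffZero, ∀ g ∈ 𝔤, ∃ c : ℝ, g = c • f := by
  classical
  have hsub := h𝔤.le_diffZero
  have hex := h𝔤.exists_degree_bound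
  let N := Nat.find hex
  have hN : ∀ f ∈ 𝔤, ∀ m : ℤ, N < m → trigCoeff f m = 0 := Nat.find_spec hex
  rcases Nat.eq_zero_or_pos N with h0 | hpos
  · rw [h0] at hN
    exact Or.inr (Or.inr ⟨vT, vT_mem_diffZero, fun g hg =>
      ⟨_, eq_smul_vT (hsub hg) fun n hn => hN g hg n (by simpa using hn)⟩⟩)
  obtain ⟨f, hf, hfN⟩ : ∃ f ∈ 𝔤, trigCoeff f N ≠ 0 := by
    by_contra hcon
    push Not at hcon
    refine Nat.find_min hex (m := N - 1) (by omega) fun f hf m hm => ?_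
    rcases eq_or_ne m N with rfl | hmN
    · exact hcon f hf
    · exact hN f hf m (by omega)
  by_cases hT : vT ∈ 𝔤
  · exact Or.inl ⟨N, hpos, span_generators_of_vT_mem h𝔤 hpos hN hf hfN hT⟩
  · refine Or.inr (common_zero_or_multiples h𝔤 ?_)
    -- the coefficient of index `N` embeds `𝔤` into `ℂ`
    let c : 𝔤 →ₗ[ℝ] ℂ :=
      { toFun := fun f => trigCoeff f.1 N
        map_add' := fun f g => trigCoeff_add (hsub f.2) (hsub g.2) N
        map_smul' := fun a f => by
          rw [RingHom.id_apply, Complex.real_smul]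
          exact trigCoeff_smul a (hsub f.2) N }
    have hc : Injective c := by
      rw [← LinearMap.ker_eq_bot, LinearMap.ker_eq_bot']
      intro g hg
      have h1 := eq_smul_vT_of_trigCoeff_eq_zero h𝔤 hN hf hfN g.2 hg
      by_cases hr : (trigCoeff g.1 0).re = 0
      · rw [hr, zero_smul] at h1
        exact Subtype.ext h1
      · refine absurd ?_ hT
        have := 𝔤.smul_mem (trigCoeff g.1 0).re⁻¹ g.2
        rwa [h1, smul_smul, ← h1, inv_mul_cancel₀ hr, one_smul] at this
    have := h𝔤.finiteDimensional
    have hle := LinearMap.finrank_le_finrank_of_injective hc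
    rw [Complex.finrank_real_complex] at hle
    intro f hf g hg hli k hk
    have hli' : LinearIndependent ℝ ![(⟨f, hf⟩ : 𝔤), ⟨g, hg⟩] := by
      rw [LinearIndependent.pair_iff] at hli ⊢
      exact fun s t h => hli s t (congrArg Subtype.val h)
    have h2 := hli'.fintype_card_le_finrank
    rw [Fintype.card_fin] at h2
    have h3 := hli'.span_eq_top_of_card_eq_finrank (by
      rw [Fintype.card_fin]; exact le_antisymm h2 hle)
    have h4 : (⟨k, hk⟩ : 𝔤) ∈ Submodule.span ℝ (Set.range ![(⟨f, hf⟩ : 𝔤), ⟨g, hg⟩]) :=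
      h3 ▸ Submodule.mem_top
    rw [Matrix.range_cons, Matrix.range_cons, Matrix.range_empty, Set.union_empty,
      Set.singleton_union, Submodule.mem_span_pair] at h4
    obtain ⟨a, b, e⟩ := h4
    exact ⟨a, b, (congrArg Subtype.val e).symm⟩

end CircleDiff

namespace CircleDiff

open Topology Function Filter

/-! ### The groups generated by the small Lie algebras -/

theorem exists_lipschitzWith_of_mem_diffZero {f : ℝ → ℝ} (hf : f ∈ diffZero) :
    ∃ K, LipschitzWith K f := by
  induction hf using Submodule.span_induction with
  | mem f hf =>
    rcases hf with rfl | ⟨k, -, rfl | rfl⟩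
    · exact ⟨0, LipschitzWith.const 1⟩
    · exact ⟨_, Real.lipschitzWith_sin.comp (lipschitzWith_smul (k : ℝ))⟩
    · exact ⟨_, Real.lipschitzWith_cos.comp (lipschitzWith_smul (k : ℝ))⟩
  | zero => exact ⟨0, LipschitzWith.const 0⟩
  | add f g _ _ hf hg =>
    obtain ⟨K, hK⟩ := hf
    obtain ⟨L, hL⟩ := hg
    exact ⟨_, hK.add hL⟩
  | smul c f _ hf =>
    obtain ⟨K, hK⟩ := hf
    exact ⟨_, (lipschitzWith_smul c).comp hK⟩

theorem eq_of_hasDerivAt_flow {f : ℝ → ℝ} (hf : f ∈ diffZero) {u v : ℝ → ℝ}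
    (hu : ∀ s, HasDerivAt u (f (u s)) s) (hv : ∀ s, HasDerivAt v (f (v s)) s)
    (h0 : u 0 = v 0) (s : ℝ) : u s = v s := by
  obtain ⟨K, hK⟩ := exists_lipschitzWith_of_mem_diffZero hf
  exact congrFun (ODE_solution_unique_univ (v := fun _ => f) (s := fun _ => Set.univ)
    (fun _ => hK.lipschitzOnWith) (fun t => ⟨hu t, trivial⟩) (fun t => ⟨hv t, trivial⟩) h0) s

theorem IsFlowMap.apply_eq_self {χ : Chart} {f : ℝ → ℝ} (hf : f ∈ diffZero) {t x : ℝ}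
    {g : DiffPlus} (hg : IsFlowMap χ f t g) (hx : f x = 0) :
    g.1 (χ.symm (Circle.exp x)) = χ.symm (Circle.exp x) := by
  obtain ⟨Φ, h0, hd, hΦ⟩ := hg
  have h1 := eq_of_hasDerivAt_flow hf (u := fun s => Φ s x) (v := fun _ => x) (fun s => hd s x)
    (fun s => by rw [hx]; exact hasDerivAt_const s x) (h0 x) t
  rw [← χ.symm_apply_apply (g.1 _), hΦ]
  exact congrArg (fun r => χ.symm (Circle.exp r)) h1

/-- The flows of two multiples of one vector field commute. -/
theorem IsFlowMap.commute {χ : Chart} {f : ℝ → ℝ} (hf : f ∈ diffZero) {a b s t : ℝ}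
    {g h : DiffPlus} (hg : IsFlowMap χ (a • f) s g) (hh : IsFlowMap χ (b • f) t h) :
    g * h = h * g := by
  obtain ⟨Φ, hΦ0, hΦd, hΦ⟩ := hg
  obtain ⟨Ψ, hΨ0, hΨd, hΨ⟩ := hh
  have key : ∀ φ, Φ s (Ψ t φ) = Ψ t (Φ s φ) := by
    intro φ
    rcases eq_or_ne a 0 with rfl | ha
    · have h1 : ∀ φ, Φ s φ = φ := fun φ =>
        eq_of_hasDerivAt_flow (zero_mem diffZero) (u := fun r => Φ r φ) (v := fun _ => φ)
          (fun r => by simpa using hΦd r φ) (fun r => hasDerivAt_const r φ) (hΦ0 φ) s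
      rw [h1, h1]
    · -- after a change of time scale, `Φ` also solves the equation of any multiple of `f`
      have h1 : ∀ (c : ℝ) (Θ : ℝ → ℝ → ℝ), (∀ φ, Θ 0 φ = φ) →
          (∀ r φ, HasDerivAt (fun r => Θ r φ) ((c • f) (Θ r φ)) r) → ∀ r r' φ,
          Θ r (Φ r' φ) = Φ (c / a * r + r') φ := by
        intro c Θ h0 hd r r' φ
        refine eq_of_hasDerivAt_flow (diffZero.smul_mem c hf) (u := fun r => Θ r (Φ r' φ))
          (v := fun r => Φ (c / a * r + r') φ) (fun r => hd r _) (fun r => ?_) (by simp [h0]) r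
        have hl : HasDerivAt (fun r => c / a * r + r') (c / a) r := by
          simpa using ((hasDerivAt_id r).const_mul (c / a)).add_const r'
        refine ((hΦd (c / a * r + r') φ).comp r hl).congr_deriv ?_
        simp only [Pi.smul_apply, smul_eq_mul]
        field_simp
      have h2 := h1 b Ψ hΨ0 hΨd t 0 φ
      rw [hΦ0] at h2
      rw [h2, h1 a Φ hΦ0 hΦd, h1 b Ψ hΨ0 hΨd, div_self ha]
      ring_nf
  refine Subtype.ext (Equiv.ext fun z => χ.injective ?_)
  obtain ⟨φ, hφ⟩ := Circle.exp_surjective (χ z)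
  have hz : z = χ.symm (Circle.exp φ) := by rw [hφ, χ.symm_apply_apply]
  have e1 : ∀ (k : DiffPlus) (Θ : ℝ → ℝ), (∀ φ, χ (k.1 (χ.symm (Circle.exp φ))) =
      Circle.exp (Θ φ)) → ∀ φ, k.1 (χ.symm (Circle.exp φ)) = χ.symm (Circle.exp (Θ φ)) :=
    fun k Θ hk φ => by rw [← hk, χ.symm_apply_apply]
  change χ (g.1 (h.1 z)) = χ (h.1 (g.1 z))
  rw [hz, e1 g _ hΦ, e1 h _ hΨ, hΦ, hΨ, key]

theorem not_liftTransitive_of_common_zero {χ : Chart} {X : Set (ℝ → ℝ)} (hX : X ⊆ diffZero)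
    {x : ℝ} (hx : ∀ f ∈ X, f x = 0) : ¬ LiftTransitive (generatedBy χ X) := by
  refine not_liftTransitive_of_fixed (q := χ.symm (Circle.exp x)) fun g hg => ?_
  induction hg using Subgroup.closure_induction with
  | mem g hg =>
    obtain ⟨f, hf, t, hg⟩ := hg
    exact hg.apply_eq_self (hX hf) (hx f hf)
  | one => rfl
  | mul g h _ _ hg hh =>
    change g.1 (h.1 _) = _
    rw [hh, hg]
  | inv g _ hg => exact g.1.symm_apply_eq.2 hg.symm

theorem not_liftTransitive_of_multiples {χ : Chart} {X : Set (ℝ → ℝ)} {f : ℝ → ℝ}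
    (hf : f ∈ diffZero) (hX : ∀ g ∈ X, ∃ c : ℝ, g = c • f) :
    ¬ LiftTransitive (generatedBy χ X) := by
  have h1 : generatedBy χ X ≤ Subgroup.centralizer (generatedBy χ X) := by
    have h2 : generatedBy χ X ≤
        Subgroup.centralizer {g | ∃ f ∈ X, ∃ t : ℝ, IsFlowMap χ f t g} := by
      refine (Subgroup.closure_le _).2 ?_
      rintro g ⟨_, hu, t, hg⟩ h ⟨_, hv, s, hh⟩
      obtain ⟨a, rfl⟩ := hX _ hu
      obtain ⟨b, rfl⟩ := hX _ hv
      exact hh.commute hf hg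
    rwa [← Subgroup.centralizer_closure] at h2
  exact not_liftTransitive_of_commute fun g hg k hk => (h1 hg k hk).symm

/-! ### The group generated by `l⁻¹ T`, `l⁻¹ S_l`, `l⁻¹ C_l` -/

theorem generatedBy_eq_comap_lorentzLifts (χ : Chart) {l : ℕ} [NeZero l] {X : Set (ℝ → ℝ)}
    (h1 : generators l ⊆ X) (h2 : X ⊆ Submodule.span ℝ (generators l)) :
    generatedBy χ X = (lorentzLifts l).comap (chartConj χ) := by
  rw [generatedBy_eq_comap, generatedBy_eq_lorentzLifts h1 h2]

theorem isFinDimSubalgebra_span_generators {l : ℕ} (hl : 1 ≤ l) :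
    IsFinDimSubalgebra (Submodule.span ℝ (generators l)) where
  le_diffZero := by
    refine Submodule.span_le.2 ?_
    rintro f (rfl | rfl | rfl)
    exacts [diffZero.smul_mem _ vT_mem_diffZero, diffZero.smul_mem _ (vS_mem_diffZero hl),
      diffZero.smul_mem _ (vC_mem_diffZero hl)]
  finiteDimensional := FiniteDimensional.span_of_finite ℝ (by simp [generators])
  bracket_mem := by
    intro f hf g hg
    have hl0 : (l : ℝ) ≠ 0 := by exact_mod_cast (by omega : l ≠ 0)
    obtain ⟨a, b, c, hf⟩ := mem_span_generators hf
    obtain ⟨a', b', c', hg⟩ := mem_span_generators hg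
    have hd : ∀ (a b c φ : ℝ), deriv (fun φ => a + b * Real.sin (l * φ) + c * Real.cos (l * φ)) φ =
        l * (b * Real.cos (l * φ) - c * Real.sin (l * φ)) := fun a b c φ => by
      have h : HasDerivAt (fun φ : ℝ => (l : ℝ) * φ) l φ := by
        simpa using (hasDerivAt_id φ).const_mul (l : ℝ)
      have h1 := ((h.sin.const_mul b).const_add a).fun_add (h.cos.const_mul c)
      rw [h1.deriv]
      ring
    refine Submodule.mem_span_triple.2 ⟨l ^ 2 * (b' * c - b * c'), l ^ 2 * (a' * c - a * c'),
      l ^ 2 * (a * b' - a' * b), funext fun φ => ?_⟩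
    rw [bracket, funext hf, funext hg, hd, hd]
    simp only [vT, vS, vC, Pi.add_apply, Pi.smul_apply, smul_eq_mul]
    field_simp
    linear_combination (-(b' * c - b * c')) * Real.sin_sq_add_cos_sq (l * φ)

theorem isFinDimSubgroupIn_generatedBy (χ : Chart) {l : ℕ} (hl : 1 ≤ l) :
    IsFinDimSubgroupIn χ (generatedBy χ (generators l)) := by
  have : NeZero l := ⟨by omega⟩
  refine ⟨_, isFinDimSubalgebra_span_generators hl, ?_⟩
  rw [generatedBy_eq_comap_lorentzLifts χ subset_rfl Submodule.subset_span,
    generatedBy_eq_comap_lorentzLifts χ Submodule.subset_span subset_rfl]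

theorem liftTransitive_generatedBy (χ : Chart) {l : ℕ} (hl : 1 ≤ l) :
    LiftTransitive (generatedBy χ (generators l)) := by
  have : NeZero l := ⟨by omega⟩
  rw [generatedBy_eq_comap_lorentzLifts χ subset_rfl Submodule.subset_span]
  exact (liftTransitive_lorentzLifts l).comap_chartConj χ

theorem isFoldCoveringGroup_generatedBy (χ : Chart) {l : ℕ} (hl : 1 ≤ l) :
    IsFoldCoveringGroup l (generatedBy χ (generators l)) SOup := by
  have : NeZero l := ⟨by omega⟩
  rw [generatedBy_eq_comap_lorentzLifts χ subset_rfl Submodule.subset_span]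
  let e : (lorentzLifts l).comap (chartConj χ) ≃* lorentzLifts l :=
    { toFun := fun g => ⟨chartConj χ g.1, g.2⟩
      invFun := fun h => ⟨chartConj χ.symm h.1, by
        rw [Subgroup.mem_comap, chartConj_chartConj_symm]
        exact h.2⟩
      left_inv := fun g => Subtype.ext (chartConj_symm_chartConj χ g.1)
      right_inv := fun h => Subtype.ext (chartConj_chartConj_symm χ h.1)
      map_mul' := fun g h => Subtype.ext (map_mul (chartConj χ) g.1 h.1) }
  exact (isFoldCoveringGroup_lorentzLifts l).of_mulEquiv e
    (((continuous_chartConj χ).comp continuous_subtype_val).subtype_mk _)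
    (((continuous_chartConj χ.symm).comp continuous_subtype_val).subtype_mk _)

/-- By the classification of the Lie algebras, transitivity leaves only `span (T, S_N, C_N)`. -/
theorem exists_eq_generatedBy {χ : Chart} {G : Subgroup DiffPlus} (hG : IsFinDimSubgroupIn χ G)
    (ht : LiftTransitive G) : ∃ N : ℕ, 1 ≤ N ∧ G = generatedBy χ (generators N) := by
  obtain ⟨𝔤, h𝔤, rfl⟩ := hG
  rcases h𝔤.classification with ⟨N, hN, h1, h2⟩ | ⟨x, hx⟩ | ⟨f, hf, h⟩
  · have : NeZero N := ⟨by omega⟩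
    refine ⟨N, hN, ?_⟩
    rw [generatedBy_eq_comap_lorentzLifts χ h1 h2,
      generatedBy_eq_comap_lorentzLifts χ subset_rfl Submodule.subset_span]
  · exact absurd ht (not_liftTransitive_of_common_zero h𝔤.le_diffZero hx)
  · exact absurd ht (not_liftTransitive_of_multiples hf h)

end CircleDiff

theorem theorem3 :
    (∀ (χ : CircleDiff.Chart) (G : Subgroup CircleDiff.DiffPlus),
      CircleDiff.IsFinDimSubgroupIn χ G → CircleDiff.LiftTransitive G →
        (∃ l : ℕ, 1 ≤ l ∧ CircleDiff.IsFoldCoveringGroup l G CircleDiff.SOup) ∧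
        ∀ l : ℕ, 1 ≤ l →
          (CircleDiff.IsFoldCoveringGroup l G CircleDiff.SOup ↔
            G = CircleDiff.generatedBy χ (CircleDiff.generators l))) ∧
    (∀ (χ : CircleDiff.Chart) (l : ℕ), 1 ≤ l →
      CircleDiff.IsFinDimSubgroupIn χ
          (CircleDiff.generatedBy χ (CircleDiff.generators l)) ∧
        CircleDiff.LiftTransitive (CircleDiff.generatedBy χ (CircleDiff.generators l)) ∧
        CircleDiff.IsFoldCoveringGroup l
          (CircleDiff.generatedBy χ (CircleDiff.generators l)) CircleDiff.SOup) := by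
  refine ⟨fun χ G hG ht => ?_, fun χ l hl =>
    ⟨CircleDiff.isFinDimSubgroupIn_generatedBy χ hl, CircleDiff.liftTransitive_generatedBy χ hl,
      CircleDiff.isFoldCoveringGroup_generatedBy χ hl⟩⟩
  obtain ⟨N, hN, rfl⟩ := CircleDiff.exists_eq_generatedBy hG ht
  have hc := CircleDiff.isFoldCoveringGroup_generatedBy χ hN
  refine ⟨⟨N, hN, hc⟩, fun l hl => ⟨fun h => ?_, fun h => ?_⟩⟩
  · -- the number of sheets is the order of the center
    rw [← h.card_center, hc.card_center]
  · rw [h]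
    exact CircleDiff.isFoldCoveringGroup_generatedBy χ hl
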